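/- **Theorem (Darboux–Moser–Weinstein for Lie algebroids).** *Conventions.* Manifolds are smooth, real, finite-dimensional, Hausdorff and second countable, without boundary unless it is mentioned. A submanifold $N$ of $M$ is injectively immersed (not necessarily embedded). A Lie algebroid $A\to M$ is a smooth real vector bundle with a Lie bracket on $\Gamma(A)$ and a smooth vector bundle map (anchor) $\mathrm{an}_A\colon A\to TM$ such that $[\sigma,f\tau]=f[\sigma,\tau]+(\mathrm{an}_A(\sigma)\cdot f)\,\tau$ for $\sigma,\tau\in\Gamma(A)$, $f\in C^\infty(M)$; the bracket is local, so $A$ restricts to a Lie algebroid $A|_U$ over every open $U\subseteq M$. A Lie subalgebroid of $A$ is a subbundle $B\to N$ of $A$ over a submanifold $N$ of $M$ such that $\mathrm{an}_A(B)\subseteq TN$ and such that, for all open $U\subseteq M$ and $V\subseteq N$ for which $V$ is a closed embedded submanifold of $U$, the sections of $A|_U$ whose restriction to $V$ takes values in $B$ are closed under the bracket. A morphism of Lie algebroids is a smooth vector bundle map $\phi\colon A\to A'$ (with base map $\mathring\phi$) whose graph is a Lie subalgebroid of the direct product Lie algebroid $A\times A'$; an isomorphism is an invertible morphism. An $A$-symplectic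 form on $M$ is a nondegenerate $\omega\in\Gamma(\Lambda^2A^*)$ with $d_A\omega=0$, where $d_A$ is the Lie algebroid (Chevalley–Eilenberg) differential. For $U\subseteq M$ open and $B\to N$ a Lie subalgebroid of $A$ with $N\subseteq U$, a deformation retraction of $A|_U$ onto $B$ is a Lie algebroid morphism $\varrho\colon T[0,1]\times A|_U\to A|_U$ such that, with $\varrho_t(a)=\varrho(t,0,a)$, $$\varrho_1=\mathrm{id},\qquad \varrho_0(A|_U)=B,\qquad \varrho_0|_B=\mathrm{id}_B,\qquad \varrho(t,u,b)=b\ \text{ for all } (t,u)\in T[0,1]=[0,1]\times\mathbb R,\ b\in B .$$ *Statement.* Let $A\to M$ be a Lie algebroid and let $B\to N$ be a Lie subalgebroid of $A$ such that, for some open neighbourhood $U$ of $N$ in $M$, $A|_U$ admits a deformation retraction onto $B$. Let $\omega_0$ and $\omega_1$ be $A$-symplectic forms on $M$ with $\omega_{0,x}=\omega_{1,x}$ (as bilinear forms on $A_x$) for all $x\in N$. Then there exist open neighbourhoods $U_0$ and $U_1$ of $N$ in $M$ and a Lie algebroid isomorphism $\phi\colon A|_{U_0}\to A|_{U_1}$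 such that $$\phi^*\omega_1=\omega_0\ \text{ on } U_0,\qquad \mathring\phi|_N=\mathrm{id}_N,\qquad \phi|_{A_x}=\mathrm{id}_{A_x}\ \text{ for all } x\in N .$$ -/

import Mathlib

open Set Filter Topology Bundle
open scoped Manifold ContDiff

noncomputable section

namespace DMW

section Basic

variable {E : Type*} [NormedAddCommGroup E] [NormedSpace ℝ E]
  {H : Type*} [TopologicalSpace H] (I : ModelWithCorners ℝ E H)
  {M : Type*} [TopologicalSpace M] [ChartedSpace H M]
  (F : Type*) [NormedAddCommGroup F] [NormedSpace ℝ F]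
  (A : M → Type*) [TopologicalSpace (TotalSpace F A)] [∀ x, TopologicalSpace (A x)]
  [∀ x, AddCommGroup (A x)] [∀ x, Module ℝ (A x)] [FiberBundle F A] [VectorBundle ℝ F A]

/-- The section `σ` of the vector bundle `A` is smooth on the open set `U`, i.e. `σ ∈ Γ(U, A)`.
Local sections are represented by everywhere defined ones with arbitrary values outside `U`. -/
def SmoothSectionOn (U : Set M) (σ : Π x, A x) : Prop :=
  ContMDiffOn I (I.prod 𝓘(ℝ, F)) ∞ (fun x ↦ TotalSpace.mk' F x (σ x)) U

/-- A Lie algebroid structure on the smooth vector bundle `A → M`: a smooth vector bundle map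
`anchor : A → TM` and a Lie bracket on the space of global smooth sections satisfying the
Leibniz rule with respect to the anchor. -/
structure LieAlgebroid [IsManifold I ∞ M] where
  /-- the anchor on each fibre -/
  anchor : Π x : M, A x →ₗ[ℝ] TangentSpace I x
  /-- the anchor is smooth -/
  contMDiff_anchor : ContMDiff (I.prod 𝓘(ℝ, F)) I.tangent ∞
    (fun z : TotalSpace F A ↦ (⟨z.1, anchor z.1 z.2⟩ : TangentBundle I M))
  /-- the Lie bracket on global smooth sections, an `ℝ`-bilinear map -/
  bracket : Cₛ^∞⟮I; F, A⟯ →ₗ[ℝ] Cₛ^∞⟮I; F, A⟯ →ₗ[ℝ] Cₛ^∞⟮I; F, A⟯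
  /-- the bracket is alternating -/
  bracket_self : ∀ σ, bracket σ σ = 0
  /-- the Jacobi identity -/
  jacobi : ∀ σ τ υ, bracket σ (bracket τ υ) = bracket (bracket σ τ) υ + bracket τ (bracket σ υ)
  /-- the Leibniz rule `[σ, f τ] = f [σ, τ] + (σ · f) τ`, where `σ · f = df (anchor σ)` -/
  leibniz : ∀ (f : C^∞⟮I, M; 𝓘(ℝ), ℝ⟯) (σ τ fτ : Cₛ^∞⟮I; F, A⟯),
    (∀ x, fτ x = f x • τ x) → ∀ x,
      bracket σ fτ x =
        f x • bracket σ τ x + (show ℝ from mfderiv I 𝓘(ℝ) f x (anchor x (σ x))) • τ x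

end Basic

section Brackets

variable {E : Type*} [NormedAddCommGroup E] [NormedSpace ℝ E]
  {H : Type*} [TopologicalSpace H] (I : ModelWithCorners ℝ E H)
  {M : Type*} [TopologicalSpace M] [ChartedSpace H M]

/-- An anchor together with a bracket of local sections: `bracket σ τ x` is the value at `x` of
the bracket of two sections that are smooth near `x`. This is only a container for the operations
of a Lie algebroid on local sections; it is used for the three Lie algebroids `A`, `T[0,1]` and
direct products, constructed below. -/
structure LocalBracket (A : M → Type*) [∀ x, AddCommGroup (A x)] [∀ x, Module ℝ (A x)] where
  /-- the anchor on each fibre -/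
  anchor : Π x : M, A x →ₗ[ℝ] TangentSpace I x
  /-- the bracket of local sections -/
  bracket : (Π x, A x) → (Π x, A x) → (Π x, A x)

variable {I}

open Classical in
/-- The bracket of local sections of a Lie algebroid `A`: if `σ` and `τ` are smooth near `x` then
`[σ, τ](x) = [σ', τ'](x)`, where `σ'`, `τ'` are global smooth sections which agree
with `σ`, `τ` near `x` (the value does not depend on their choice). -/
def LieAlgebroid.toLocal [IsManifold I ∞ M]
    {F : Type*} [NormedAddCommGroup F] [NormedSpace ℝ F]
    {A : M → Type*} [TopologicalSpace (TotalSpace F A)] [∀ x, TopologicalSpace (A x)]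
    [∀ x, AddCommGroup (A x)] [∀ x, Module ℝ (A x)] [FiberBundle F A] [VectorBundle ℝ F A]
    (𝒜 : LieAlgebroid I F A) : LocalBracket I A where
  anchor := 𝒜.anchor
  bracket σ τ x :=
    if h : ∃ p : Cₛ^∞⟮I; F, A⟯ × Cₛ^∞⟮I; F, A⟯,
        (∀ᶠ y in 𝓝 x, p.1 y = σ y) ∧ (∀ᶠ y in 𝓝 x, p.2 y = τ y)
    then 𝒜.bracket h.choose.1 h.choose.2 x else 0

/-- The bracket of a Lie algebroid is local in the second argument. -/
theorem LieAlgebroid.bracket_eq_zero_of_eventually [FiniteDimensional ℝ E] [T2Space M]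
    [IsManifold I ∞ M] {F : Type*} [NormedAddCommGroup F] [NormedSpace ℝ F]
    {A : M → Type*} [TopologicalSpace (TotalSpace F A)] [∀ x, TopologicalSpace (A x)]
    [∀ x, AddCommGroup (A x)] [∀ x, Module ℝ (A x)] [FiberBundle F A] [VectorBundle ℝ F A]
    (𝒜 : LieAlgebroid I F A) (σ τ : Cₛ^∞⟮I; F, A⟯) (x : M)
    (h : ∀ᶠ y in 𝓝 x, τ y = 0) : 𝒜.bracket σ τ x = 0 := by
  obtain ⟨f, -, hf⟩ := (SmoothBumpFunction.nhds_basis_tsupport (I := I) x).mem_iff.1 h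
  have := 𝒜.leibniz ⟨f, f.contMDiff⟩ σ τ 0 (fun y ↦ by
    by_cases hy : y ∈ tsupport f
    · rw [show τ y = 0 from hf hy]; simp
    · change (0 : A y) = f y • τ y
      rw [image_eq_zero_of_notMem_tsupport hy]; simp) x
  rw [h.self_of_nhds] at this
  simp at this
  have h2 : ∀ v : ℝ, v • (0 : A x) = 0 := smul_zero
  erw [h2, add_zero] at this
  exact this.symm

/-- The bracket of local sections does not depend on the choice of the global sections. -/
theorem LieAlgebroid.toLocal_bracket [FiniteDimensional ℝ E] [T2Space M]
    [IsManifold I ∞ M] {F : Type*} [NormedAddCommGroup F] [NormedSpace ℝ F]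
    {A : M → Type*} [TopologicalSpace (TotalSpace F A)] [∀ x, TopologicalSpace (A x)]
    [∀ x, AddCommGroup (A x)] [∀ x, Module ℝ (A x)] [FiberBundle F A] [VectorBundle ℝ F A]
    (𝒜 : LieAlgebroid I F A) (σ τ : Π x, A x) (σ' τ' : Cₛ^∞⟮I; F, A⟯) (x : M)
    (hσ : ∀ᶠ y in 𝓝 x, σ' y = σ y) (hτ : ∀ᶠ y in 𝓝 x, τ' y = τ y) :
    𝒜.toLocal.bracket σ τ x = 𝒜.bracket σ' τ' x := by
  have skew : ∀ σ τ, 𝒜.bracket σ τ = - 𝒜.bracket τ σ := by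
    intro σ τ
    have := 𝒜.bracket_self (σ + τ)
    simp [𝒜.bracket_self] at this
    rw [eq_neg_iff_add_eq_zero]
    exact this
  have h : ∃ p : Cₛ^∞⟮I; F, A⟯ × Cₛ^∞⟮I; F, A⟯,
      (∀ᶠ y in 𝓝 x, p.1 y = σ y) ∧ (∀ᶠ y in 𝓝 x, p.2 y = τ y) := ⟨(σ', τ'), hσ, hτ⟩
  have e : 𝒜.toLocal.bracket σ τ x = 𝒜.bracket h.choose.1 h.choose.2 x := dif_pos h
  rw [e]
  obtain ⟨h1, h2⟩ := h.choose_spec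
  generalize h.choose = p at *
  have a1 := 𝒜.bracket_eq_zero_of_eventually p.1 (p.2 - τ') x (by
    filter_upwards [h2, hτ] with y a b; simp [a, b])
  have a2 := 𝒜.bracket_eq_zero_of_eventually τ' (p.1 - σ') x (by
    filter_upwards [h1, hσ] with y a b; simp [a, b])
  rw [map_sub, ContMDiffSection.coe_sub, Pi.sub_apply, sub_eq_zero] at a1 a2
  rw [a1, skew, skew σ', ContMDiffSection.coe_neg, ContMDiffSection.coe_neg, Pi.neg_apply,
    Pi.neg_apply, a2]

/-- The tangent Lie algebroid `TM` with the bracket of vector fields. -/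
def tangentAlgebroid (I : ModelWithCorners ℝ E H) (M : Type*) [TopologicalSpace M]
    [ChartedSpace H M] : LocalBracket I (TangentSpace I : M → Type _) where
  anchor _ := LinearMap.id
  bracket V W := VectorField.mlieBracket I V W

/-- The derivative at `x`, in the direction `v ∈ T_x M`, of a function `f` on `M` with values in
a fixed fibre `B y` of a vector bundle `B` with model fibre `F'`. -/
def fibreDeriv (I : ModelWithCorners ℝ E H) {N : Type*} [TopologicalSpace N]
    (F' : Type*) [NormedAddCommGroup F'] [NormedSpace ℝ F'] (B : N → Type*)
    [TopologicalSpace (TotalSpace F' B)] [∀ y, TopologicalSpace (B y)]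
    [∀ y, AddCommGroup (B y)] [∀ y, Module ℝ (B y)] [FiberBundle F' B] [VectorBundle ℝ F' B]
    (y : N) (f : M → B y) (x : M) (v : TangentSpace I x) : B y :=
  let e : B y ≃L[ℝ] F' := (trivializationAt F' B y).continuousLinearEquivAt ℝ y
    (mem_baseSet_trivializationAt F' B y)
  e.symm (mfderiv I 𝓘(ℝ, F') (fun x' ↦ e (f x')) x v)

end Brackets

section Product

variable {M : Type*} {N : Type*}

/-- The external direct product of the bundles `A → M` and `B → N`, a bundle over `M × N` with
fibres `A x × B y`. -/
def ExtProd (A : M → Type*) (B : N → Type*) (p : M × N) : Type _ := A p.1 × B p.2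

instance (A : M → Type*) (B : N → Type*) [∀ x, AddCommGroup (A x)] [∀ y, AddCommGroup (B y)]
    (p : M × N) : AddCommGroup (ExtProd A B p) :=
  inferInstanceAs (AddCommGroup (A p.1 × B p.2))

instance (A : M → Type*) (B : N → Type*) [∀ x, AddCommGroup (A x)] [∀ y, AddCommGroup (B y)]
    [∀ x, Module ℝ (A x)] [∀ y, Module ℝ (B y)]
    (p : M × N) : Module ℝ (ExtProd A B p) :=
  inferInstanceAs (Module ℝ (A p.1 × B p.2))

instance (A : M → Type*) (B : N → Type*)
    [∀ x, TopologicalSpace (A x)] [∀ y, TopologicalSpace (B y)]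
    (p : M × N) : TopologicalSpace (ExtProd A B p) :=
  inferInstanceAs (TopologicalSpace (A p.1 × B p.2))

variable [TopologicalSpace M] [TopologicalSpace N]
    (F : Type*) [NormedAddCommGroup F] [NormedSpace ℝ F]
    (A : M → Type*) [TopologicalSpace (TotalSpace F A)] [∀ x, TopologicalSpace (A x)]
    [∀ x, AddCommGroup (A x)] [∀ x, Module ℝ (A x)] [FiberBundle F A] [VectorBundle ℝ F A]
    (F' : Type*) [NormedAddCommGroup F'] [NormedSpace ℝ F']
    (B : N → Type*) [TopologicalSpace (TotalSpace F' B)] [∀ y, TopologicalSpace (B y)]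
    [∀ y, AddCommGroup (B y)] [∀ y, Module ℝ (B y)] [FiberBundle F' B] [VectorBundle ℝ F' B]

instance : TopologicalSpace (TotalSpace (F × F') (ExtProd A B)) :=
  inferInstanceAs (TopologicalSpace (TotalSpace (F × F')
    (((ContinuousMap.fst : C(M × N, M)) *ᵖ A) ×ᵇ ((ContinuousMap.snd : C(M × N, N)) *ᵖ B))))

instance : FiberBundle (F × F') (ExtProd A B) :=
  inferInstanceAs (FiberBundle (F × F')
    (((ContinuousMap.fst : C(M × N, M)) *ᵖ A) ×ᵇ ((ContinuousMap.snd : C(M × N, N)) *ᵖ B)))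

instance : VectorBundle ℝ (F × F') (ExtProd A B) :=
  inferInstanceAs (VectorBundle ℝ (F × F')
    (((ContinuousMap.fst : C(M × N, M)) *ᵖ A) ×ᵇ ((ContinuousMap.snd : C(M × N, N)) *ᵖ B)))

variable {E : Type*} [NormedAddCommGroup E] [NormedSpace ℝ E]
  {H : Type*} [TopologicalSpace H] {I : ModelWithCorners ℝ E H} [ChartedSpace H M]
  {E' : Type*} [NormedAddCommGroup E'] [NormedSpace ℝ E']
  {H' : Type*} [TopologicalSpace H'] {J : ModelWithCorners ℝ E' H'} [ChartedSpace H' N]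

variable {A B} in
/-- The direct product Lie algebroid `A × B → M × N`. Its anchor is the product of the anchors and
its bracket is the one characterized by the Leibniz rule and by
`[(a, b), (a', b')] = ([a, a'], [b, b'])` for sections `a`, `a'` of `A` and `b`, `b'` of `B`:
the `A`-component of `[σ, τ]` at `(x, y)` is the bracket of the `A`-components of `σ` and `τ`
along `M × {y}`, plus the derivative along `{x} × N` of the `A`-component of `τ` in the direction
of the anchor of the `B`-component of `σ`, minus the same term with `σ` and `τ` exchanged;
and similarly for the `B`-component. -/
def LocalBracket.prod (𝒜 : LocalBracket I A) (ℬ : LocalBracket J B) :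
    LocalBracket (I.prod J) (ExtProd A B) where
  anchor p := LinearMap.prodMap (𝒜.anchor p.1) (ℬ.anchor p.2)
  bracket σ τ p :=
    (𝒜.bracket (fun x ↦ (σ (x, p.2)).1) (fun x ↦ (τ (x, p.2)).1) p.1
        + fibreDeriv J F A p.1 (fun y ↦ (τ (p.1, y)).1) p.2 (ℬ.anchor p.2 (σ p).2)
        - fibreDeriv J F A p.1 (fun y ↦ (σ (p.1, y)).1) p.2 (ℬ.anchor p.2 (τ p).2),
      ℬ.bracket (fun y ↦ (σ (p.1, y)).2) (fun y ↦ (τ (p.1, y)).2) p.2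
        + fibreDeriv I F' B p.2 (fun x ↦ (τ (x, p.2)).2) p.1 (𝒜.anchor p.1 (σ p).1)
        - fibreDeriv I F' B p.2 (fun x ↦ (σ (x, p.2)).2) p.1 (𝒜.anchor p.1 (τ p).1))

end Product

section Subalgebroid

variable {E : Type*} [NormedAddCommGroup E] [NormedSpace ℝ E]
  {H : Type*} [TopologicalSpace H] {I : ModelWithCorners ℝ E H}
  {M : Type*} [TopologicalSpace M] [ChartedSpace H M]
  {E' : Type*} [NormedAddCommGroup E'] [NormedSpace ℝ E']
  {H' : Type*} [TopologicalSpace H'] (J : ModelWithCorners ℝ E' H')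
  {N : Type*} [TopologicalSpace N] [ChartedSpace H' N]
  (F : Type*) [NormedAddCommGroup F] [NormedSpace ℝ F]
  {A : M → Type*} [TopologicalSpace (TotalSpace F A)] [∀ x, TopologicalSpace (A x)]
  [∀ x, AddCommGroup (A x)] [∀ x, Module ℝ (A x)] [FiberBundle F A] [VectorBundle ℝ F A]

/-- `ι : N → M` is an injectively immersed submanifold, and the subspaces `B y ⊆ A (ι y)`
form a subbundle of `A` over it: near each point of `N` they have a smooth frame. -/
structure IsSubbundle (ι : N → M) (B : Π y : N, Submodule ℝ (A (ι y))) : Prop where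
  contMDiff : ContMDiff J I ∞ ι
  injective : Function.Injective ι
  immersion : ∀ y, Function.Injective (mfderiv J I ι y)
  exists_frame : ∀ y₀ : N, ∃ V ∈ 𝓝 y₀, ∃ (k : ℕ) (s : Fin k → Π y : N, A (ι y)),
    (∀ i, ContMDiffOn J (I.prod 𝓘(ℝ, F)) ∞ (fun y ↦ TotalSpace.mk' F (ι y) (s i y)) V) ∧
    ∀ y ∈ V, LinearIndependent ℝ (fun i ↦ s i y) ∧
      Submodule.span ℝ (range fun i ↦ s i y) = B y

/-- The open sets `U ⊆ M` and `V ⊆ N` are adapted to the immersed submanifold `ι : N → M`: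
`ι` maps `V` into `U`, and `V` is a closed embedded submanifold of `U`. -/
def IsAdapted (ι : N → M) (U : Set M) (V : Set N) : Prop :=
  IsOpen U ∧ IsOpen V ∧ ∃ h : MapsTo ι V U, IsClosedEmbedding h.restrict

/-- The subbundle `B → N` (over the immersed submanifold `ι : N → M`) is a Lie subalgebroid:
the anchor maps `B` into `TN`, and for each adapted pair `(U, V)` the bracket of two smooth
sections of `A` over `U` whose restrictions to `V` lie in `B` also has restriction to `V`
lying in `B`. -/
structure IsLieSubalgebroid (𝒜 : LocalBracket I A) (ι : N → M)
    (B : Π y : N, Submodule ℝ (A (ι y))) : Prop extends IsSubbundle (I := I) J F ι B where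
  anchor_mem : ∀ y, ∀ b ∈ B y, ∃ v : TangentSpace J y, mfderiv J I ι y v = 𝒜.anchor (ι y) b
  bracket_mem : ∀ (U : Set M) (V : Set N), IsAdapted ι U V → ∀ σ τ : Π x, A x,
    SmoothSectionOn I F A U σ → SmoothSectionOn I F A U τ →
    (∀ y ∈ V, σ (ι y) ∈ B y) → (∀ y ∈ V, τ (ι y) ∈ B y) →
    ∀ y ∈ V, 𝒜.bracket σ τ (ι y) ∈ B y

end Subalgebroid

section Morphism

/-- A fibrewise linear map from the bundle `A → M` to the bundle `B → N` over a map `M → N`. -/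
structure BundleMap {M N : Type*} (A : M → Type*) [∀ x, AddCommGroup (A x)]
    [∀ x, Module ℝ (A x)] (B : N → Type*) [∀ y, AddCommGroup (B y)] [∀ y, Module ℝ (B y)] where
  /-- the base map -/
  base : M → N
  /-- the linear map on each fibre -/
  fibre : Π x : M, A x →ₗ[ℝ] B (base x)

/-- The map of total spaces given by a bundle map. -/
def BundleMap.toTotal {M N : Type*} (F F' : Type*) {A : M → Type*} [∀ x, AddCommGroup (A x)]
    [∀ x, Module ℝ (A x)] {B : N → Type*} [∀ y, AddCommGroup (B y)] [∀ y, Module ℝ (B y)]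
    (φ : BundleMap A B) (z : TotalSpace F A) : TotalSpace F' B :=
  ⟨φ.base z.1, φ.fibre z.1 z.2⟩

variable {E : Type*} [NormedAddCommGroup E] [NormedSpace ℝ E]
  {H : Type*} [TopologicalSpace H] {I : ModelWithCorners ℝ E H}
  {M : Type*} [TopologicalSpace M] [ChartedSpace H M]
  {E' : Type*} [NormedAddCommGroup E'] [NormedSpace ℝ E']
  {H' : Type*} [TopologicalSpace H'] {J : ModelWithCorners ℝ E' H'}
  {N : Type*} [TopologicalSpace N] [ChartedSpace H' N]
  (F : Type*) [NormedAddCommGroup F] [NormedSpace ℝ F]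
  {A : M → Type*} [TopologicalSpace (TotalSpace F A)] [∀ x, TopologicalSpace (A x)]
  [∀ x, AddCommGroup (A x)] [∀ x, Module ℝ (A x)] [FiberBundle F A] [VectorBundle ℝ F A]
  (F' : Type*) [NormedAddCommGroup F'] [NormedSpace ℝ F']
  {B : N → Type*} [TopologicalSpace (TotalSpace F' B)] [∀ y, TopologicalSpace (B y)]
  [∀ y, AddCommGroup (B y)] [∀ y, Module ℝ (B y)] [FiberBundle F' B] [VectorBundle ℝ F' B]

/-- The fibre at `(x, φ x)` of the graph of `φ`: all pairs `(a, φ a)` with `a ∈ A x`. -/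
def BundleMap.graph {M N : Type*} {A : M → Type*} [∀ x, AddCommGroup (A x)]
    [∀ x, Module ℝ (A x)] {B : N → Type*} [∀ y, AddCommGroup (B y)] [∀ y, Module ℝ (B y)]
    (φ : BundleMap A B) (x : M) : Submodule ℝ (ExtProd A B (x, φ.base x)) :=
  show Submodule ℝ (A x × B (φ.base x)) from LinearMap.graph (φ.fibre x)

/-- `φ` restricts to a Lie algebroid morphism `A|_W → B|_W'`, for `W ⊆ M` and `W' ⊆ N` open: over
`W` it is a smooth vector bundle map with base map into `W'`, and its graph over `W`, whose base
is the graph of the base map, is a Lie subalgebroid of the direct product `A × B`. (What `φ` does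
outside `W` is irrelevant.) -/
structure IsLieMorphism (𝒜 : LocalBracket I A) (ℬ : LocalBracket J B)
    (W : TopologicalSpace.Opens M) (W' : TopologicalSpace.Opens N) (φ : BundleMap A B) :
    Prop where
  mapsTo : MapsTo φ.base W W'
  smooth : ContMDiffOn (I.prod 𝓘(ℝ, F)) (J.prod 𝓘(ℝ, F')) ∞ (φ.toTotal F F')
    {z : TotalSpace F A | z.1 ∈ W}
  graph : IsLieSubalgebroid (A := ExtProd A B) I (F × F') (𝒜.prod F F' ℬ)
    (fun x : W ↦ ((x : M), φ.base x)) (fun x : W ↦ φ.graph x)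

end Morphism

section Main

variable {E : Type*} [NormedAddCommGroup E] [NormedSpace ℝ E]
  {H : Type*} [TopologicalSpace H] {I : ModelWithCorners ℝ E H}
  {M : Type*} [TopologicalSpace M] [ChartedSpace H M] [IsManifold I ∞ M]
  {F : Type*} [NormedAddCommGroup F] [NormedSpace ℝ F]
  {A : M → Type*} [TopologicalSpace (TotalSpace F A)] [∀ x, TopologicalSpace (A x)]
  [∀ x, AddCommGroup (A x)] [∀ x, Module ℝ (A x)] [FiberBundle F A] [VectorBundle ℝ F A]

/-- An `A`-symplectic form on `M`: a smooth section `form` of `Λ²A*` which is closed for the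
Lie algebroid exterior derivative and nondegenerate. -/
structure SymplecticForm [∀ x, ContinuousAdd (A x)] [∀ x, ContinuousSMul ℝ (A x)]
    (𝒜 : LieAlgebroid I F A) where
  /-- the bilinear form on each fibre -/
  form : Π x : M, A x →L[ℝ] A x →L[ℝ] ℝ
  alternating : ∀ x a, form x a a = 0
  smooth : ContMDiff I (I.prod 𝓘(ℝ, F →L[ℝ] F →L[ℝ] ℝ)) ∞
    (fun x ↦ TotalSpace.mk' (F →L[ℝ] F →L[ℝ] ℝ) x (form x))
  closed : ∀ (σ₁ σ₂ σ₃ : Cₛ^∞⟮I; F, A⟯) (x : M),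
    (show ℝ from
        mfderiv I 𝓘(ℝ) (fun y ↦ form y (σ₂ y) (σ₃ y)) x (𝒜.anchor x (σ₁ x)))
      - (show ℝ from
        mfderiv I 𝓘(ℝ) (fun y ↦ form y (σ₁ y) (σ₃ y)) x (𝒜.anchor x (σ₂ x)))
      + (show ℝ from
        mfderiv I 𝓘(ℝ) (fun y ↦ form y (σ₁ y) (σ₂ y)) x (𝒜.anchor x (σ₃ x)))
      - form x (𝒜.bracket σ₁ σ₂ x) (σ₃ x)
      + form x (𝒜.bracket σ₁ σ₃ x) (σ₂ x)
      - form x (𝒜.bracket σ₂ σ₃ x) (σ₁ x) = 0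
  nondegenerate : ∀ x a, (∀ b, form x a b = 0) → a = 0

/-- `ϱ` restricts to a deformation retraction `T[0,1] × A|_U → A|_U` of `A|_U` onto the Lie
subalgebroid `B → N` (over the immersed submanifold `ι : N → M`): it is a Lie algebroid morphism
with `ϱ₁ = id`, `ϱ₀(A|_U) = B`, `ϱ₀|_B = id_B` and `ϱ(t, u, b) = b` for all `(t, u) ∈ T[0,1]` and
`b ∈ B`, where `ϱ_t(a) = ϱ(t, 0, a)`. -/
structure IsDeformationRetraction (𝒜 : LieAlgebroid I F A) (U : TopologicalSpace.Opens M)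
    {N : Type*} (ι : N → M) (B : Π y : N, Submodule ℝ (A (ι y)))
    (ϱ : BundleMap (ExtProd (TangentSpace (𝓡∂ 1) : Icc (0 : ℝ) 1 → Type _) A) A) : Prop where
  morphism : IsLieMorphism (EuclideanSpace ℝ (Fin 1) × F) F
    ((tangentAlgebroid (𝓡∂ 1) (Icc (0 : ℝ) 1)).prod (EuclideanSpace ℝ (Fin 1)) F 𝒜.toLocal)
    𝒜.toLocal ⟨{p | p.2 ∈ U}, U.isOpen.preimage continuous_snd⟩ U ϱ
  at_one : ∀ x ∈ U, ∀ a : A x,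
    ϱ.toTotal (EuclideanSpace ℝ (Fin 1) × F) F ⟨(1, x), (0, a)⟩ = ⟨x, a⟩
  at_zero : {w : TotalSpace F A | ∃ x ∈ U, ∃ a : A x,
      ϱ.toTotal (EuclideanSpace ℝ (Fin 1) × F) F ⟨(0, x), (0, a)⟩ = w} =
    {w : TotalSpace F A | ∃ y, ∃ b ∈ B y, (⟨ι y, b⟩ : TotalSpace F A) = w}
  at_zero_sub : ∀ y, ∀ b ∈ B y,
    ϱ.toTotal (EuclideanSpace ℝ (Fin 1) × F) F ⟨(0, ι y), (0, b)⟩ = ⟨ι y, b⟩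
  fixed : ∀ (t : Icc (0 : ℝ) 1) (u : TangentSpace (𝓡∂ 1) t) (y : N), ∀ b ∈ B y,
    ϱ.toTotal (EuclideanSpace ℝ (Fin 1) × F) F ⟨(t, ι y), (u, b)⟩ = ⟨ι y, b⟩

/-- `φ` restricts to a Lie algebroid isomorphism `A|_U₀ → A|_U₁`. -/
def IsLieIso (𝒜 : LieAlgebroid I F A) (U₀ U₁ : TopologicalSpace.Opens M)
    (φ : BundleMap A A) : Prop :=
  IsLieMorphism F F 𝒜.toLocal 𝒜.toLocal U₀ U₁ φ ∧
  ∃ ψ : BundleMap A A, IsLieMorphism F F 𝒜.toLocal 𝒜.toLocal U₁ U₀ ψ ∧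
    (∀ z : TotalSpace F A, z.1 ∈ U₀ → ψ.toTotal F F (φ.toTotal F F z) = z) ∧
    (∀ z : TotalSpace F A, z.1 ∈ U₁ → φ.toTotal F F (ψ.toTotal F F z) = z)

end Main

end DMW

end

/-!
The proof is Moser's method, carried out for Lie algebroids.

**The primitive.** Let `α = ω₁ - ω₀`. The retraction `ϱ` is a homotopy of Lie algebroid morphisms
from `ϱ₀`, which pulls `α` back to zero because its image is `B` and `α` vanishes over `N`, to the
identity. Cartan's formula (`LocHomotopy.hasDerivAt_pullback`) says that the time derivative of the
pullback of the closed form `α` is the differential of its contraction with the time direction, so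
the integral `β` of this contraction over time satisfies `dβ = α` (`LocHomotopy.locPrimitive`).
Since `ϱ` stays constant in time over `N`, both factors of the contraction, `α` and the image of the
time direction, vanish there; hence `β` vanishes over `N` together with its first derivative
(`coordPrimitive_self`).

**The flow.** The forms `ω₀ + t α` are nondegenerate near `N`, and the equation `(ω₀ + t α)(v, ·) =
-β` defines a time-dependent section `v` of `A` which is smooth near `N` and vanishes there to
second order (`moserField`, `exists_moserField_nhds`). A section of a Lie algebroid generates a flow
by vector bundle maps, and these are Lie algebroid morphisms: the defects in the compatibility with
anchors and brackets solve homogeneous linear differential equations with initial value zero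
(`LocAlg.exists_flow`). Because `v` vanishes to second order over `N`, the flow exists near `N` for
a given bounded time and fixes `A` over `N`. Since `dβ = α`, the Lie derivative of `ω₀ + t α` along
`v` is `-α` (`lie_derivative_eq`), so the flow from time `0` to time `1` pulls `ω₁` back to `ω₀`
(`form_const_along_flow`). The flow from `1` to `0` inverts it.

**Coordinates.** All computations take place in the preferred charts and trivializations. There a
Lie algebroid is a pair of smooth functions, the anchor and the bracket of constant sections,
subject to the structure equations `LocAlg` (`locAlg`). The definition of a morphism by its graph is
translated to the equations `IsLocMor` and `LocHomotopy` by applying the closure under brackets to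
sections adapted to the graph (`IsLieMorphism.toF_bracket`), and back by
`isLieMorphism_of_hasLocalForm`. The submanifold is only injectively immersed and no tubular
neighbourhood is available, so the flow is constructed chart by chart around the points of `N`; the
pieces fit together by the uniqueness of flow lines (`IsFlowLine.eqOn`, `exists_flow_map`).
Smoothness of flows in the initial value comes from the inverse function theorem on a Banach space
of curves (`exists_smooth_flow`). It is applied only at common zeros of vector fields whose
linearizations compose to zero, where the derivative of the fixed-point equation has an explicit
inverse.
-/

noncomputable section

namespace DMW

set_option linter.unusedSectionVars false
set_option synthInstance.maxHeartbeats 400000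

/-! ### Superposition operators and smooth flows near a zero -/

section Nemytskii

variable {a b : ℝ} {Z G : Type*} [NormedAddCommGroup Z] [NormedSpace ℝ Z]
  [NormedAddCommGroup G] [NormedSpace ℝ G]

/-- The Nemytskii (superposition) operator `γ ↦ (s ↦ Y (s, γ s))` on continuous curves. -/
def nemytskii (Y : C(ℝ × Z, G)) (γ : C(Icc a b, Z)) : C(Icc a b, G) where
  toFun s := Y ((s : ℝ), γ s)

@[simp] theorem nemytskii_apply (Y : C(ℝ × Z, G)) (γ : C(Icc a b, Z)) (s : Icc a b) :
    nemytskii Y γ s = Y ((s : ℝ), γ s) := rfl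

/-- A curve of linear maps acts pointwise on curves. -/
def curveApply {K : Type*} [TopologicalSpace K] [CompactSpace K] :
    C(K, Z →L[ℝ] G) →L[ℝ] C(K, Z) →L[ℝ] C(K, G) :=
  LinearMap.mkContinuous₂
    (LinearMap.mk₂ ℝ (fun (L : C(K, Z →L[ℝ] G)) (γ : C(K, Z)) ↦
        (⟨fun s ↦ L s (γ s), by fun_prop⟩ : C(K, G)))
      (fun _ _ _ ↦ by ext; simp) (fun _ _ _ ↦ by ext; simp)
      (fun _ _ _ ↦ by ext; simp) (fun _ _ _ ↦ by ext; simp)) 1 (fun L γ ↦ by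
        rw [ContinuousMap.norm_le _ (by positivity)]
        intro s
        simp only [LinearMap.mk₂_apply, ContinuousMap.coe_mk, one_mul]
        exact (L s).le_of_opNorm_le_of_le (L.norm_coe_le_norm s) (γ.norm_coe_le_norm s))

@[simp] theorem curveApply_apply {K : Type*} [TopologicalSpace K] [CompactSpace K]
    (L : C(K, Z →L[ℝ] G)) (γ : C(K, Z)) (s : K) :
    curveApply L γ s = L s (γ s) := rfl

/-- Around the compact graph of a curve, a continuous function is close to its values on the
graph, uniformly in time. -/
theorem exists_uniform_nhds_curve (g : C(ℝ × Z, G)) (γ : C(Icc a b, Z)) {ε : ℝ} (hε : 0 < ε) :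
    ∃ δ > 0, ∀ s : Icc a b, ∀ z, ‖z - γ s‖ < δ → ‖g ((s : ℝ), z) - g ((s : ℝ), γ s)‖ < ε := by
  have hc : IsCompact (range fun s : Icc a b ↦ ((s : ℝ), γ s)) :=
    isCompact_range (by fun_prop)
  have := hc.uniformContinuousAt_of_continuousAt g (fun a _ ↦ g.continuous.continuousAt)
    (Metric.dist_mem_uniformity hε)
  obtain ⟨δ, hδ, h⟩ := Metric.mem_uniformity_dist.1 this
  refine ⟨δ, hδ, fun s z hz ↦ ?_⟩
  have h2 := @h ((s : ℝ), γ s) ((s : ℝ), z) (by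
    rw [Prod.dist_eq]; simpa [dist_comm, dist_eq_norm, hδ] using hz) ⟨s, rfl⟩
  rw [← dist_eq_norm, dist_comm]
  exact h2

/-- The derivative in the second variable. -/
def sndDeriv (Y : ℝ × Z → G) (q : ℝ × Z) : Z →L[ℝ] G :=
  (fderiv ℝ Y q).comp (ContinuousLinearMap.inr ℝ ℝ Z)

theorem contDiff_sndDeriv {Y : ℝ × Z → G} (hY : ContDiff ℝ ∞ Y) : ContDiff ℝ ∞ (sndDeriv Y) :=
  (hY.fderiv_right (by simp)).clm_comp contDiff_const

theorem hasFDerivAt_slice {Y : ℝ × Z → G} {s : ℝ} {z : Z} (hY : DifferentiableAt ℝ Y (s, z)) :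
    HasFDerivAt (fun z ↦ Y (s, z)) (sndDeriv Y (s, z)) z := by
  have h1 : HasFDerivAt (fun z : Z ↦ (s, z)) (ContinuousLinearMap.inr ℝ ℝ Z) z :=
    hasFDerivAt_prodMk_right s z
  exact HasFDerivAt.comp z (f := fun z : Z ↦ (s, z)) hY.hasFDerivAt h1

/-- The derivative of the Nemytskii operator of `Y` at a curve is pointwise application of the
partial derivative of `Y`. By the mean value inequality the error is controlled by the oscillation
of this derivative near the compact graph of the curve. -/
theorem hasFDerivAt_nemytskii {Y : C(ℝ × Z, G)} (hY : ContDiff ℝ ∞ Y) (γ : C(Icc a b, Z)) :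
    HasFDerivAt (nemytskii Y) (curveApply (nemytskii
      (⟨sndDeriv Y, (contDiff_sndDeriv hY).continuous⟩ : C(ℝ × Z, Z →L[ℝ] G)) γ)) γ := by
  rw [hasFDerivAt_iff_isLittleO_nhds_zero, Asymptotics.isLittleO_iff]
  intro ε hε
  obtain ⟨δ, hδ, h⟩ := exists_uniform_nhds_curve
    (⟨sndDeriv Y, (contDiff_sndDeriv hY).continuous⟩ : C(ℝ × Z, Z →L[ℝ] G)) γ hε
  filter_upwards [Metric.ball_mem_nhds (0 : C(Icc a b, Z)) hδ] with η hη
  rw [mem_ball_zero_iff] at hη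
  rw [ContinuousMap.norm_le _ (by positivity)]
  intro s
  have hs : ‖η s‖ < δ := (η.norm_coe_le_norm s).trans_lt hη
  have key := (convex_ball (γ s) δ).norm_image_sub_le_of_norm_hasFDerivWithin_le'
    (f := fun z ↦ Y ((s : ℝ), z)) (f' := fun z ↦ sndDeriv Y ((s : ℝ), z))
    (φ := sndDeriv Y ((s : ℝ), γ s)) (C := ε) (x := γ s) (y := γ s + η s)
    (fun z _ ↦ (hasFDerivAt_slice (hY.differentiable (by simp)).differentiableAt).hasFDerivWithinAt)
    (fun z hz ↦ (h s z (by rwa [Metric.mem_ball, dist_eq_norm] at hz)).le)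
    (Metric.mem_ball_self hδ) (by simpa using hs)
  simp only [add_sub_cancel_left] at key
  calc _ ≤ ε * ‖η s‖ := key
    _ ≤ ε * ‖η‖ := by gcongr; exact η.norm_coe_le_norm s

end Nemytskii

/-- Composition with a bounded operator preserves smoothness. The spaces are kept abstract because
unification is slow for iterated spaces of curves and of operators. -/
theorem contDiff_clm_comp_curve {n : ℕ∞ω} {K W X S : Type*} [TopologicalSpace K]
    [CompactSpace K] [NormedAddCommGroup W] [NormedSpace ℝ W] [NormedAddCommGroup X]
    [NormedSpace ℝ X] [NormedAddCommGroup S] [NormedSpace ℝ S] (T : C(K, W) →L[ℝ] X)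
    {g : S → C(K, W)} (hg : ContDiff ℝ n g) : ContDiff ℝ n (fun s ↦ T (g s)) :=
  T.contDiff.comp hg

section NemytskiiSmooth

universe u v
variable {a b : ℝ} {Z : Type u} [NormedAddCommGroup Z] [NormedSpace ℝ Z]

/-- The derivative of a Nemytskii operator is again one, with values in `Z →L[ℝ] G`, so that
induction on the order of differentiability applies. The universe of `G` is chosen such that the
statement for `G` includes the one for `Z →L[ℝ] G`. -/
theorem contDiff_nat_nemytskii (n : ℕ) : ∀ {G : Type (max u v)} [NormedAddCommGroup G]
    [NormedSpace ℝ G] {Y : C(ℝ × Z, G)}, ContDiff ℝ ∞ Y →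
    ContDiff ℝ n (nemytskii Y : C(Icc a b, Z) → C(Icc a b, G)) := by
  induction n with
  | zero =>
    intro G _ _ Y hY
    exact contDiff_zero.2 (continuous_iff_continuousAt.2
      fun γ ↦ (hasFDerivAt_nemytskii hY γ).continuousAt)
  | succ n ih =>
    intro G _ _ Y hY
    refine contDiff_succ_iff_hasFDerivAt.2 ⟨_, ?_, hasFDerivAt_nemytskii hY⟩
    exact contDiff_clm_comp_curve (X := C(Icc a b, Z) →L[ℝ] C(Icc a b, G)) curveApply
      (ih (Y := ⟨sndDeriv Y, (contDiff_sndDeriv hY).continuous⟩) (contDiff_sndDeriv hY))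

/-- The Nemytskii operator of a smooth function is smooth. -/
theorem contDiff_nemytskii {G : Type (max u v)} [NormedAddCommGroup G]
    [NormedSpace ℝ G] {Y : C(ℝ × Z, G)} (hY : ContDiff ℝ ∞ Y) :
    ContDiff ℝ ∞ (nemytskii Y : C(Icc a b, Z) → C(Icc a b, G)) :=
  contDiff_infty.2 fun n ↦ contDiff_nat_nemytskii n hY

end NemytskiiSmooth

section Primitive

open MeasureTheory intervalIntegral

variable {a b : ℝ} {G : Type*} [NormedAddCommGroup G] [NormedSpace ℝ G]

/-- The extension of a curve on `[a, b]` to the real line by constants. -/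
def extend (hab : a ≤ b) (γ : C(Icc a b, G)) (t : ℝ) : G := γ (projIcc a b hab t)

theorem continuous_extend (hab : a ≤ b) (γ : C(Icc a b, G)) : Continuous (extend hab γ) :=
  γ.continuous.comp continuous_projIcc

theorem extend_of_mem (hab : a ≤ b) (γ : C(Icc a b, G)) {t : ℝ} (ht : t ∈ Icc a b) :
    extend hab γ t = γ ⟨t, ht⟩ := by rw [extend, projIcc_of_mem hab ht]

variable [CompleteSpace G]

/-- The operator of integration `γ ↦ (t ↦ ∫ s in t₀..t, γ s)` on continuous curves. -/
def primitive (hab : a ≤ b) (t₀ : Icc a b) : C(Icc a b, G) →L[ℝ] C(Icc a b, G) :=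
  LinearMap.mkContinuous
    { toFun := fun γ ↦ ⟨fun t ↦ ∫ s in (t₀ : ℝ)..t, extend hab γ s, by
        have := continuous_primitive (μ := volume) (f := extend hab γ)
          (fun _ _ ↦ (continuous_extend hab γ).intervalIntegrable _ _) (t₀ : ℝ)
        exact this.comp continuous_subtype_val⟩
      map_add' := fun γ η ↦ by
        ext t
        exact intervalIntegral.integral_add ((continuous_extend hab γ).intervalIntegrable _ _)
          ((continuous_extend hab η).intervalIntegrable _ _)
      map_smul' := fun c γ ↦ by
        ext t
        exact intervalIntegral.integral_smul c (extend hab γ) } (b - a) (fun γ ↦ by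
        rw [ContinuousMap.norm_le _ (mul_nonneg (sub_nonneg.2 hab) (norm_nonneg _))]
        intro t
        refine (norm_integral_le_of_norm_le_const (C := ‖γ‖)
          fun s _ ↦ γ.norm_coe_le_norm _).trans ?_
        rw [mul_comm]
        gcongr
        rw [abs_le]
        constructor <;> linarith [t.2.1, t.2.2, t₀.2.1, t₀.2.2])

theorem primitive_apply (hab : a ≤ b) (t₀ t : Icc a b) (γ : C(Icc a b, G)) :
    primitive hab t₀ γ t = ∫ s in (t₀ : ℝ)..t, extend hab γ s := rfl

/-- A curve that satisfies an integral equation satisfies the differential equation in the interior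
of the interval. -/
theorem hasDerivAt_extend_of_eq_primitive (hab : a ≤ b) (t₀ : Icc a b) {γ η : C(Icc a b, G)}
    {z : G} (h : γ = ContinuousMap.const _ z + primitive hab t₀ η) {t : ℝ} (ht : t ∈ Ioo a b) :
    HasDerivAt (extend hab γ) (extend hab η t) t := by
  have h1 : HasDerivAt (fun t ↦ z + ∫ s in (t₀ : ℝ)..t, extend hab η s) (extend hab η t) t :=
    ((continuous_extend hab η).integral_hasStrictDerivAt _ t).hasDerivAt.const_add z
  refine h1.congr_of_eventuallyEq ?_
  filter_upwards [Ioo_mem_nhds ht.1 ht.2] with s hs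
  rw [extend_of_mem hab γ (Ioo_subset_Icc_self hs), h]
  rfl

end Primitive

section Flow

variable {a b : ℝ} {Z : Type*} [NormedAddCommGroup Z] [NormedSpace ℝ Z] [CompleteSpace Z]

/-- The flow of a smooth time-dependent vector field `Y` near a common zero `z₀`, as a smooth map
to the Banach space of curves. It is obtained from the inverse function theorem for
`γ ↦ γ - ∫ Y(s, γ(s)) ds` at the constant curve `z₀`. The linearizations of `Y` at `z₀` compose to
zero, so the derivative there is `1 - V` with `V² = 0`, which is invertible. -/
theorem exists_smooth_flow (hab : a ≤ b) (t₀ : Icc a b) {Y : C(ℝ × Z, Z)} (hY : ContDiff ℝ ∞ Y)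
    {z₀ : Z} (hfix : ∀ s ∈ Icc a b, Y (s, z₀) = 0)
    (hnil : ∀ s ∈ Icc a b, ∀ s' ∈ Icc a b, ∀ w,
      sndDeriv Y (s, z₀) (sndDeriv Y (s', z₀) w) = 0) :
    ∃ (ζ : Z → C(Icc a b, Z)) (O : Set Z), IsOpen O ∧ z₀ ∈ O ∧ ContDiffOn ℝ ∞ ζ O ∧
      ζ z₀ = ContinuousMap.const _ z₀ ∧
      ∀ z ∈ O, ζ z = ContinuousMap.const _ z + primitive hab t₀ (nemytskii Y (ζ z)) := by
  set C := C(Icc a b, Z)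
  set J : C →L[ℝ] C := primitive hab t₀
  set Y' : C(ℝ × Z, Z →L[ℝ] Z) := ⟨sndDeriv Y, (contDiff_sndDeriv hY).continuous⟩
  set Θ : C → C := fun γ ↦ γ - J (nemytskii Y γ) with hΘ
  have hΘs : ContDiff ℝ ∞ Θ := contDiff_id.sub (J.contDiff.comp (contDiff_nemytskii hY))
  set γ₀ : C := ContinuousMap.const _ z₀
  have hΘ' : ∀ γ, HasFDerivAt Θ (ContinuousLinearMap.id ℝ C - J.comp (curveApply (nemytskii Y' γ)))
      γ := fun γ ↦ (hasFDerivAt_id γ).sub (J.hasFDerivAt.comp γ (hasFDerivAt_nemytskii hY γ))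
  have hΘ0 : Θ γ₀ = γ₀ := by
    have : nemytskii Y γ₀ = 0 := by ext s; exact hfix s s.2
    simp [hΘ, this]
  set V : C →L[ℝ] C := J.comp (curveApply (nemytskii Y' γ₀)) with hV
  have hVV : ∀ η, V (V η) = 0 := by
    intro η
    -- the linearization at time `s` moves under the integral and meets the one at time `r`
    have h0 : curveApply (nemytskii Y' γ₀) (V η) = 0 := by
      ext s
      change sndDeriv Y (s, z₀)
        (∫ r in (t₀ : ℝ)..s, extend hab (curveApply (nemytskii Y' γ₀) η) r) = 0
      rw [← ContinuousLinearMap.intervalIntegral_comp_comm _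
        ((continuous_extend hab _).intervalIntegrable _ _)]
      refine intervalIntegral.integral_zero_ae (Eventually.of_forall fun r _ ↦ ?_)
      exact hnil s s.2 _ (projIcc a b hab r).2 _
    change J (curveApply (nemytskii Y' γ₀) (V η)) = 0
    rw [h0, map_zero]
  -- since `V² = 0`, the inverse of `1 - V` is `1 + V`
  let Λ : C ≃L[ℝ] C := ContinuousLinearEquiv.equivOfInverse (ContinuousLinearMap.id ℝ C - V)
    (ContinuousLinearMap.id ℝ C + V) (fun η ↦ by simp [hVV]) (fun η ↦ by simp [hVV])
  have hΛ : HasFDerivAt Θ (Λ : C →L[ℝ] C) γ₀ := hΘ' γ₀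
  let P := hΘs.contDiffAt.toOpenPartialHomeomorph Θ hΛ (by simp)
  have hP : ∀ γ, P γ = Θ γ := fun γ ↦ rfl
  have hmem : γ₀ ∈ P.source := hΘs.contDiffAt.mem_toOpenPartialHomeomorph_source hΛ (by simp)
  -- the inverse is smooth at all points whose preimage has invertible derivative
  let S : Set C := {γ | fderiv ℝ Θ γ ∈ range ((↑) : (C ≃L[ℝ] C) → C →L[ℝ] C)}
  have hS : IsOpen S := ContinuousLinearEquiv.isOpen.preimage
    (hΘs.continuous_fderiv (by simp))
  have hO : IsOpen (P.symm.source ∩ P.symm ⁻¹' S) := P.symm.isOpen_inter_preimage hS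
  have hcc : Continuous (fun z : Z ↦ (ContinuousMap.const (Icc a b) z)) :=
    ContinuousMap.continuous_const'
  have hconst : ContDiff ℝ ∞ (fun z : Z ↦ (ContinuousMap.const (Icc a b) z)) := by
    let c : Z →L[ℝ] C :=
      { toFun := fun z ↦ ContinuousMap.const _ z
        map_add' := fun _ _ ↦ rfl
        map_smul' := fun _ _ ↦ rfl
        cont := hcc }
    exact c.contDiff
  have hPγ : P.symm γ₀ = γ₀ := by
    conv_lhs => rw [← hΘ0, ← hP]
    exact P.left_inv hmem
  refine ⟨fun z ↦ P.symm (ContinuousMap.const _ z),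
    (fun z ↦ ContinuousMap.const _ z) ⁻¹' (P.symm.source ∩ P.symm ⁻¹' S),
    hO.preimage hcc, ⟨?_, ?_⟩, ?_, hPγ, ?_⟩
  · rw [P.symm_source]
    change γ₀ ∈ P.target
    rw [← hΘ0, ← hP]
    exact P.map_source hmem
  · change fderiv ℝ Θ (P.symm γ₀) ∈ range ((↑) : (C ≃L[ℝ] C) → C →L[ℝ] C)
    rw [hPγ, hΛ.fderiv]
    exact ⟨Λ, rfl⟩
  · intro z hz
    obtain ⟨hz1, Λ', hΛ'⟩ := hz
    have h1 : ContDiffAt ℝ ∞ P.symm (ContinuousMap.const _ z) := by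
      refine P.contDiffAt_symm (f₀' := Λ') hz1 ?_ ?_
      · rw [hΛ']
        exact (hΘs.differentiable (by simp) _).hasFDerivAt
      · exact hΘs.contDiffAt
    exact (h1.comp z hconst.contDiffAt).contDiffWithinAt
  · intro z hz
    have h1 : Θ (P.symm (ContinuousMap.const _ z)) = ContinuousMap.const _ z := by
      rw [← hP]; exact P.right_inv hz.1
    rw [hΘ, sub_eq_iff_eq_add] at h1
    exact h1

end Flow

/-! ### Local flows and parametric integrals -/

section FlowDerivative

variable {a b : ℝ} {Z : Type*} [NormedAddCommGroup Z] [NormedSpace ℝ Z] [CompleteSpace Z]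

/-- The derivative of the flow with respect to the initial value solves the linearized equation. -/
theorem fderiv_flow_eq (hab : a ≤ b) (t₀ : Icc a b) {Y : C(ℝ × Z, Z)} (hY : ContDiff ℝ ∞ Y)
    {ζ : Z → C(Icc a b, Z)} {O : Set Z} (hO : IsOpen O) (hζ : ContDiffOn ℝ ∞ ζ O)
    (h : ∀ z ∈ O, ζ z = ContinuousMap.const _ z + primitive hab t₀ (nemytskii Y (ζ z)))
    {z : Z} (hz : z ∈ O) (v : Z) :
    fderiv ℝ ζ z v = ContinuousMap.const _ v + primitive hab t₀ (curveApply (nemytskii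
      (⟨sndDeriv Y, (contDiff_sndDeriv hY).continuous⟩ : C(ℝ × Z, Z →L[ℝ] Z)) (ζ z))
      (fderiv ℝ ζ z v)) := by
  have h1 : HasFDerivAt ζ (fderiv ℝ ζ z) z :=
    ((hζ.contDiffAt (hO.mem_nhds hz)).differentiableAt (by simp)).hasFDerivAt
  let c : Z →L[ℝ] C(Icc a b, Z) :=
    { toFun := fun z ↦ ContinuousMap.const _ z
      map_add' := fun _ _ ↦ rfl
      map_smul' := fun _ _ ↦ rfl
      cont := ContinuousMap.continuous_const' }
  have h2 := (c.hasFDerivAt (x := z)).add ((primitive hab t₀).hasFDerivAt.comp z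
    ((hasFDerivAt_nemytskii hY (ζ z)).comp z h1))
  have h3 : HasFDerivAt ζ _ z := h2.congr_of_eventuallyEq (by
    filter_upwards [hO.mem_nhds hz] with y hy using h y hy)
  have := h1.unique h3
  exact congrArg (fun D : Z →L[ℝ] C(Icc a b, Z) ↦ D v) this

/-- A solution of a linear differential equation that vanishes at one time vanishes identically. -/
theorem eq_zero_of_linear_ode {X : Type*} [NormedAddCommGroup X] [NormedSpace ℝ X]
    {A : ℝ → X →L[ℝ] X} (hA : ContinuousOn A (Icc a b)) {g : ℝ → X}
    (hg : ∀ t ∈ Ioo a b, HasDerivAt g (A t (g t)) t) {t₀ : ℝ} (ht₀ : t₀ ∈ Ioo a b)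
    (h0 : g t₀ = 0) : ∀ t ∈ Ioo a b, g t = 0 := by
  obtain ⟨C, hC⟩ := isCompact_Icc.exists_bound_of_continuousOn hA
  have hC0 : 0 ≤ C := (norm_nonneg _).trans (hC t₀ (Ioo_subset_Icc_self ht₀))
  have := ODE_solution_unique_of_mem_Ioo (v := fun t x ↦ A t x) (s := fun _ ↦ univ)
    (K := ⟨C, hC0⟩) (f := g) (g := fun _ ↦ 0) (t₀ := t₀) (a := a) (b := b)
    (fun t ht ↦ ((A t).lipschitz.weaken (by
      exact hC t (Ioo_subset_Icc_self ht))).lipschitzOnWith) ht₀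
    (fun t ht ↦ ⟨hg t ht, trivial⟩)
    (fun t _ ↦ ⟨by simpa using hasDerivAt_const t (0 : X), trivial⟩) h0
  exact this

/-- A smooth function defined near a compact set in a finite-dimensional space agrees, near the
compact set, with a globally smooth function. -/
theorem exists_contDiff_eqOn_nhds {X G : Type*} [NormedAddCommGroup X] [NormedSpace ℝ X]
    [FiniteDimensional ℝ X] [NormedAddCommGroup G] [NormedSpace ℝ G] {W K : Set X}
    (hW : IsOpen W) (hK : IsCompact K) (hKW : K ⊆ W) {f : X → G} (hf : ContDiffOn ℝ ∞ f W) :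
    ∃ g : X → G, ContDiff ℝ ∞ g ∧ ∃ V, IsOpen V ∧ K ⊆ V ∧ V ⊆ W ∧ ∀ x ∈ V, g x = f x := by
  obtain ⟨χ, h0, h1, -⟩ := exists_contMDiffMap_zero_one_nhds_of_isClosed (n := ⊤) 𝓘(ℝ, X)
    hW.isClosed_compl hK.isClosed (disjoint_compl_left_iff_subset.2 hKW)
  have hχ : ContDiff ℝ ∞ χ := χ.contMDiff.contDiff
  obtain ⟨V, hV, hKV, hV1⟩ := mem_nhdsSet_iff_exists.1 h1
  refine ⟨fun x ↦ χ x • f x, ?_, V ∩ W, hV.inter hW, subset_inter hKV hKW, inter_subset_right,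
    fun x hx ↦ by simp [show χ x = 1 from hV1 hx.1]⟩
  rw [contDiff_iff_contDiffAt]
  intro x
  by_cases hx : x ∈ W
  · exact hχ.contDiffAt.smul (hf.contDiffAt (hW.mem_nhds hx))
  · refine (contDiffAt_const (c := (0 : G))).congr_of_eventuallyEq ?_
    filter_upwards [h0.filter_mono (nhds_le_nhdsSet (show x ∈ Wᶜ from hx))] with y hy
    simp [hy]

/-- The flow of a time-dependent vector field `Y` near a common zero `z₀` whose linearizations
compose to zero: it exists for all times in `(a, b)`, stays in a prescribed neighbourhood, is smooth
in the initial value, and its derivative solves the linearized equation. -/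
theorem exists_local_flow [FiniteDimensional ℝ Z] {t₀ : ℝ} (ht₀ : t₀ ∈ Ioo a b)
    {W : Set (ℝ × Z)} (hW : IsOpen W) {Y : ℝ × Z → Z} (hY : ContDiffOn ℝ ∞ Y W) {z₀ : Z}
    (hz₀ : ∀ s ∈ Icc a b, (s, z₀) ∈ W) (hfix : ∀ s ∈ Icc a b, Y (s, z₀) = 0)
    (hnil : ∀ s ∈ Icc a b, ∀ s' ∈ Icc a b, ∀ w,
      sndDeriv Y (s, z₀) (sndDeriv Y (s', z₀) w) = 0)
    {Q : Set Z} (hQ : Q ∈ 𝓝 z₀) :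
    ∃ (O : Set Z) (w : ℝ → Z → Z), IsOpen O ∧ z₀ ∈ O ∧
      (∀ t, ContDiffOn ℝ ∞ (w t) O) ∧ (∀ t, w t z₀ = z₀) ∧ (∀ z ∈ O, w t₀ z = z) ∧
      (∀ z ∈ O, ∀ t, w t z ∈ Q) ∧ (∀ z ∈ O, ∀ t ∈ Icc a b, (t, w t z) ∈ W) ∧
      (∀ z ∈ O, Continuous fun t ↦ w t z) ∧ (∀ z ∈ O, Continuous fun t ↦ fderiv ℝ (w t) z) ∧
      (∀ z ∈ O, ∀ t ∈ Ioo a b, HasDerivAt (fun t ↦ w t z) (Y (t, w t z)) t) ∧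
      (∀ z ∈ O, ∀ v, ∀ t ∈ Ioo a b, HasDerivAt (fun t ↦ fderiv ℝ (w t) z v)
        (sndDeriv Y (t, w t z) (fderiv ℝ (w t) z v)) t) := by
  have hab : a ≤ b := (ht₀.1.trans ht₀.2).le
  set τ : Icc a b := ⟨t₀, Ioo_subset_Icc_self ht₀⟩
  have hK : IsCompact (Icc a b ×ˢ {z₀}) := isCompact_Icc.prod isCompact_singleton
  obtain ⟨Y₁, hY₁, V, hV, hKV, hVW, hYY⟩ := exists_contDiff_eqOn_nhds hW hK
    (by rintro ⟨s, z⟩ ⟨hs, rfl⟩; exact hz₀ s hs) hY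
  obtain ⟨u, v, hu, hv, hIu, hzv, huv⟩ := generalized_tube_lemma isCompact_Icc
    (isCompact_singleton (x := z₀)) hV hKV
  have hzv : z₀ ∈ v := hzv rfl
  have hVmem : ∀ s ∈ Icc a b, ∀ z ∈ v, (s, z) ∈ V := fun s hs z hz ↦ huv ⟨hIu hs, hz⟩
  have hYe : ∀ s ∈ Icc a b, ∀ z ∈ v, Y₁ (s, z) = Y (s, z) := fun s hs z hz ↦
    hYY _ (hVmem s hs z hz)
  have hYd : ∀ s ∈ Icc a b, ∀ z ∈ v, sndDeriv Y₁ (s, z) = sndDeriv Y (s, z) := by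
    intro s hs z hz
    have : Y₁ =ᶠ[𝓝 (s, z)] Y := by
      filter_upwards [hV.mem_nhds (hVmem s hs z hz)] with q hq using hYY q hq
    rw [sndDeriv, sndDeriv, this.fderiv_eq]
  obtain ⟨ζ, O, hO, hzO, hζ, hζ0, hζe⟩ := exists_smooth_flow hab τ (Y := ⟨Y₁, hY₁.continuous⟩) hY₁
    (z₀ := z₀) (fun s hs ↦ (hYe s hs z₀ hzv).trans (hfix s hs)) (fun s hs s' hs' w ↦ by
      change sndDeriv Y₁ (s, z₀) (sndDeriv Y₁ (s', z₀) w) = 0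
      rw [hYd s hs _ hzv, hYd s' hs' _ hzv]; exact hnil s hs s' hs' w)
  obtain ⟨ε, hε, hball⟩ := Metric.mem_nhds_iff.1 (inter_mem (hv.mem_nhds hzv) hQ)
  -- curves close to the constant curve `z₀` stay where the extension of `Y` agrees with `Y`
  set O' := O ∩ ζ ⁻¹' Metric.ball (ContinuousMap.const _ z₀) ε
  have hO' : IsOpen O' := hζ.continuousOn.isOpen_inter_preimage hO Metric.isOpen_ball
  have hOO : O' ⊆ O := inter_subset_left
  have hstay : ∀ z ∈ O', ∀ s, ζ z s ∈ v ∩ Q := by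
    intro z hz s
    refine hball ?_
    have := (ContinuousMap.dist_lt_iff hε).1 hz.2 s
    exact this
  let ev : ℝ → C(Icc a b, Z) →L[ℝ] Z := fun t ↦
    { toFun := fun γ ↦ extend hab γ t
      map_add' := fun _ _ ↦ rfl
      map_smul' := fun _ _ ↦ rfl
      cont := ContinuousEvalConst.continuous_eval_const _ }
  have hd : ∀ t, ∀ z ∈ O', ∀ v, fderiv ℝ (fun z ↦ extend hab (ζ z) t) z v =
      extend hab (fderiv ℝ ζ z v) t := by
    intro t z hz v
    have h1 : HasFDerivAt ζ (fderiv ℝ ζ z) z :=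
      ((hζ.contDiffAt (hO.mem_nhds (hOO hz))).differentiableAt (by simp)).hasFDerivAt
    have h2 := (ev t).hasFDerivAt.comp z h1
    have h3 : fderiv ℝ (fun z ↦ extend hab (ζ z) t) z = (ev t).comp (fderiv ℝ ζ z) := h2.fderiv
    rw [h3]
    rfl
  refine ⟨O', fun t z ↦ extend hab (ζ z) t, hO', ⟨hzO, ?_⟩, ?_, ?_, ?_, ?_, ?_, ?_, ?_, ?_, ?_⟩
  · rw [mem_preimage, hζ0]; exact Metric.mem_ball_self hε
  · intro t
    exact (ev t).contDiff.comp_contDiffOn (hζ.mono hOO)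
  · intro t; simp [hζ0, extend]
  · intro z hz
    change extend hab (ζ z) t₀ = z
    rw [extend_of_mem hab _ (Ioo_subset_Icc_self ht₀), hζe z (hOO hz)]
    simp [primitive_apply, τ]
  · exact fun z hz t ↦ (hstay z hz _).2
  · intro z hz t ht
    exact hVW (hVmem t ht _ (hstay z hz _).1)
  · exact fun z _ ↦ continuous_extend hab _
  · intro z hz
    rw [continuous_clm_apply]
    intro v
    simp only [hd _ z hz]
    exact continuous_extend hab _
  · intro z hz t ht
    have := hasDerivAt_extend_of_eq_primitive hab τ (hζe z (hOO hz)) ht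
    convert this using 1
    have ht' := Ioo_subset_Icc_self ht
    change Y (t, extend hab (ζ z) t) = _
    rw [extend_of_mem hab _ ht', extend_of_mem hab _ ht', nemytskii_apply]
    exact (hYe t ht' _ (hstay z hz _).1).symm
  · intro z hz v t ht
    have := hasDerivAt_extend_of_eq_primitive hab τ
      (fderiv_flow_eq hab τ (Y := ⟨Y₁, hY₁.continuous⟩) hY₁ hO hζ hζe (hOO hz) v) ht
    simp only [hd _ z hz]
    convert this using 1
    have ht' := Ioo_subset_Icc_self ht
    rw [extend_of_mem hab _ ht', extend_of_mem hab _ ht', extend_of_mem hab _ ht',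
      curveApply_apply, nemytskii_apply]
    change _ = sndDeriv Y₁ (t, ζ z ⟨t, ht'⟩) _
    rw [hYd t ht' _ (hstay z hz _).1]

end FlowDerivative

section ParametricIntegral

universe u v
open MeasureTheory

/-- A smooth function can be integrated over a compact interval with respect to one of its
variables, and the result is smooth. -/
theorem contDiffAt_parametric_integral {X : Type u} {G : Type v} [NormedAddCommGroup X]
    [NormedSpace ℝ X] [FiniteDimensional ℝ X] [NormedAddCommGroup G] [NormedSpace ℝ G]
    [CompleteSpace G] {a b : ℝ} (hab : a ≤ b) {W : Set (ℝ × X)} (hW : IsOpen W) {x₀ : X}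
    (hx₀ : ∀ s ∈ Icc a b, (s, x₀) ∈ W) {f : ℝ × X → G} (hf : ContDiffOn ℝ ∞ f W) :
    ContDiffAt ℝ ∞ (fun x ↦ ∫ s in a..b, f (s, x)) x₀ ∧
    HasFDerivAt (fun x ↦ ∫ s in a..b, f (s, x)) (∫ s in a..b, sndDeriv f (s, x₀)) x₀ := by
  have hK : IsCompact (Icc a b ×ˢ {x₀}) := isCompact_Icc.prod isCompact_singleton
  obtain ⟨g, hg, V, hV, hKV, hVW, hgf⟩ := exists_contDiff_eqOn_nhds hW hK
    (by rintro ⟨s, z⟩ ⟨hs, rfl⟩; exact hx₀ s hs) hf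
  obtain ⟨u, v, hu, hv, hIu, hxv, huv⟩ := generalized_tube_lemma isCompact_Icc
    (isCompact_singleton (x := x₀)) hV hKV
  have hxv : x₀ ∈ v := hxv rfl
  have hVmem : ∀ s ∈ Icc a b, ∀ z ∈ v, (s, z) ∈ V := fun s hs z hz ↦ huv ⟨hIu hs, hz⟩
  -- the function is paired with the variable in order to work in a single universe
  let g' : C(ℝ × X, X × G) := ⟨fun q ↦ (q.2, g q), by have := hg.continuous; fun_prop⟩
  have hg' : ContDiff ℝ ∞ g' := contDiff_snd.prodMk hg
  have hdd : ∀ s x, sndDeriv g' (s, x) = (ContinuousLinearMap.id ℝ X).prod (sndDeriv g (s, x)) := by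
    intro s x
    have h1 := hasFDerivAt_slice (Y := g') (s := s) (z := x)
      (hg'.differentiable (by simp)).differentiableAt
    have h2 := (hasFDerivAt_id x).prodMk (hasFDerivAt_slice (Y := g) (s := s) (z := x)
      (hg.differentiable (by simp)).differentiableAt)
    exact h1.unique h2
  let T : C(Icc a b, X × G) →L[ℝ] G :=
    (ContinuousLinearMap.snd ℝ X G).comp
      ({ toFun := fun γ ↦ γ ⟨b, hab, le_rfl⟩
         map_add' := fun _ _ ↦ rfl
         map_smul' := fun _ _ ↦ rfl
         cont := ContinuousEvalConst.continuous_eval_const _ } ∘L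
        primitive (G := X × G) hab ⟨a, le_rfl, hab⟩)
  have hT : ∀ γ : C(Icc a b, X × G), T γ = ∫ s in a..b, (extend hab γ s).2 := by
    intro γ
    change (ContinuousLinearMap.snd ℝ X G) (∫ s in a..b, extend hab γ s) = _
    rw [← ContinuousLinearMap.intervalIntegral_comp_comm _
      ((continuous_extend hab _).intervalIntegrable _ _)]
    rfl
  let c : X →L[ℝ] C(Icc a b, X) :=
    { toFun := fun z ↦ ContinuousMap.const _ z
      map_add' := fun _ _ ↦ rfl
      map_smul' := fun _ _ ↦ rfl
      cont := ContinuousMap.continuous_const' }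
  -- the integral is a bounded operator applied to the Nemytskii operator at a constant curve
  have heq : ∀ x ∈ v, ∫ s in a..b, f (s, x) = T (nemytskii g' (c x)) := by
    intro x hx
    rw [hT]
    refine intervalIntegral.integral_congr fun s hs ↦ ?_
    rw [uIcc_of_le hab] at hs
    simp only [extend_of_mem hab _ hs]
    exact (hgf _ (hVmem s hs x hx)).symm
  have hev : (fun x ↦ ∫ s in a..b, f (s, x)) =ᶠ[𝓝 x₀] fun x ↦ T (nemytskii g' (c x)) := by
    filter_upwards [hv.mem_nhds hxv] with x hx using heq x hx
  constructor
  · refine ContDiffAt.congr_of_eventuallyEq ?_ hev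
    exact (T.contDiff.comp ((contDiff_nemytskii.{u, v} hg').comp c.contDiff)).contDiffAt
  · refine HasFDerivAt.congr_of_eventuallyEq ?_ hev
    have h1 := T.hasFDerivAt.comp x₀ ((hasFDerivAt_nemytskii hg' (c x₀)).comp x₀ c.hasFDerivAt)
    refine h1.congr_fderiv ?_
    ext w
    have hcont : Continuous (sndDeriv g) := (contDiff_sndDeriv hg).continuous
    have hi : ∫ s in a..b, sndDeriv f (s, x₀) = ∫ s in a..b, sndDeriv g (s, x₀) := by
      refine intervalIntegral.integral_congr fun s hs ↦ ?_
      rw [uIcc_of_le hab] at hs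
      have : g =ᶠ[𝓝 (s, x₀)] f := by
        filter_upwards [hV.mem_nhds (hVmem s hs _ hxv)] with q hq using hgf q hq
      simp only [sndDeriv, this.fderiv_eq]
    rw [hi, ContinuousLinearMap.intervalIntegral_apply
      ((show Continuous fun s : ℝ ↦ sndDeriv g (s, x₀) by fun_prop).intervalIntegrable _ _)]
    simp only [ContinuousLinearMap.comp_apply]
    rw [hT]
    refine intervalIntegral.integral_congr fun s hs ↦ ?_
    rw [uIcc_of_le hab] at hs
    simp only [extend_of_mem hab _ hs, curveApply_apply, nemytskii_apply]
    change (sndDeriv g' (s, x₀) w).2 = _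
    rw [hdd]
    rfl

end ParametricIntegral

/-! ### Lie algebroids on trivial bundles and their flows -/

section Derivatives

variable {X X' G : Type*} [NormedAddCommGroup X] [NormedSpace ℝ X] [NormedAddCommGroup X']
  [NormedSpace ℝ X'] [NormedAddCommGroup G] [NormedSpace ℝ G]

/-- The chain rule. Like the next rules it is stated for abstract spaces, so that applications to
spaces of operators do not unfold their norms during unification. -/
theorem hasDerivAt_comp_of_hasFDerivAt {C : X → G} {C' : X →L[ℝ] G} {g : ℝ → X} {g' : X} {t : ℝ}
    (hC : HasFDerivAt C C' (g t)) (hg : HasDerivAt g g' t) :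
    HasDerivAt (fun t ↦ C (g t)) (C' g') t :=
  hC.comp_hasDerivAt t hg

theorem hasDerivAt_fst_comp {g : ℝ → X × X'} {g' : X × X'} {t : ℝ} (h : HasDerivAt g g' t) :
    HasDerivAt (fun t ↦ (g t).1) g'.1 t :=
  hasDerivAt_comp_of_hasFDerivAt (ContinuousLinearMap.fst ℝ X X').hasFDerivAt h

theorem hasDerivAt_snd_comp {g : ℝ → X × X'} {g' : X × X'} {t : ℝ} (h : HasDerivAt g g' t) :
    HasDerivAt (fun t ↦ (g t).2) g'.2 t :=
  hasDerivAt_comp_of_hasFDerivAt (ContinuousLinearMap.snd ℝ X X').hasFDerivAt h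

theorem hasDerivAt_apply₂ {C : ℝ → X →L[ℝ] X →L[ℝ] G} {C' : X →L[ℝ] X →L[ℝ] G} {p q : ℝ → X}
    {p' q' : X} {t : ℝ} (hC : HasDerivAt C C' t) (hp : HasDerivAt p p' t)
    (hq : HasDerivAt q q' t) :
    HasDerivAt (fun t ↦ C t (p t) (q t)) (C' (p t) (q t) + C t p' (q t) + C t (p t) q') t := by
  have := (hC.clm_apply hp).clm_apply hq
  exact this

theorem hasFDerivAt_apply₂ {C : X' → X →L[ℝ] X →L[ℝ] G} {C' : X' →L[ℝ] X →L[ℝ] X →L[ℝ] G}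
    {p q : X' → X} {p' q' : X' →L[ℝ] X} {t : X'} (hC : HasFDerivAt C C' t)
    (hp : HasFDerivAt p p' t) (hq : HasFDerivAt q q' t) :
    DifferentiableAt ℝ (fun t ↦ C t (p t) (q t)) t ∧ ∀ ξ, fderiv ℝ (fun t ↦ C t (p t) (q t)) t ξ
      = C' ξ (p t) (q t) + C t (p' ξ) (q t) + C t (p t) (q' ξ) := by
  have := (hC.clm_apply hp).clm_apply hq
  refine ⟨this.differentiableAt, fun ξ ↦ ?_⟩
  rw [this.fderiv]
  simp
  abel

end Derivatives

section LocalAlgebroid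

variable {E : Type*} [NormedAddCommGroup E] [NormedSpace ℝ E]
  {F : Type*} [NormedAddCommGroup F] [NormedSpace ℝ F]

/-- A Lie algebroid structure on the trivial bundle with fibre `F` over the open set `Ω ⊆ E`, given
by the anchor `ρ` and the brackets `c y a b` of constant sections. The field `anchor` says that the
anchor preserves brackets, and `jacobi` is the Jacobi identity, both for constant sections; the
Leibniz rule determines all other brackets. -/
structure LocAlg (Ω : Set E) (ρ : E → F →L[ℝ] E) (c : E → F →L[ℝ] F →L[ℝ] F) : Prop where
  isOpen : IsOpen Ω
  smooth_anchor : ContDiffOn ℝ ∞ ρ Ω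
  smooth_bracket : ContDiffOn ℝ ∞ c Ω
  skew : ∀ x ∈ Ω, ∀ a b, c x a b = - c x b a
  anchor : ∀ x ∈ Ω, ∀ a b, ρ x (c x a b) = fderiv ℝ ρ x (ρ x a) b - fderiv ℝ ρ x (ρ x b) a
  jacobi : ∀ x ∈ Ω, ∀ a b d,
    c x a (c x b d) + fderiv ℝ c x (ρ x a) b d + (c x b (c x d a) + fderiv ℝ c x (ρ x b) d a)
      + (c x d (c x a b) + fderiv ℝ c x (ρ x d) a b) = 0

/-- The conditions at `x` for the bundle map with base map `f` and fibre maps `Φ` to be compatible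
with the anchors and the brackets. The bracket condition is the Maurer-Cartan type equation obtained
by applying `Φ` to two constant sections. -/
structure IsLocMor (ρ : E → F →L[ℝ] E) (c : E → F →L[ℝ] F →L[ℝ] F) (f : E → E)
    (Φ : E → F →L[ℝ] F) (x : E) : Prop where
  anchor : ∀ a, fderiv ℝ f x (ρ x a) = ρ (f x) (Φ x a)
  bracket : ∀ a b, fderiv ℝ Φ x (ρ x a) b - fderiv ℝ Φ x (ρ x b) a
    + c (f x) (Φ x a) (Φ x b) = Φ x (c x a b)

/-- The operator `a ↦ [a, v]` on constant sections `a`, for a section `v`. -/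
def adj (ρ : E → F →L[ℝ] E) (c : E → F →L[ℝ] F →L[ℝ] F) (v : E → F) (x : E) : F →L[ℝ] F :=
  (fderiv ℝ v x).comp (ρ x) - c x (v x)

variable {Ω : Set E} {ρ : E → F →L[ℝ] E} {c : E → F →L[ℝ] F →L[ℝ] F}

theorem LocAlg.hasFDerivAt_anchor (h : LocAlg Ω ρ c) {x : E} (hx : x ∈ Ω) :
    HasFDerivAt ρ (fderiv ℝ ρ x) x :=
  ((h.smooth_anchor.contDiffAt (h.isOpen.mem_nhds hx)).differentiableAt (by simp)).hasFDerivAt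

theorem LocAlg.hasFDerivAt_bracket (h : LocAlg Ω ρ c) {x : E} (hx : x ∈ Ω) :
    HasFDerivAt c (fderiv ℝ c x) x :=
  ((h.smooth_bracket.contDiffAt (h.isOpen.mem_nhds hx)).differentiableAt (by simp)).hasFDerivAt

theorem LocAlg.hasDerivAt_bracket_comp (h : LocAlg Ω ρ c) {g : ℝ → E} {g' : E} {t : ℝ}
    (hx : g t ∈ Ω) (hg : HasDerivAt g g' t) :
    HasDerivAt (fun t ↦ c (g t)) (fderiv ℝ c (g t) g') t :=
  hasDerivAt_comp_of_hasFDerivAt (G := F →L[ℝ] F →L[ℝ] F) (h.hasFDerivAt_bracket hx) hg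

theorem LocAlg.fderiv_anchor_apply (h : LocAlg Ω ρ c) {x : E} (hx : x ∈ Ω) {v : E → F}
    (hv : DifferentiableAt ℝ v x) (ξ : E) :
    fderiv ℝ (fun y ↦ ρ y (v y)) x ξ = fderiv ℝ ρ x ξ (v x) + ρ x (fderiv ℝ v x ξ) := by
  rw [((h.hasFDerivAt_anchor hx).clm_apply hv.hasFDerivAt).fderiv]
  simp [add_comm]

/-- The anchor maps `[v, a]` to the bracket of vector fields, for a constant section `a`. -/
theorem LocAlg.anchor_adj (h : LocAlg Ω ρ c) {x : E} (hx : x ∈ Ω) {v : E → F}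
    (hv : DifferentiableAt ℝ v x) (a : F) :
    fderiv ℝ ρ x (ρ x (v x)) a + ρ x (adj ρ c v x a) =
      fderiv ℝ (fun y ↦ ρ y (v y)) x (ρ x a) := by
  rw [h.fderiv_anchor_apply hx hv]
  simp only [adj, sub_apply, ContinuousLinearMap.comp_apply, map_sub, h.anchor x hx]
  abel

/-- The derivative of `adj ρ c v` by the product rule. -/
theorem LocAlg.hasFDerivAt_adj_apply (h : LocAlg Ω ρ c) {x : E} (hx : x ∈ Ω) {v : E → F}
    (hv : ContDiffAt ℝ ∞ v x) :
    DifferentiableAt ℝ (adj ρ c v) x ∧ ∀ ξ a, fderiv ℝ (adj ρ c v) x ξ a =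
      fderiv ℝ (fderiv ℝ v) x ξ (ρ x a) + fderiv ℝ v x (fderiv ℝ ρ x ξ a)
        - (fderiv ℝ c x ξ (v x) a + c x (fderiv ℝ v x ξ) a) := by
  have hv1 : HasFDerivAt v (fderiv ℝ v x) x := (hv.differentiableAt (by simp)).hasFDerivAt
  have hv2 : HasFDerivAt (fderiv ℝ v) (fderiv ℝ (fderiv ℝ v) x) x :=
    ((hv.fderiv_right (m := ∞) (by simp)).differentiableAt (by simp)).hasFDerivAt
  have := (hv2.clm_comp (h.hasFDerivAt_anchor hx)).sub
    ((h.hasFDerivAt_bracket hx).clm_apply hv1)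
  have h3 : HasFDerivAt (adj ρ c v) _ x := this
  refine ⟨h3.differentiableAt, fun ξ a ↦ ?_⟩
  rw [h3.fderiv]
  simp
  abel

/-- The Jacobi identity for a section `v` and two constant sections. -/
theorem LocAlg.jacobi_adj (h : LocAlg Ω ρ c) {x : E} (hx : x ∈ Ω) {v : E → F}
    (hv : ContDiffAt ℝ ∞ v x) (a b : F) :
    fderiv ℝ (adj ρ c v) x (ρ x a) b - fderiv ℝ (adj ρ c v) x (ρ x b) a
      + fderiv ℝ c x (ρ x (v x)) a b + c x (adj ρ c v x a) b + c x a (adj ρ c v x b)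
      = adj ρ c v x (c x a b) := by
  -- the second derivatives of `v` cancel by symmetry
  have hsym : fderiv ℝ (fderiv ℝ v) x (ρ x a) (ρ x b) = fderiv ℝ (fderiv ℝ v) x (ρ x b) (ρ x a) :=
    (hv.isSymmSndFDerivAt (by
      rw [minSmoothness_of_isRCLikeNormedField]; exact WithTop.coe_le_coe.2 le_top)).eq _ _
  have hskew : ∀ ξ a b, fderiv ℝ c x ξ a b = - fderiv ℝ c x ξ b a := by
    intro ξ a b
    have h1 : ∀ a b, HasFDerivAt (fun y ↦ c y a b) (((fderiv ℝ c x).flip a).flip b) x := by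
      intro a b
      have := ((h.hasFDerivAt_bracket hx).clm_apply (hasFDerivAt_const a x)).clm_apply
        (hasFDerivAt_const b x)
      refine this.congr_fderiv ?_
      ext; simp
    have h2 : HasFDerivAt (fun y ↦ c y a b) (-(((fderiv ℝ c x).flip b).flip a)) x :=
      (h1 b a).neg.congr_of_eventuallyEq (by
        filter_upwards [h.isOpen.mem_nhds hx] with y hy using h.skew y hy a b)
    exact congrArg (fun D : E →L[ℝ] F ↦ D ξ) ((h1 a b).unique h2)
  obtain ⟨-, hd⟩ := h.hasFDerivAt_adj_apply hx hv
  have hj := h.jacobi x hx (v x) a b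
  have han := congrArg (fderiv ℝ v x) (h.anchor x hx a b)
  rw [map_sub] at han
  rw [hd, hd, hsym]
  simp only [adj, sub_apply, ContinuousLinearMap.comp_apply, map_sub]
  rw [han]
  have s1 := hskew (ρ x a) b (v x)
  have s2 := h.skew x hx a (c x b (v x))
  have s3 := h.skew x hx b (v x)
  have s4 := h.skew x hx (c x (v x) a) b
  have s5 := h.skew x hx a (fderiv ℝ v x (ρ x b))
  rw [s1, s3, map_neg] at hj
  rw [s4, s5]
  have s6 : c x a (c x (v x) b) = - c x a (c x b (v x)) := by rw [s3, map_neg, neg_neg]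
  rw [← sub_eq_zero]
  refine Eq.trans ?_ hj
  rw [s6]
  abel

end LocalAlgebroid

section FlowOfSection

variable {E : Type*} [NormedAddCommGroup E] [NormedSpace ℝ E] [FiniteDimensional ℝ E]
  {F : Type*} [NormedAddCommGroup F] [NormedSpace ℝ F] [FiniteDimensional ℝ F]
  {Ω : Set E} {ρ : E → F →L[ℝ] E} {c : E → F →L[ℝ] F →L[ℝ] F}

/-- The vector field on `E × End F` generated by a time-dependent section `v`, whose integral
curves through `(x, 1)` are the flow of `v` on the Lie algebroid. -/
def sectionField (ρ : E → F →L[ℝ] E) (c : E → F →L[ℝ] F →L[ℝ] F) (v : ℝ × E → F)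
    (q : ℝ × (E × (F →L[ℝ] F))) : E × (F →L[ℝ] F) :=
  (ρ q.2.1 (v (q.1, q.2.1)), (adj ρ c (fun y ↦ v (q.1, y)) q.2.1).comp q.2.2)

variable {W : Set (ℝ × E)} {v : ℝ × E → F}

theorem contDiffAt_slice (hW : IsOpen W) (hv : ContDiffOn ℝ ∞ v W) {t : ℝ} {x : E}
    (h : (t, x) ∈ W) : ContDiffAt ℝ ∞ (fun y ↦ v (t, y)) x :=
  (hv.contDiffAt (hW.mem_nhds h)).comp x (f := fun y ↦ (t, y)) (by fun_prop)

theorem fderiv_slice (hW : IsOpen W) (hv : ContDiffOn ℝ ∞ v W) {t : ℝ} {x : E}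
    (h : (t, x) ∈ W) : fderiv ℝ (fun y ↦ v (t, y)) x = sndDeriv v (t, x) :=
  (hasFDerivAt_slice ((hv.contDiffAt (hW.mem_nhds h)).differentiableAt (by simp))).fderiv

theorem contDiffOn_sndDeriv (hW : IsOpen W) (hv : ContDiffOn ℝ ∞ v W) :
    ContDiffOn ℝ ∞ (sndDeriv v) W :=
  (hv.fderiv_of_isOpen hW (by simp)).clm_comp contDiffOn_const

theorem LocAlg.contDiffOn_adj (h : LocAlg Ω ρ c) (hW : IsOpen W) (hWΩ : ∀ q ∈ W, q.2 ∈ Ω)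
    (hv : ContDiffOn ℝ ∞ v W) :
    ContDiffOn ℝ ∞ (fun q : ℝ × E ↦ adj ρ c (fun y ↦ v (q.1, y)) q.2) W := by
  have h1 : ContDiffOn ℝ ∞ (fun q : ℝ × E ↦ ρ q.2) W :=
    h.smooth_anchor.comp contDiffOn_snd hWΩ
  have h2 : ContDiffOn ℝ ∞ (fun q : ℝ × E ↦ c q.2) W :=
    h.smooth_bracket.comp contDiffOn_snd hWΩ
  refine (((contDiffOn_sndDeriv hW hv).clm_comp h1).sub (h2.clm_apply hv)).congr ?_
  rintro ⟨t, x⟩ hq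
  simp only [adj, fderiv_slice hW hv hq]

theorem LocAlg.contDiffOn_sectionField (h : LocAlg Ω ρ c) (hW : IsOpen W)
    (hWΩ : ∀ q ∈ W, q.2 ∈ Ω) (hv : ContDiffOn ℝ ∞ v W) :
    ContDiffOn ℝ ∞ (sectionField ρ c v) {q | (q.1, q.2.1) ∈ W} := by
  have h0 : ContDiffOn ℝ ∞ (fun q : ℝ × (E × (F →L[ℝ] F)) ↦ (q.1, q.2.1))
    {q | (q.1, q.2.1) ∈ W} := by fun_prop
  have h1 : ContDiffOn ℝ ∞ (fun q : ℝ × E ↦ ρ q.2) W :=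
    h.smooth_anchor.comp contDiffOn_snd hWΩ
  exact ((h1.clm_apply hv).comp h0 fun q hq ↦ hq).prodMk
    (((h.contDiffOn_adj hW hWΩ hv).comp h0 fun q hq ↦ hq).clm_comp (by fun_prop))

/-- The linearization of the vector field `sectionField`. Where `v` vanishes to second order it
reduces to `(ξ, Ψ) ↦ (0, D(ad v) ξ ∘ Φ)`, and maps of this form compose to zero. -/
theorem LocAlg.sndDeriv_sectionField (h : LocAlg Ω ρ c) (hW : IsOpen W)
    (hWΩ : ∀ q ∈ W, q.2 ∈ Ω) (hv : ContDiffOn ℝ ∞ v W) {t : ℝ} {x : E} (hq : (t, x) ∈ W)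
    (Φ : F →L[ℝ] F) (ξ : E) (Ψ : F →L[ℝ] F) :
    sndDeriv (sectionField ρ c v) (t, (x, Φ)) (ξ, Ψ) =
      (fderiv ℝ (fun y ↦ ρ y (v (t, y))) x ξ,
        (fderiv ℝ (adj ρ c (fun y ↦ v (t, y))) x ξ).comp Φ
          + (adj ρ c (fun y ↦ v (t, y)) x).comp Ψ) := by
  have hx : x ∈ Ω := hWΩ _ hq
  have hvt := contDiffAt_slice hW hv hq
  have hopen : IsOpen {q : ℝ × (E × (F →L[ℝ] F)) | (q.1, q.2.1) ∈ W} :=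
    hW.preimage (by fun_prop)
  have h1 := hasFDerivAt_slice (Y := sectionField ρ c v) (s := t) (z := (x, Φ))
    (((h.contDiffOn_sectionField hW hWΩ hv).contDiffAt
      (hopen.mem_nhds (show (t, (x, Φ)) ∈ {q : ℝ × (E × (F →L[ℝ] F)) | (q.1, q.2.1) ∈ W} from hq))
      ).differentiableAt (by simp))
  have hf : HasFDerivAt (fun z : E × (F →L[ℝ] F) ↦ z.1) (ContinuousLinearMap.fst ℝ E _) (x, Φ) :=
    hasFDerivAt_fst
  have hs : HasFDerivAt (fun z : E × (F →L[ℝ] F) ↦ z.2) (ContinuousLinearMap.snd ℝ E _) (x, Φ) :=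
    hasFDerivAt_snd
  have hX : DifferentiableAt ℝ (fun y ↦ ρ y (v (t, y))) x :=
    ((h.hasFDerivAt_anchor hx).clm_apply
      (hvt.differentiableAt (by simp)).hasFDerivAt).differentiableAt
  have h2 := (HasFDerivAt.comp (x, Φ) (g := fun y ↦ ρ y (v (t, y))) hX.hasFDerivAt hf).prodMk
    ((HasFDerivAt.comp (x, Φ) (g := adj ρ c (fun y ↦ v (t, y)))
      (h.hasFDerivAt_adj_apply hx hvt).1.hasFDerivAt hf).clm_comp hs)
  have h3 := h1.unique h2
  rw [h3]
  simp [add_comm]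

set_option maxHeartbeats 2000000 in
/-- A time-dependent section `v` that vanishes to second order at `p` has a flow near `p` for all
times in an interval; it consists of compatible pairs of a base map and fibre maps. -/
theorem LocAlg.exists_flow (h : LocAlg Ω ρ c) {a b : ℝ} {t₀ : ℝ} (ht₀ : t₀ ∈ Ioo a b)
    (hW : IsOpen W) (hWΩ : ∀ q ∈ W, q.2 ∈ Ω) (hv : ContDiffOn ℝ ∞ v W) {p : E}
    (hp : ∀ s ∈ Icc a b, (s, p) ∈ W) (hv0 : ∀ s ∈ Icc a b, v (s, p) = 0)
    (hv1 : ∀ s ∈ Icc a b, sndDeriv v (s, p) = 0) {Q : Set E} (hQ : Q ∈ 𝓝 p) :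
    ∃ (O : Set E) (f : ℝ → E → E) (Φ : ℝ → E → F →L[ℝ] F), IsOpen O ∧ p ∈ O ∧
      (∀ t, ContDiffOn ℝ ∞ (f t) O) ∧ (∀ t, ContDiffOn ℝ ∞ (Φ t) O) ∧
      (∀ t, f t p = p) ∧ (∀ t, Φ t p = 1) ∧
      (∀ x ∈ O, f t₀ x = x) ∧ (∀ x ∈ O, Φ t₀ x = 1) ∧
      (∀ x ∈ O, ∀ t, f t x ∈ Q) ∧
      (∀ x ∈ O, ∀ t ∈ Icc a b, (t, f t x) ∈ W) ∧
      (∀ x ∈ O, ∀ t ∈ Ioo a b, HasDerivAt (fun t ↦ f t x) (ρ (f t x) (v (t, f t x))) t) ∧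
      (∀ x ∈ O, ∀ t ∈ Ioo a b, HasDerivAt (fun t ↦ Φ t x)
        ((adj ρ c (fun y ↦ v (t, y)) (f t x)).comp (Φ t x)) t) ∧
      (∀ x ∈ O, ∀ t ∈ Ioo a b, IsLocMor ρ c (f t) (Φ t) x) := by
  set W' : Set (ℝ × (E × (F →L[ℝ] F))) := {q | (q.1, q.2.1) ∈ W}
  have hW' : IsOpen W' := hW.preimage (by fun_prop)
  have hadj0 : ∀ s ∈ Icc a b, adj ρ c (fun y ↦ v (s, y)) p = 0 := by
    intro s hs
    simp [adj, fderiv_slice hW hv (hp s hs), hv1 s hs, hv0 s hs]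
  have hX0 : ∀ s ∈ Icc a b, ∀ ξ, fderiv ℝ (fun y ↦ ρ y (v (s, y))) p ξ = 0 := by
    intro s hs ξ
    rw [h.fderiv_anchor_apply (v := fun y ↦ v (s, y)) (hWΩ _ (hp s hs))
      ((contDiffAt_slice hW hv (hp s hs)).differentiableAt (by simp)),
      fderiv_slice hW hv (hp s hs), hv1 s hs, hv0 s hs]
    simp
  obtain ⟨O, w, hO, hpO, hws, hwp, hw0, hwQ, hwW, hwc, hdc, hwd, hdd⟩ :=
    exists_local_flow ht₀ hW' (h.contDiffOn_sectionField hW hWΩ hv)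
      (z₀ := (p, ContinuousLinearMap.id ℝ F)) (fun s hs ↦ hp s hs)
      (fun s hs ↦ by simp [sectionField, hv0 s hs, hadj0 s hs])
      (fun s hs s' hs' u ↦ by
        obtain ⟨ξ, Ψ⟩ := u
        simp only [h.sndDeriv_sectionField hW hWΩ hv (hp s' hs'),
          h.sndDeriv_sectionField hW hWΩ hv (hp s hs), hadj0 s hs, hadj0 s' hs', hX0 s hs,
          hX0 s' hs']
        simp)
      (Q := Prod.fst ⁻¹' Q) (continuous_fst.continuousAt.preimage_mem_nhds hQ)
  set i : E → E × (F →L[ℝ] F) := fun x ↦ (x, ContinuousLinearMap.id ℝ F)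
  have hi : ContDiff ℝ ∞ i := by fun_prop
  have his : ∀ t, ContDiffOn ℝ ∞ (fun x ↦ w t (i x)) (i ⁻¹' O) := fun t ↦
    (hws t).comp hi.contDiffOn fun x hx ↦ hx
  have hiO : IsOpen (i ⁻¹' O) := hO.preimage hi.continuous
  -- derivatives of the base map and of the fibre maps
  have hfd : ∀ x ∈ i ⁻¹' O, ∀ t, ∀ ξ, fderiv ℝ (fun x ↦ (w t (i x)).1) x ξ =
      (fderiv ℝ (w t) (i x) (ξ, 0)).1 ∧ fderiv ℝ (fun x ↦ (w t (i x)).2) x ξ =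
      (fderiv ℝ (w t) (i x) (ξ, 0)).2 := by
    intro x hx t ξ
    have h1 : HasFDerivAt (w t) (fderiv ℝ (w t) (i x)) (i x) :=
      (((hws t).contDiffAt (hO.mem_nhds hx)).differentiableAt (by simp)).hasFDerivAt
    have h2 : HasFDerivAt i (ContinuousLinearMap.inl ℝ E (F →L[ℝ] F)) x :=
      hasFDerivAt_prodMk_left x _
    have h3 := h1.comp x h2
    constructor
    · have : HasFDerivAt (fun x ↦ (w t (i x)).1) _ x := h3.fst
      rw [this.fderiv]; rfl
    · have : HasFDerivAt (fun x ↦ (w t (i x)).2) _ x := h3.snd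
      rw [this.fderiv]; rfl
  refine ⟨i ⁻¹' O, fun t x ↦ (w t (i x)).1, fun t x ↦ (w t (i x)).2, hiO, hpO,
    fun t ↦ (his t).fst, fun t ↦ (his t).snd, fun t ↦ congrArg Prod.fst (hwp t),
    fun t ↦ congrArg Prod.snd (hwp t),
    fun x hx ↦ congrArg Prod.fst (hw0 _ hx),
    fun x hx ↦ congrArg Prod.snd (hw0 _ hx), fun x hx t ↦ hwQ _ hx t,
    fun x hx t ht ↦ hwW _ hx t ht, fun x hx t ht ↦ ?_, fun x hx t ht ↦ ?_, ?_⟩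
  · exact (hasDerivAt_fst_comp (hwd _ hx t ht))
  · exact (hasDerivAt_snd_comp (hwd _ hx t ht))
  intro x hx
  have hxΩ : x ∈ Ω := by
    have := hWΩ _ (hwW _ hx t₀ (Ioo_subset_Icc_self ht₀))
    rwa [hw0 _ hx] at this
  have hfΩ : ∀ t ∈ Icc a b, (w t (i x)).1 ∈ Ω := fun t ht ↦ hWΩ _ (hwW _ hx t ht)
  have hpath : ContinuousOn (fun t ↦ (t, (w t (i x)).1)) (Icc a b) :=
    (continuous_id.prodMk (continuous_fst.comp (hwc _ hx))).continuousOn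
  have hf' : ∀ t ∈ Ioo a b, HasDerivAt (fun t ↦ (w t (i x)).1)
      (ρ (w t (i x)).1 (v (t, (w t (i x)).1))) t :=
    fun t ht ↦ hasDerivAt_fst_comp (hwd _ hx t ht)
  have hΦ' : ∀ t ∈ Ioo a b, HasDerivAt (fun t ↦ (w t (i x)).2)
      ((adj ρ c (fun y ↦ v (t, y)) (w t (i x)).1).comp (w t (i x)).2) t :=
    fun t ht ↦ hasDerivAt_snd_comp (hwd _ hx t ht)
  have hu1 : ∀ ξ, ∀ t ∈ Ioo a b, HasDerivAt (fun t ↦ (fderiv ℝ (w t) (i x) (ξ, 0)).1)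
      (fderiv ℝ (fun y ↦ ρ y (v (t, y))) (w t (i x)).1 (fderiv ℝ (w t) (i x) (ξ, 0)).1) t := by
    intro ξ t ht
    refine HasDerivAt.congr_deriv
      (hasDerivAt_fst_comp (hdd _ hx (ξ, 0) t ht)) ?_
    exact (congrArg Prod.fst (h.sndDeriv_sectionField hW hWΩ hv
      (hwW _ hx t (Ioo_subset_Icc_self ht)) (w t (i x)).2 (fderiv ℝ (w t) (i x) (ξ, 0)).1
      (fderiv ℝ (w t) (i x) (ξ, 0)).2))
  have hu2 : ∀ ξ, ∀ t ∈ Ioo a b, HasDerivAt (fun t ↦ (fderiv ℝ (w t) (i x) (ξ, 0)).2)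
      ((fderiv ℝ (adj ρ c (fun y ↦ v (t, y))) (w t (i x)).1
          (fderiv ℝ (w t) (i x) (ξ, 0)).1).comp (w t (i x)).2
        + (adj ρ c (fun y ↦ v (t, y)) (w t (i x)).1).comp (fderiv ℝ (w t) (i x) (ξ, 0)).2) t := by
    intro ξ t ht
    refine HasDerivAt.congr_deriv
      (hasDerivAt_snd_comp (hdd _ hx (ξ, 0) t ht)) ?_
    exact (congrArg Prod.snd (h.sndDeriv_sectionField hW hWΩ hv
      (hwW _ hx t (Ioo_subset_Icc_self ht)) (w t (i x)).2 (fderiv ℝ (w t) (i x) (ξ, 0)).1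
      (fderiv ℝ (w t) (i x) (ξ, 0)).2))
  have hw0' : fderiv ℝ (w t₀) (i x) = ContinuousLinearMap.id ℝ _ := by
    have : w t₀ =ᶠ[𝓝 (i x)] id := by
      filter_upwards [hO.mem_nhds hx] with z hz using hw0 z hz
    rw [this.fderiv_eq, fderiv_id]
  have hvd : ∀ t ∈ Ioo a b, ContDiffAt ℝ ∞ (fun y ↦ v (t, y)) (w t (i x)).1 := fun t ht ↦
    contDiffAt_slice hW hv (hwW _ hx t (Ioo_subset_Icc_self ht))
  -- The defect in the compatibility with the anchors solves the linearized equation of the base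
  -- flow and vanishes at time `t₀`.
  have hG : ∀ α : F, ∀ t ∈ Ioo a b, ρ (w t (i x)).1 ((w t (i x)).2 α)
      - (fderiv ℝ (w t) (i x) (ρ x α, 0)).1 = 0 := by
    intro α
    refine eq_zero_of_linear_ode
      (A := fun t ↦ sndDeriv (fun q : ℝ × E ↦ ρ q.2 (v q)) (t, (w t (i x)).1)) ?_ ?_ ht₀ ?_
    · have h1 : ContDiffOn ℝ ∞ (fun q : ℝ × E ↦ ρ q.2) W :=
        h.smooth_anchor.comp contDiffOn_snd hWΩ
      exact (contDiffOn_sndDeriv hW (h1.clm_apply hv)).continuousOn.comp hpath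
        fun t ht ↦ hwW _ hx t ht
    · intro t ht
      have ht' := Ioo_subset_Icc_self ht
      have h1 : HasDerivAt (fun t ↦ ρ (w t (i x)).1) _ t :=
        hasDerivAt_comp_of_hasFDerivAt (h.hasFDerivAt_anchor (hfΩ t ht')) (hf' t ht)
      have h2 : HasDerivAt (fun t ↦ (w t (i x)).2 α) _ t :=
        (hΦ' t ht).clm_apply (hasDerivAt_const t α)
      have h3 := (h1.clm_apply h2).sub (hu1 (ρ x α) t ht)
      refine HasDerivAt.congr_deriv h3 ?_
      have hs : sndDeriv (fun q : ℝ × E ↦ ρ q.2 (v q)) (t, (w t (i x)).1) =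
          fderiv ℝ (fun y ↦ ρ y (v (t, y))) (w t (i x)).1 :=
        (fderiv_slice (v := fun q : ℝ × E ↦ ρ q.2 (v q)) hW
          ((h.smooth_anchor.comp contDiffOn_snd hWΩ).clm_apply hv) (hwW _ hx t ht')).symm
      rw [hs, map_sub, ← h.anchor_adj (v := fun y ↦ v (t, y)) (hfΩ t ht')
        ((hvd t ht).differentiableAt (by simp))]
      simp
    · simp [hw0', hw0 _ hx, i]
  -- The defect in the compatibility with the brackets solves a linear equation given by
  -- `adj ρ c v`, by the Jacobi identity, and vanishes at time `t₀`.
  have hK : ∀ α β : F, ∀ t ∈ Ioo a b, (fderiv ℝ (w t) (i x) (ρ x α, 0)).2 β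
      - (fderiv ℝ (w t) (i x) (ρ x β, 0)).2 α
      + c (w t (i x)).1 ((w t (i x)).2 α) ((w t (i x)).2 β) - (w t (i x)).2 (c x α β) = 0 := by
    intro α β
    refine eq_zero_of_linear_ode
      (A := fun t ↦ adj ρ c (fun y ↦ v (t, y)) (w t (i x)).1) ?_ ?_ ht₀ ?_
    · exact (h.contDiffOn_adj hW hWΩ hv).continuousOn.comp hpath fun t ht ↦ hwW _ hx t ht
    · intro t ht
      have ht' := Ioo_subset_Icc_self ht
      have h1 : HasDerivAt (fun t ↦ c (w t (i x)).1) _ t :=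
        h.hasDerivAt_bracket_comp (hfΩ t ht') (hf' t ht)
      have h2 : ∀ α, HasDerivAt (fun t ↦ (w t (i x)).2 α) _ t := fun α ↦
        (hΦ' t ht).clm_apply (hasDerivAt_const t α)
      have h3 : ∀ α β, HasDerivAt (fun t ↦ (fderiv ℝ (w t) (i x) (ρ x α, 0)).2 β) _ t :=
        fun α β ↦ (hu2 (ρ x α) t ht).clm_apply (hasDerivAt_const t β)
      have h4 := (((h3 α β).sub (h3 β α)).add (hasDerivAt_apply₂ h1 (h2 α) (h2 β))).sub
        (h2 (c x α β))
      refine HasDerivAt.congr_deriv h4 ?_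
      have e := fun α ↦ sub_eq_zero.1 (hG α t ht)
      have hj := h.jacobi_adj (hfΩ t ht') (hvd t ht) ((w t (i x)).2 α) ((w t (i x)).2 β)
      simp only [map_sub, map_add, ← e, add_apply, ContinuousLinearMap.comp_apply, map_zero,
        add_zero]
      rw [← hj]
      abel
    · simp [hw0', hw0 _ hx, i]
  intro t ht
  refine ⟨fun α ↦ ?_, fun α β ↦ ?_⟩
  · rw [(hfd x hx t _).1]
    exact (sub_eq_zero.1 (hG α t ht)).symm
  · rw [(hfd x hx t _).2, (hfd x hx t _).2]
    exact sub_eq_zero.1 (hK α β t ht)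

end FlowOfSection

/-! ### Two-forms on trivial bundles: Cartan's formula and the Moser equation -/

/-- The chain rule, for abstract spaces. -/
theorem hasFDerivAt_comp_of_hasFDerivAt {X X' G : Type*} [NormedAddCommGroup X] [NormedSpace ℝ X]
    [NormedAddCommGroup X'] [NormedSpace ℝ X'] [NormedAddCommGroup G] [NormedSpace ℝ G]
    {C : X → G} {C' : X →L[ℝ] G} {g : X' → X} {g' : X' →L[ℝ] X} {t : X'}
    (hC : HasFDerivAt C C' (g t)) (hg : HasFDerivAt g g' t) :
    HasFDerivAt (fun t ↦ C (g t)) (C'.comp g') t :=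
  hC.comp t hg

theorem contDiffOn_add_smul {X G : Type*} [NormedAddCommGroup X] [NormedSpace ℝ X]
    [NormedAddCommGroup G] [NormedSpace ℝ G] {g h : X → G} {O : Set X} (hg : ContDiffOn ℝ ∞ g O)
    (hh : ContDiffOn ℝ ∞ h O) :
    ContDiffOn ℝ ∞ (fun q : ℝ × X ↦ g q.2 + q.1 • h q.2) {q | q.2 ∈ O} :=
  (hg.comp contDiffOn_snd fun _ h ↦ h).add
    (contDiffOn_fst.smul (hh.comp contDiffOn_snd fun _ h ↦ h))

theorem fderiv_add_const_smul {X G : Type*} [NormedAddCommGroup X] [NormedSpace ℝ X]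
    [NormedAddCommGroup G] [NormedSpace ℝ G] {g h : X → G} {x : X} (hg : DifferentiableAt ℝ g x)
    (hh : DifferentiableAt ℝ h x) (t : ℝ) : DifferentiableAt ℝ (fun y ↦ g y + t • h y) x ∧
      fderiv ℝ (fun y ↦ g y + t • h y) x = fderiv ℝ g x + t • fderiv ℝ h x :=
  have h := hg.hasFDerivAt.add (hh.hasFDerivAt.const_smul t)
  ⟨h.differentiableAt, h.fderiv⟩

theorem hasDerivAt_add_id_smul {G : Type*} [NormedAddCommGroup G] [NormedSpace ℝ G] {g h : ℝ → G}
    {g' h' : G} {t : ℝ} (hg : HasDerivAt g g' t) (hh : HasDerivAt h h' t) :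
    HasDerivAt (fun t ↦ g t + t • h t) (g' + (t • h' + h t)) t := by
  refine HasDerivAt.congr_deriv (hg.add ((hasDerivAt_id t).smul hh)) ?_
  simp

section LocalForms

variable {E : Type*} [NormedAddCommGroup E] [NormedSpace ℝ E]
  {F : Type*} [NormedAddCommGroup F] [NormedSpace ℝ F]
  {Ω : Set E} {ρ : E → F →L[ℝ] E} {c : E → F →L[ℝ] F →L[ℝ] F}

/-- The two-form `η` is closed at `x`: the Chevalley-Eilenberg differential of `η` vanishes on
constant sections. -/
def LocClosed (ρ : E → F →L[ℝ] E) (c : E → F →L[ℝ] F →L[ℝ] F) (η : E → F →L[ℝ] F →L[ℝ] ℝ)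
    (x : E) : Prop :=
  ∀ a b d, fderiv ℝ η x (ρ x a) b d - fderiv ℝ η x (ρ x b) a d + fderiv ℝ η x (ρ x d) a b
    - η x (c x a b) d + η x (c x a d) b - η x (c x b d) a = 0

/-- The two-form `α` is at `x` the differential of the one-form `β`. -/
def LocPrimitive (ρ : E → F →L[ℝ] E) (c : E → F →L[ℝ] F →L[ℝ] F) (α : E → F →L[ℝ] F →L[ℝ] ℝ)
    (β : E → F →L[ℝ] ℝ) (x : E) : Prop :=
  ∀ a b, fderiv ℝ β x (ρ x a) b - fderiv ℝ β x (ρ x b) a - β x (c x a b) = α x a b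

/-- If `η` is closed, `η(v, ·) = -β` and `dβ = α`, then the Lie derivative of `η` along `v`
is `-α`. -/
theorem lie_derivative_eq {α η : E → F →L[ℝ] F →L[ℝ] ℝ} {β : E → F →L[ℝ] ℝ} {v : E → F} {x : E}
    (hη : DifferentiableAt ℝ η x) (hv : DifferentiableAt ℝ v x)
    (halt : ∀ a b, η x a b = - η x b a) (hcl : LocClosed ρ c η x)
    (hvβ : ∀ᶠ y in 𝓝 x, η y (v y) = - β y) (hp : LocPrimitive ρ c α β x) (a b : F) :
    α x a b + fderiv ℝ η x (ρ x (v x)) a b + η x (adj ρ c v x a) b + η x a (adj ρ c v x b) = 0 := by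
  have h1 : ∀ ξ b, fderiv ℝ η x ξ (v x) b + η x (fderiv ℝ v x ξ) b = - fderiv ℝ β x ξ b := by
    intro ξ b
    have e1 := (hη.hasFDerivAt.clm_apply hv.hasFDerivAt).congr_of_eventuallyEq
      (f₁ := fun y ↦ - β y) (by filter_upwards [hvβ] with y hy using hy.symm)
    have e3 : HasFDerivAt β _ x :=
      e1.neg.congr_of_eventuallyEq (Eventually.of_forall fun y ↦ by simp)
    rw [e3.fderiv]
    simp
    ring
  have h2 := hcl (v x) a b
  have h3 := hp a b
  have h4 := h1 (ρ x a) b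
  have h5 := h1 (ρ x b) a
  have h6 : η x (v x) (c x a b) = - β x (c x a b) := by rw [hvβ.self_of_nhds]; rfl
  have h7 := halt (c x a b) (v x)
  have h8 := halt a (adj ρ c v x b)
  simp only [adj, sub_apply, ContinuousLinearMap.comp_apply, map_sub] at h8 ⊢
  rw [h8]
  linarith

set_option maxHeartbeats 1000000 in
/-- The flow of a section along which the Lie derivative of `ω₀ + t α` is `-α` preserves the
time-dependent form `ω₀ + t α`. -/
theorem form_const_along_flow {a b : ℝ} {ω₀ α : E → F →L[ℝ] F →L[ℝ] ℝ} {f : ℝ → E} {f' : ℝ → E}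
    {Φ L : ℝ → F →L[ℝ] F} (hω : ∀ t ∈ Ioo a b, DifferentiableAt ℝ ω₀ (f t))
    (hα : ∀ t ∈ Ioo a b, DifferentiableAt ℝ α (f t))
    (hf : ∀ t ∈ Ioo a b, HasDerivAt f (f' t) t)
    (hΦ : ∀ t ∈ Ioo a b, HasDerivAt Φ ((L t).comp (Φ t)) t)
    (h : ∀ t ∈ Ioo a b, ∀ u w, α (f t) u w + fderiv ℝ (fun y ↦ ω₀ y + t • α y) (f t) (f' t) u w
      + (ω₀ (f t) + t • α (f t)) (L t u) w + (ω₀ (f t) + t • α (f t)) u (L t w) = 0)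
    {t₀ t₁ : ℝ} (ht₀ : t₀ ∈ Ioo a b) (ht₁ : t₁ ∈ Ioo a b) (u w : F) :
    (ω₀ (f t₁) + t₁ • α (f t₁)) (Φ t₁ u) (Φ t₁ w) =
      (ω₀ (f t₀) + t₀ • α (f t₀)) (Φ t₀ u) (Φ t₀ w) := by
  have key := eq_zero_of_linear_ode (a := a) (b := b) (A := fun _ ↦ (0 : ℝ →L[ℝ] ℝ))
    (g := fun t ↦ (ω₀ (f t) + t • α (f t)) (Φ t u) (Φ t w) -
      (ω₀ (f t₀) + t₀ • α (f t₀)) (Φ t₀ u) (Φ t₀ w)) continuousOn_const ?_ ht₀ (sub_self _) t₁ ht₁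
  · exact sub_eq_zero.1 key
  intro t ht
  have h1 : HasDerivAt (fun t ↦ ω₀ (f t)) (fderiv ℝ ω₀ (f t) (f' t)) t :=
    hasDerivAt_comp_of_hasFDerivAt (G := F →L[ℝ] F →L[ℝ] ℝ) (hω t ht).hasFDerivAt (hf t ht)
  have h2 : HasDerivAt (fun t ↦ α (f t)) (fderiv ℝ α (f t) (f' t)) t :=
    hasDerivAt_comp_of_hasFDerivAt (G := F →L[ℝ] F →L[ℝ] ℝ) (hα t ht).hasFDerivAt (hf t ht)
  have h3 : HasDerivAt (fun t ↦ ω₀ (f t) + t • α (f t)) _ t :=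
    hasDerivAt_add_id_smul (G := F →L[ℝ] F →L[ℝ] ℝ) h1 h2
  have h4 : ∀ u, HasDerivAt (fun t ↦ Φ t u) (L t (Φ t u)) t := fun u ↦ by
    have := (hΦ t ht).clm_apply (hasDerivAt_const t u)
    simpa using this
  have h5 := (hasDerivAt_apply₂ h3 (h4 u) (h4 w)).sub_const
    ((ω₀ (f t₀) + t₀ • α (f t₀)) (Φ t₀ u) (Φ t₀ w))
  refine h5.congr_deriv ?_
  have h6 := h t ht (Φ t u) (Φ t w)
  have h7 : fderiv ℝ (fun y ↦ ω₀ y + t • α y) (f t) (f' t) =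
      fderiv ℝ ω₀ (f t) (f' t) + t • fderiv ℝ α (f t) (f' t) := by
    rw [(fderiv_add_const_smul (G := F →L[ℝ] F →L[ℝ] ℝ) (hω t ht) (hα t ht) t).2]; rfl
  rw [h7] at h6
  simp only [add_apply, smul_apply, smul_eq_mul, zero_apply] at h6 ⊢
  linarith

/-- A Lie algebroid morphism from `Tℝ × A` to `A` in local coordinates: base map `r`, and fibre map
`(u, a) ↦ u • w + P a`. The fields are the compatibility with the anchors and with the brackets. -/
structure LocHomotopy (Ω : Set E) (ρ : E → F →L[ℝ] E) (c : E → F →L[ℝ] F →L[ℝ] F)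
    (W : Set (ℝ × E)) (r : ℝ × E → E) (P : ℝ × E → F →L[ℝ] F) (w : ℝ × E → F) : Prop where
  isOpen : IsOpen W
  mem : ∀ q ∈ W, r q ∈ Ω
  smooth_base : ContDiffOn ℝ ∞ r W
  smooth_fibre : ContDiffOn ℝ ∞ P W
  smooth_time : ContDiffOn ℝ ∞ w W
  anchor_time : ∀ q ∈ W, fderiv ℝ r q (1, 0) = ρ (r q) (w q)
  anchor_space : ∀ q ∈ W, ∀ a, sndDeriv r q (ρ q.2 a) = ρ (r q) (P q a)
  bracket_time : ∀ q ∈ W, ∀ a,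
    fderiv ℝ P q (1, 0) a = sndDeriv w q (ρ q.2 a) - c (r q) (w q) (P q a)
  bracket_space : ∀ q ∈ W, ∀ a b, sndDeriv P q (ρ q.2 a) b - sndDeriv P q (ρ q.2 b) a
    + c (r q) (P q a) (P q b) = P q (c q.2 a b)

variable {W : Set (ℝ × E)} {r : ℝ × E → E} {P : ℝ × E → F →L[ℝ] F} {w : ℝ × E → F}

/-- The contraction with the time direction of the pullback of `α` under a homotopy, as a one-form
on `A`. -/
def contraction (α : E → F →L[ℝ] F →L[ℝ] ℝ) (r : ℝ × E → E) (P : ℝ × E → F →L[ℝ] F)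
    (w : ℝ × E → F) (q : ℝ × E) : F →L[ℝ] ℝ :=
  (α (r q) (w q)).comp (P q)

theorem LocHomotopy.contDiffOn_contraction (h : LocHomotopy Ω ρ c W r P w)
    {α : E → F →L[ℝ] F →L[ℝ] ℝ} (hα : ContDiffOn ℝ ∞ α Ω) :
    ContDiffOn ℝ ∞ (contraction α r P w) W :=
  ((hα.comp h.smooth_base h.mem).clm_apply h.smooth_time).clm_comp h.smooth_fibre

theorem LocHomotopy.fderiv_contraction (h : LocHomotopy Ω ρ c W r P w) (hΩ : IsOpen Ω)
    {α : E → F →L[ℝ] F →L[ℝ] ℝ} (hα : ContDiffOn ℝ ∞ α Ω) {q : ℝ × E} (hq : q ∈ W) (ξ : E)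
    (b : F) : sndDeriv (contraction α r P w) q ξ b =
      fderiv ℝ α (r q) (sndDeriv r q ξ) (w q) (P q b) + α (r q) (sndDeriv w q ξ) (P q b)
        + α (r q) (w q) (sndDeriv P q ξ b) := by
  have hr : HasFDerivAt r (fderiv ℝ r q) q :=
    ((h.smooth_base.contDiffAt (h.isOpen.mem_nhds hq)).differentiableAt (by simp)).hasFDerivAt
  have hP : HasFDerivAt P (fderiv ℝ P q) q :=
    ((h.smooth_fibre.contDiffAt (h.isOpen.mem_nhds hq)).differentiableAt (by simp)).hasFDerivAt
  have hw : HasFDerivAt w (fderiv ℝ w q) q :=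
    ((h.smooth_time.contDiffAt (h.isOpen.mem_nhds hq)).differentiableAt (by simp)).hasFDerivAt
  have hα' : HasFDerivAt α (fderiv ℝ α (r q)) (r q) :=
    ((hα.contDiffAt (hΩ.mem_nhds (h.mem q hq))).differentiableAt (by simp)).hasFDerivAt
  have hαr : HasFDerivAt (fun q ↦ α (r q)) ((fderiv ℝ α (r q)).comp (fderiv ℝ r q)) q :=
    hasFDerivAt_comp_of_hasFDerivAt (G := F →L[ℝ] F →L[ℝ] ℝ) hα' hr
  have h1 : HasFDerivAt (contraction α r P w) _ q := (hαr.clm_apply hw).clm_comp hP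
  rw [sndDeriv, h1.fderiv]
  simp [sndDeriv]
  ring

/-- Cartan's formula for a homotopy: the pullback of a closed form `α` at time `t` has as time
derivative the differential of the contraction with the time direction. -/
theorem LocHomotopy.hasDerivAt_pullback (h : LocHomotopy Ω ρ c W r P w) (hΩ : IsOpen Ω)
    {α : E → F →L[ℝ] F →L[ℝ] ℝ} (hα : ContDiffOn ℝ ∞ α Ω)
    (halt : ∀ x ∈ Ω, ∀ a b, α x a b = - α x b a) (hcl : ∀ x ∈ Ω, LocClosed ρ c α x)
    {t : ℝ} {x : E} (hq : (t, x) ∈ W) (a b : F) :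
    HasDerivAt (fun s ↦ α (r (s, x)) (P (s, x) a) (P (s, x) b))
      (sndDeriv (contraction α r P w) (t, x) (ρ x a) b
        - sndDeriv (contraction α r P w) (t, x) (ρ x b) a
        - contraction α r P w (t, x) (c x a b)) t := by
  have hi : HasDerivAt (fun s : ℝ ↦ (s, x)) ((1 : ℝ), (0 : E)) t :=
    (hasDerivAt_id t).prodMk (hasDerivAt_const t x)
  have hr : HasDerivAt (fun s ↦ r (s, x)) (fderiv ℝ r (t, x) (1, 0)) t :=
    hasDerivAt_comp_of_hasFDerivAt (g := fun s : ℝ ↦ (s, x))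
      ((h.smooth_base.contDiffAt (h.isOpen.mem_nhds hq)).differentiableAt (by simp)).hasFDerivAt hi
  have hP : HasDerivAt (fun s ↦ P (s, x)) (fderiv ℝ P (t, x) (1, 0)) t :=
    hasDerivAt_comp_of_hasFDerivAt (g := fun s : ℝ ↦ (s, x))
      ((h.smooth_fibre.contDiffAt (h.isOpen.mem_nhds hq)).differentiableAt (by simp)).hasFDerivAt hi
  have hα' : HasFDerivAt α (fderiv ℝ α (r (t, x))) (r (t, x)) :=
    ((hα.contDiffAt (hΩ.mem_nhds (h.mem _ hq))).differentiableAt (by simp)).hasFDerivAt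
  have hαr : HasDerivAt (fun s ↦ α (r (s, x))) (fderiv ℝ α (r (t, x)) (fderiv ℝ r (t, x) (1, 0)))
      t := hasDerivAt_comp_of_hasFDerivAt (G := F →L[ℝ] F →L[ℝ] ℝ) (g := fun s ↦ r (s, x)) hα' hr
  have hPa : ∀ a, HasDerivAt (fun s ↦ P (s, x) a) (fderiv ℝ P (t, x) (1, 0) a) t := fun a ↦ by
    have := hP.clm_apply (hasDerivAt_const t a)
    simpa using this
  refine (hasDerivAt_apply₂ hαr (hPa a) (hPa b)).congr_deriv ?_
  have e1 := h.bracket_time _ hq a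
  have e2 := h.bracket_time _ hq b
  have e3 := h.bracket_space _ hq a b
  have e4 := hcl _ (h.mem _ hq) (w (t, x)) (P (t, x) a) (P (t, x) b)
  have e5 := halt _ (h.mem _ hq) (P (t, x) a) (sndDeriv w (t, x) (ρ x b))
  have e6 := halt _ (h.mem _ hq) (P (t, x) a) (c (r (t, x)) (w (t, x)) (P (t, x) b))
  have e7 := halt _ (h.mem _ hq) (w (t, x)) (c (r (t, x)) (P (t, x) a) (P (t, x) b))
  have e8 : contraction α r P w (t, x) (c x a b) = α (r (t, x)) (w (t, x)) (P (t, x) (c x a b)) :=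
    rfl
  rw [h.fderiv_contraction hΩ hα hq, h.fderiv_contraction hΩ hα hq, h.anchor_time _ hq, e1, e2,
    h.anchor_space _ hq, h.anchor_space _ hq, e8]
  rw [← e3]
  simp only [map_sub, map_add, sub_apply]
  linarith

/-- Integrating the contraction over time gives a primitive of `α` if the homotopy ends at the
identity and starts at a map that pulls `α` back to zero. -/
theorem LocHomotopy.locPrimitive [FiniteDimensional ℝ E] [FiniteDimensional ℝ F]
    (h : LocHomotopy Ω ρ c W r P w) (hΩ : IsOpen Ω)
    {α : E → F →L[ℝ] F →L[ℝ] ℝ} (hα : ContDiffOn ℝ ∞ α Ω)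
    (halt : ∀ x ∈ Ω, ∀ a b, α x a b = - α x b a) (hcl : ∀ x ∈ Ω, LocClosed ρ c α x)
    {x : E} (hq : ∀ s ∈ Icc (0 : ℝ) 1, (s, x) ∈ W) (h1r : r (1, x) = x) (h1P : ∀ a, P (1, x) a = a)
    (h0 : α (r (0, x)) = 0) :
    LocPrimitive ρ c α (fun y ↦ ∫ s in (0 : ℝ)..1, contraction α r P w (s, y)) x := by
  intro a b
  have hsm := h.contDiffOn_contraction hα
  have hsm' := contDiffOn_sndDeriv h.isOpen hsm
  rw [(contDiffAt_parametric_integral zero_le_one h.isOpen hq hsm).2.fderiv]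
  have hpath : ContinuousOn (fun s : ℝ ↦ (s, x)) (Icc 0 1) := by fun_prop
  have hi1 : IntervalIntegrable (fun s ↦ sndDeriv (contraction α r P w) (s, x))
      MeasureTheory.volume 0 1 :=
    (hsm'.continuousOn.comp hpath hq).intervalIntegrable_of_Icc zero_le_one
  have hc2 : ContinuousOn (fun s ↦ contraction α r P w (s, x)) (Icc 0 1) :=
    hsm.continuousOn.comp hpath hq
  have hc1 : ContinuousOn (fun s ↦ sndDeriv (contraction α r P w) (s, x)) (Icc 0 1) :=
    hsm'.continuousOn.comp hpath hq
  have hi2 : IntervalIntegrable (fun s ↦ contraction α r P w (s, x)) MeasureTheory.volume 0 1 :=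
    hc2.intervalIntegrable_of_Icc zero_le_one
  have hc3 : ∀ ξ, ContinuousOn (fun s ↦ sndDeriv (contraction α r P w) (s, x) ξ) (Icc 0 1) :=
    fun ξ ↦ hc1.clm_apply continuousOn_const
  have hc4 : ∀ ξ b, ContinuousOn (fun s ↦ sndDeriv (contraction α r P w) (s, x) ξ b) (Icc 0 1) :=
    fun ξ b ↦ (hc3 ξ).clm_apply continuousOn_const
  have hc5 : ∀ b, ContinuousOn (fun s ↦ contraction α r P w (s, x) b) (Icc 0 1) :=
    fun b ↦ hc2.clm_apply continuousOn_const
  have hi4 := fun ξ b ↦ (hc4 ξ b).intervalIntegrable_of_Icc (μ := MeasureTheory.volume)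
    zero_le_one
  have hi5 := fun b ↦ (hc5 b).intervalIntegrable_of_Icc (μ := MeasureTheory.volume) zero_le_one
  have key := intervalIntegral.integral_eq_sub_of_hasDerivAt
    (f := fun s ↦ α (r (s, x)) (P (s, x) a) (P (s, x) b)) (a := 0) (b := 1)
    (fun s hs ↦ h.hasDerivAt_pullback hΩ hα halt hcl
      (hq s (by rwa [uIcc_of_le zero_le_one] at hs)) a b)
    (((hi4 _ _).sub (hi4 _ _)).sub (hi5 _))
  rw [intervalIntegral.integral_sub ((hi4 _ _).sub (hi4 _ _)) (hi5 _),
    intervalIntegral.integral_sub (hi4 _ _) (hi4 _ _)] at key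
  rw [ContinuousLinearMap.intervalIntegral_apply hi1,
    ContinuousLinearMap.intervalIntegral_apply hi1,
    ContinuousLinearMap.intervalIntegral_apply hi2,
    ContinuousLinearMap.intervalIntegral_apply
      ((hc3 _).intervalIntegrable_of_Icc zero_le_one),
    ContinuousLinearMap.intervalIntegral_apply
      ((hc3 _).intervalIntegrable_of_Icc zero_le_one), key, h0, h1r, h1P, h1P]
  simp

end LocalForms

section MoserSection

variable {E : Type*} [NormedAddCommGroup E] [NormedSpace ℝ E] [FiniteDimensional ℝ E]
  {F : Type*} [NormedAddCommGroup F] [NormedSpace ℝ F] [FiniteDimensional ℝ F]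

/-- The solution `v` of `(ω₀ + s α)(v, ·) = -β` at the time `s`. It is zero where `ω₀ + s α` is not
invertible, because `ContinuousLinearMap.inverse` is. -/
def moserSection (ω₀ α : E → F →L[ℝ] F →L[ℝ] ℝ) (β : E → F →L[ℝ] ℝ) (q : ℝ × E) : F :=
  - (ContinuousLinearMap.inverse (ω₀ q.2 + q.1 • α q.2)) (β q.2)

variable {Ω O : Set E} {ω₀ α : E → F →L[ℝ] F →L[ℝ] ℝ} {β : E → F →L[ℝ] ℝ}

/-- The points where `ω₀ + s α` is nondegenerate. -/
def nondegSet (O : Set E) (ω₀ α : E → F →L[ℝ] F →L[ℝ] ℝ) : Set (ℝ × E) :=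
  {q | q.2 ∈ O ∧ ω₀ q.2 + q.1 • α q.2 ∈ range ((↑) : (F ≃L[ℝ] F →L[ℝ] ℝ) → F →L[ℝ] F →L[ℝ] ℝ)}

theorem contDiffOn_form_pencil (hω : ContDiffOn ℝ ∞ ω₀ O) (hα : ContDiffOn ℝ ∞ α O) :
    ContDiffOn ℝ ∞ (fun q : ℝ × E ↦ ω₀ q.2 + q.1 • α q.2) {q | q.2 ∈ O} :=
  contDiffOn_add_smul hω hα

theorem isOpen_nondegSet (hO : IsOpen O) (hω : ContDiffOn ℝ ∞ ω₀ O) (hα : ContDiffOn ℝ ∞ α O) :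
    IsOpen (nondegSet O ω₀ α) :=
  (contDiffOn_form_pencil hω hα).continuousOn.isOpen_inter_preimage
    (hO.preimage continuous_snd) ContinuousLinearEquiv.isOpen

theorem contDiffOn_moserSection (hω : ContDiffOn ℝ ∞ ω₀ O) (hα : ContDiffOn ℝ ∞ α O)
    (hβ : ContDiffOn ℝ ∞ β O) :
    ContDiffOn ℝ ∞ (moserSection ω₀ α β) (nondegSet O ω₀ α) := by
  have h1 : ContDiffOn ℝ ∞ (fun q : ℝ × E ↦ ContinuousLinearMap.inverse (ω₀ q.2 + q.1 • α q.2))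
      (nondegSet O ω₀ α) := by
    rintro q ⟨hq, e, he⟩
    have h2 : ContDiffWithinAt ℝ ∞ (fun q : ℝ × E ↦ ω₀ q.2 + q.1 • α q.2) (nondegSet O ω₀ α) q :=
      (contDiffOn_form_pencil hω hα q hq).mono fun _ h ↦ h.1
    have h3 := contDiffAt_map_inverse (𝕜 := ℝ) (n := ∞) e
    rw [he] at h3
    exact h3.comp_contDiffWithinAt q h2
  exact (h1.clm_apply (hβ.comp contDiffOn_snd fun _ h ↦ h.1)).neg

theorem form_moserSection {q : ℝ × E} (hq : q ∈ nondegSet O ω₀ α) :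
    (ω₀ q.2 + q.1 • α q.2) (moserSection ω₀ α β q) = - β q.2 := by
  obtain ⟨-, e, he⟩ := hq
  rw [moserSection, map_neg, ← he, ContinuousLinearMap.inverse_equiv]
  simp

theorem moserSection_eq_zero {s : ℝ} {p : E} (hβ : β p = 0) : moserSection ω₀ α β (s, p) = 0 := by
  simp [moserSection, hβ]

set_option maxHeartbeats 1000000 in
/-- The section `moserSection` vanishes to second order where `β` does: differentiate its defining
equation. -/
theorem sndDeriv_moserSection_eq_zero (hO : IsOpen O) (hω : ContDiffOn ℝ ∞ ω₀ O)
    (hα : ContDiffOn ℝ ∞ α O) (hβs : ContDiffOn ℝ ∞ β O) {s : ℝ} {p : E}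
    (hq : (s, p) ∈ nondegSet O ω₀ α) (hβ : β p = 0) (hβ' : fderiv ℝ β p = 0) :
    sndDeriv (moserSection ω₀ α β) (s, p) = 0 := by
  have hopen := isOpen_nondegSet hO hω hα
  have hs := hasFDerivAt_slice (((contDiffOn_moserSection hω hα hβs).contDiffAt
    (hopen.mem_nhds hq)).differentiableAt (by simp))
  have h1 :=
    (fderiv_add_const_smul (G := F →L[ℝ] F →L[ℝ] ℝ)
      ((hω.contDiffAt (hO.mem_nhds hq.1)).differentiableAt (by simp))
      ((hα.contDiffAt (hO.mem_nhds hq.1)).differentiableAt (by simp)) s).1.hasFDerivAt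
  have h2 : HasFDerivAt β 0 p := hβ' ▸
    ((hβs.contDiffAt (hO.mem_nhds hq.1)).differentiableAt (by simp)).hasFDerivAt
  have h3 := h1.clm_apply hs
  have h4 : HasFDerivAt (𝕜 := ℝ) (fun y ↦ (ω₀ y + s • α y) (moserSection ω₀ α β (s, y)))
      (0 : E →L[ℝ] F →L[ℝ] ℝ) p := by
    have h5 := h2.neg
    rw [neg_zero] at h5
    refine h5.congr_of_eventuallyEq ?_
    filter_upwards [(hopen.preimage (show Continuous fun y : E ↦ (s, y) by fun_prop)).mem_nhds hq]
      with y hy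
    exact form_moserSection (q := (s, y)) hy
  have h6 := h3.unique h4
  obtain ⟨-, e, he⟩ := hq
  ext ξ
  have h7 := congrArg (fun D : E →L[ℝ] F →L[ℝ] ℝ ↦ D ξ) h6
  simp only [moserSection_eq_zero hβ, add_apply, ContinuousLinearMap.comp_apply,
    map_zero, add_zero, zero_apply] at h7
  have h8 : e (sndDeriv (moserSection ω₀ α β) (s, p) ξ) = 0 := by
    rw [← ContinuousLinearEquiv.coe_coe, he]; exact h7
  simpa using h8

end MoserSection

/-! ### Sections and vector fields in charts and trivializations -/

section Coordinates

variable {E : Type*} [NormedAddCommGroup E] [NormedSpace ℝ E]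
  {M : Type*} [TopologicalSpace M] [ChartedSpace E M] [IsManifold 𝓘(ℝ, E) ∞ M]
  {G : Type*} [NormedAddCommGroup G] [NormedSpace ℝ G]

/-- The differential at `x` of the chart of `M` at `p`, for `x` in the chart domain. -/
def chartDeriv (E : Type*) [NormedAddCommGroup E] [NormedSpace ℝ E]
    {M : Type*} [TopologicalSpace M] [ChartedSpace E M] (p x : M) :
    TangentSpace 𝓘(ℝ, E) x →L[ℝ] E :=
  mfderiv 𝓘(ℝ, E) 𝓘(ℝ, E) (chartAt E p) x

theorem contMDiffAt_chart {p x : M} (hx : x ∈ (chartAt E p).source) :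
    ContMDiffAt 𝓘(ℝ, E) 𝓘(ℝ, E) ∞ (chartAt E p) x :=
  (contMDiffOn_chart (I := 𝓘(ℝ, E)) (x := p)).contMDiffAt ((chartAt E p).open_source.mem_nhds hx)

theorem contMDiffAt_chart_symm {p : M} {y : E} (hy : y ∈ (chartAt E p).target) :
    ContMDiffAt 𝓘(ℝ, E) 𝓘(ℝ, E) ∞ (chartAt E p).symm y :=
  (contMDiffOn_chart_symm (I := 𝓘(ℝ, E)) (x := p)).contMDiffAt
    ((chartAt E p).open_target.mem_nhds hy)

theorem chartDeriv_injective {p x : M} (hx : x ∈ (chartAt E p).source) :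
    Function.Injective (chartDeriv E p x) := by
  have h1 := (contMDiffAt_chart (E := E) hx).mdifferentiableAt (by simp)
  have h2 := (contMDiffAt_chart_symm (E := E) ((chartAt E p).map_source hx)).mdifferentiableAt
    (by simp)
  have h := mfderiv_comp x h2 h1
  have e : (chartAt E p).symm ∘ (chartAt E p) =ᶠ[𝓝 x] id := by
    filter_upwards [(chartAt E p).open_source.mem_nhds hx] with z hz
    exact (chartAt E p).left_inv hz
  rw [e.mfderiv_eq, mfderiv_id] at h
  intro v w hvw
  have h' := fun v ↦ congrArg (fun L ↦ L v) h
  have hv := h' v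
  have hw := h' w
  simp only [ContinuousLinearMap.comp_apply] at hv hw
  change v = mfderiv _ _ _ _ (chartDeriv E p x v) at hv
  change w = mfderiv _ _ _ _ (chartDeriv E p x w) at hw
  rw [hv, hw, hvw]

/-- Smoothness of a function may be tested in any preferred chart. -/
theorem contMDiffAt_iff_chart {g : M → G} {p x : M} (hx : x ∈ (chartAt E p).source) :
    ContMDiffAt 𝓘(ℝ, E) 𝓘(ℝ, G) ∞ g x ↔
      ContDiffAt ℝ ∞ (fun y ↦ g ((chartAt E p).symm y)) (chartAt E p x) := by
  rw [← contMDiffAt_iff_contDiffAt]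
  constructor
  · intro h
    refine ContMDiffAt.comp _ ?_ (contMDiffAt_chart_symm ((chartAt E p).map_source hx))
    rwa [(chartAt E p).left_inv hx]
  · intro h
    refine (h.comp x (contMDiffAt_chart hx)).congr_of_eventuallyEq ?_
    filter_upwards [(chartAt E p).open_source.mem_nhds hx] with z hz
    simp [(chartAt E p).left_inv hz]

theorem mfderiv_comp_chart {S : E → G} {p x : M} (hx : x ∈ (chartAt E p).source)
    (hS : DifferentiableAt ℝ S (chartAt E p x)) (v : TangentSpace 𝓘(ℝ, E) x) :
    mfderiv 𝓘(ℝ, E) 𝓘(ℝ, G) (fun z ↦ S (chartAt E p z)) x v =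
      fderiv ℝ S (chartAt E p x) (chartDeriv E p x v) := by
  have := mfderiv_comp_apply (I := 𝓘(ℝ, E)) (I' := 𝓘(ℝ, E)) (I'' := 𝓘(ℝ, G)) x
    hS.mdifferentiableAt ((contMDiffAt_chart hx).mdifferentiableAt (by simp)) v
  rw [mfderiv_eq_fderiv] at this
  exact this

variable (F : Type*) [NormedAddCommGroup F] [NormedSpace ℝ F]
  {A : M → Type*} [TopologicalSpace (TotalSpace F A)] [∀ x, TopologicalSpace (A x)]
  [∀ x, AddCommGroup (A x)] [∀ x, Module ℝ (A x)]
  [FiberBundle F A] [VectorBundle ℝ F A]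

variable (A) in
/-- The points of `M` that lie in the domains of the preferred chart and of the preferred
trivialization of `A` at `p`. -/
def chartDom (p : M) : Set M := (chartAt E p).source ∩ (trivializationAt F A p).baseSet

variable (A) in
/-- The image of `chartDom F A p` in the model space. -/
def coordDom (p : M) : Set E :=
  (chartAt E p).target ∩ (chartAt E p).symm ⁻¹' (trivializationAt F A p).baseSet

/-- The preferred trivialization of `A` at `p` on the fibre over `x`; it is zero for `x` outside the
base set. -/
def toF (p x : M) : A x →L[ℝ] F := (trivializationAt F A p).continuousLinearMapAt ℝ x

/-- The inverse of the preferred trivialization of `A` at `p` on the fibre over `x`; it is zero for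
`x` outside the base set. -/
def ofF (p x : M) : F →L[ℝ] A x := (trivializationAt F A p).symmL ℝ x

variable (A) in
/-- The section of `A` with coordinates `S` near `p`. -/
def secOf (p : M) (S : E → F) (x : M) : A x := ofF F p x (S (chartAt E p x))

variable {F}

theorem mem_chartDom_self (p : M) : p ∈ chartDom (E := E) F A p :=
  ⟨mem_chart_source E p, mem_baseSet_trivializationAt F A p⟩

theorem isOpen_chartDom (p : M) : IsOpen (chartDom (E := E) F A p) :=
  (chartAt E p).open_source.inter (trivializationAt F A p).open_baseSet

theorem isOpen_coordDom (p : M) : IsOpen (coordDom (E := E) F A p) :=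
  (chartAt E p).isOpen_inter_preimage_symm (trivializationAt F A p).open_baseSet

theorem map_mem_coordDom {p x : M} (hx : x ∈ chartDom (E := E) F A p) :
    chartAt E p x ∈ coordDom (E := E) F A p :=
  ⟨(chartAt E p).map_source hx.1, by
    rw [mem_preimage, (chartAt E p).left_inv hx.1]; exact hx.2⟩

theorem symm_mem_chartDom {p : M} {y : E} (hy : y ∈ coordDom (E := E) F A p) :
    (chartAt E p).symm y ∈ chartDom (E := E) F A p :=
  ⟨(chartAt E p).map_target hy.1, hy.2⟩

theorem toF_ofF {p x : M} (hx : x ∈ chartDom (E := E) F A p) (a : F) :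
    toF F p x (ofF F p x a : A x) = a :=
  (trivializationAt F A p).continuousLinearMapAt_symmL hx.2 a

theorem ofF_toF {p x : M} (hx : x ∈ chartDom (E := E) F A p) (a : A x) :
    ofF F p x (toF F p x a) = a :=
  (trivializationAt F A p).symmL_continuousLinearMapAt hx.2 a

theorem toF_injective {p x : M} (hx : x ∈ chartDom (E := E) F A p) :
    Function.Injective (toF F p x : A x → F) :=
  Function.LeftInverse.injective (g := ofF F p x) (ofF_toF hx)

theorem toF_secOf {p x : M} (hx : x ∈ chartDom (E := E) F A p) (S : E → F) :
    toF F p x (secOf F A p S x) = S (chartAt E p x) := toF_ofF hx _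

theorem toF_eq_trivializationAt {p x : M} (hx : x ∈ chartDom (E := E) F A p) (a : A x) :
    toF F p x a = ((trivializationAt F A p) ⟨x, a⟩).2 := by
  exact Trivialization.continuousLinearMapAt_apply_of_mem (R := ℝ) _ hx.2 a

/-- A section is determined near `x` by its coordinates. -/
theorem eventuallyEq_secOf {p x : M} (hx : x ∈ chartDom (E := E) F A p) (σ : Π x, A x) :
    ∀ᶠ z in 𝓝 x, secOf F A p
      (fun y ↦ toF F p ((chartAt E p).symm y) (σ ((chartAt E p).symm y))) z = σ z := by
  filter_upwards [(isOpen_chartDom p).mem_nhds hx] with z hz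
  simp only [secOf]
  rw [(chartAt E p).left_inv hz.1, ofF_toF hz]

theorem eventually_nhds_symm {p x : M} (hx : x ∈ (chartAt E p).source) {P : M → Prop}
    (h : ∀ᶠ z in 𝓝 x, P z) : ∀ᶠ y in 𝓝 (chartAt E p x), P ((chartAt E p).symm y) := by
  have := (chartAt E p).continuousAt_symm ((chartAt E p).map_source hx)
  rw [ContinuousAt, (chartAt E p).left_inv hx] at this
  exact this.eventually h

theorem eventually_nhds_chart {p x : M} (hx : x ∈ (chartAt E p).source) {P : E → Prop}
    (h : ∀ᶠ y in 𝓝 (chartAt E p x), P y) : ∀ᶠ z in 𝓝 x, P (chartAt E p z) :=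
  ((chartAt E p).continuousAt hx).eventually h

variable [ContMDiffVectorBundle ∞ F A 𝓘(ℝ, E)]

/-- A section is smooth if and only if its coordinates are. -/
theorem contMDiffAt_section_iff_coord {p x : M} (hx : x ∈ chartDom (E := E) F A p)
    {σ : Π x, A x} :
    ContMDiffAt 𝓘(ℝ, E) (𝓘(ℝ, E).prod 𝓘(ℝ, F)) ∞ (fun x ↦ TotalSpace.mk' F x (σ x)) x ↔
      ContDiffAt ℝ ∞ (fun y ↦ toF F p ((chartAt E p).symm y) (σ ((chartAt E p).symm y)))
        (chartAt E p x) := by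
  rw [(trivializationAt F A p).contMDiffAt_section_iff hx.2,
    ← contMDiffAt_iff_chart (g := fun z ↦ toF F p z (σ z)) hx.1]
  apply Filter.EventuallyEq.contMDiffAt_iff
  filter_upwards [(isOpen_chartDom p).mem_nhds hx] with z hz
  rw [toF_eq_trivializationAt hz]

theorem contMDiffAt_secOf {p x : M} (hx : x ∈ chartDom (E := E) F A p) {S : E → F}
    (hS : ContDiffAt ℝ ∞ S (chartAt E p x)) :
    ContMDiffAt 𝓘(ℝ, E) (𝓘(ℝ, E).prod 𝓘(ℝ, F)) ∞
      (fun x ↦ TotalSpace.mk' F x (secOf F A p S x)) x := by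
  rw [contMDiffAt_section_iff_coord hx]
  refine hS.congr_of_eventuallyEq ?_
  filter_upwards [(isOpen_coordDom (F := F) (A := A) p).mem_nhds (map_mem_coordDom hx)] with y hy
  rw [toF_secOf (symm_mem_chartDom hy), (chartAt E p).right_inv hy.1]

theorem smoothSectionOn_secOf {p : M} {S : E → F} (hS : ContDiffOn ℝ ∞ S (coordDom F A p)) :
    SmoothSectionOn 𝓘(ℝ, E) F A (chartDom (E := E) F A p) (secOf F A p S) := by
  intro x hx
  have h := map_mem_coordDom hx
  exact (contMDiffAt_secOf hx
    (hS.contDiffAt ((isOpen_coordDom p).mem_nhds h))).contMDiffWithinAt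

end Coordinates

section Extension

variable {E : Type*} [NormedAddCommGroup E] [NormedSpace ℝ E] [FiniteDimensional ℝ E]
  {M : Type*} [TopologicalSpace M] [T2Space M] [ChartedSpace E M] [IsManifold 𝓘(ℝ, E) ∞ M]
  {F : Type*} [NormedAddCommGroup F] [NormedSpace ℝ F]
  {A : M → Type*} [TopologicalSpace (TotalSpace F A)] [∀ x, TopologicalSpace (A x)]
  [∀ x, AddCommGroup (A x)] [∀ x, Module ℝ (A x)]
  [FiberBundle F A] [VectorBundle ℝ F A] [ContMDiffVectorBundle ∞ F A 𝓘(ℝ, E)]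

/-- The germ of a smooth section at a point is the germ of a global smooth section. -/
theorem exists_section_eventuallyEq {σ : Π x, A x} {x : M}
    (h : ∀ᶠ z in 𝓝 x, ContMDiffAt 𝓘(ℝ, E) (𝓘(ℝ, E).prod 𝓘(ℝ, F)) ∞
      (fun x ↦ TotalSpace.mk' F x (σ x)) z) :
    ∃ σ' : Cₛ^∞⟮𝓘(ℝ, E); F, A⟯, ∀ᶠ z in 𝓝 x, σ' z = σ z := by
  obtain ⟨u, hu, huo, hxu⟩ := eventually_nhds_iff.1 h
  obtain ⟨f, -, hf⟩ := (SmoothBumpFunction.nhds_basis_tsupport (I := 𝓘(ℝ, E)) x).mem_iff.1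
    (huo.mem_nhds hxu)
  refine ⟨⟨(f : M → ℝ) • σ, ContMDiffOn.smul_section_of_tsupport f.contMDiff.contMDiffOn huo hf
    (fun z hz ↦ (hu z hz).contMDiffWithinAt)⟩, ?_⟩
  filter_upwards [f.eventuallyEq_one] with z hz
  change f z • σ z = σ z
  rw [hz, Pi.one_apply, one_smul]

theorem exists_section_secOf {p x : M} (hx : x ∈ chartDom (E := E) F A p) {S : E → F}
    (hS : ∀ᶠ y in 𝓝 (chartAt E p x), ContDiffAt ℝ ∞ S y) :
    ∃ σ' : Cₛ^∞⟮𝓘(ℝ, E); F, A⟯, ∀ᶠ z in 𝓝 x, σ' z = secOf F A p S z := by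
  apply exists_section_eventuallyEq
  filter_upwards [(isOpen_chartDom p).mem_nhds hx, eventually_nhds_chart hx.1 hS] with z hz hz'
  exact contMDiffAt_secOf hz hz'

/-- The germ of a smooth function at a point is the germ of a global smooth function. -/
theorem exists_function_eventuallyEq {g : M → ℝ} {x : M}
    (h : ∀ᶠ z in 𝓝 x, ContMDiffAt 𝓘(ℝ, E) 𝓘(ℝ, ℝ) ∞ g z) :
    ∃ f : C^∞⟮𝓘(ℝ, E), M; 𝓘(ℝ), ℝ⟯, ∀ᶠ z in 𝓝 x, f z = g z := by
  obtain ⟨u, hu, huo, hxu⟩ := eventually_nhds_iff.1 h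
  obtain ⟨f, -, hf⟩ := (SmoothBumpFunction.nhds_basis_tsupport (I := 𝓘(ℝ, E)) x).mem_iff.1
    (huo.mem_nhds hxu)
  refine ⟨⟨fun z ↦ f z • g z, contMDiff_of_tsupport fun z hz ↦ ?_⟩, ?_⟩
  · exact f.contMDiff.contMDiffAt.smul
      (hu z (hf (closure_mono (Function.support_smul_subset_left _ _) hz)))
  · filter_upwards [f.eventuallyEq_one] with z hz
    change f z • g z = g z
    rw [hz, Pi.one_apply, one_smul]

end Extension

/-! ### The anchor and the bracket in coordinates -/

section LocalForm

variable {E : Type*} [NormedAddCommGroup E] [NormedSpace ℝ E] [FiniteDimensional ℝ E]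
  {M : Type*} [TopologicalSpace M] [T2Space M] [ChartedSpace E M] [IsManifold 𝓘(ℝ, E) ∞ M]
  {F : Type*} [NormedAddCommGroup F] [NormedSpace ℝ F] [FiniteDimensional ℝ F]
  {A : M → Type*} [TopologicalSpace (TotalSpace F A)] [∀ x, TopologicalSpace (A x)]
  [∀ x, AddCommGroup (A x)] [∀ x, Module ℝ (A x)]
  [FiberBundle F A] [VectorBundle ℝ F A] [ContMDiffVectorBundle ∞ F A 𝓘(ℝ, E)]
  (𝒜 : LieAlgebroid 𝓘(ℝ, E) F A)

/-- Evaluation of smooth sections at a point, as a linear map. -/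
def evalSection (x : M) : Cₛ^∞⟮𝓘(ℝ, E); F, A⟯ →ₗ[ℝ] A x where
  toFun s := s x
  map_add' _ _ := rfl
  map_smul' _ _ := rfl

theorem LieAlgebroid.bracket_skew (σ τ : Cₛ^∞⟮𝓘(ℝ, E); F, A⟯) :
    𝒜.bracket σ τ = - 𝒜.bracket τ σ := by
  have := 𝒜.bracket_self (σ + τ)
  simp [𝒜.bracket_self] at this
  rw [eq_neg_iff_add_eq_zero]
  exact this

/-- The anchor of `A` in the coordinates at `p`. -/
def coordAnchor (p : M) (y : E) : F →L[ℝ] E :=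
  LinearMap.toContinuousLinearMap <|
    (chartDeriv E p ((chartAt E p).symm y)).toLinearMap ∘ₗ
      𝒜.anchor ((chartAt E p).symm y) ∘ₗ (ofF F p ((chartAt E p).symm y)).toLinearMap

theorem coordAnchor_apply {p x : M} (hx : x ∈ chartDom (E := E) F A p) (a : A x) :
    coordAnchor 𝒜 p (chartAt E p x) (toF F p x a) = chartDeriv E p x (𝒜.anchor x a) := by
  simp only [coordAnchor, LinearMap.coe_toContinuousLinearMap', LinearMap.comp_apply,
    ContinuousLinearMap.coe_coe]
  rw [(chartAt E p).left_inv hx.1, ofF_toF hx]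

theorem contDiffOn_coordAnchor (p : M) :
    ContDiffOn ℝ ∞ (coordAnchor 𝒜 p) (coordDom F A p) := by
  rw [contDiffOn_clm_apply]
  intro a y hy
  apply ContDiffAt.contDiffWithinAt
  have hx := symm_mem_chartDom hy
  set x := (chartAt E p).symm y with hxy
  have h1 := (𝒜.contMDiff_anchor.contMDiffAt).comp x
    (contMDiffAt_secOf hx (S := fun _ ↦ a) contDiffAt_const)
  have h2 := ((trivializationAt E (TangentSpace 𝓘(ℝ, E)) p).contMDiffAt_section_iff
    (IB := 𝓘(ℝ, E)) (n := ∞) (s := fun z ↦ 𝒜.anchor z (secOf F A p (fun _ : E ↦ a) z)) (x₀ := x)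
    (by simpa using hx.1)).1 h1
  have h3 : ContMDiffAt 𝓘(ℝ, E) 𝓘(ℝ, E) ∞
      (fun z ↦ chartDeriv E p z (𝒜.anchor z (secOf F A p (fun _ : E ↦ a) z))) x := by
    refine h2.congr_of_eventuallyEq ?_
    filter_upwards [(chartAt E p).open_source.mem_nhds hx.1] with z hz
    have := TangentBundle.continuousLinearMapAt_trivializationAt (I := 𝓘(ℝ, E)) hz
    rw [← Trivialization.continuousLinearMapAt_apply_of_mem (R := ℝ) _ (by simpa using hz), this]
    rfl
  rw [contMDiffAt_iff_chart hx.1, hxy, (chartAt E p).right_inv hy.1] at h3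
  exact h3

/-- The bracket with a section depends on the coordinates of that section through their value
and their derivative along the anchor. -/
theorem LieAlgebroid.toF_bracket_secOf_right {p x : M} (hx : x ∈ chartDom (E := E) F A p)
    (σ τ τ₀ : Cₛ^∞⟮𝓘(ℝ, E); F, A⟯) {T : E → F}
    (hT : ∀ᶠ y in 𝓝 (chartAt E p x), ContDiffAt ℝ ∞ T y)
    (hτ : ∀ᶠ z in 𝓝 x, τ z = secOf F A p T z)
    (hτ₀ : ∀ᶠ z in 𝓝 x, τ₀ z = secOf F A p (fun _ : E ↦ T (chartAt E p x)) z) :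
    toF F p x (𝒜.bracket σ τ x) = toF F p x (𝒜.bracket σ τ₀ x) +
      fderiv ℝ T (chartAt E p x) (chartDeriv E p x (𝒜.anchor x (σ x))) := by
  -- expand the coordinates of `τ` in a basis of `F` and apply the Leibniz rule to each term
  let b := Module.finBasis ℝ F
  let l : ∀ i, F →L[ℝ] ℝ := fun i ↦ LinearMap.toContinuousLinearMap (b.coord i)
  have hb : ∀ v : F, ∑ i, l i v • b i = v := fun v ↦ b.sum_repr v
  have he : ∀ i, ∃ e : Cₛ^∞⟮𝓘(ℝ, E); F, A⟯, ∀ᶠ z in 𝓝 x, e z = secOf F A p (fun _ : E ↦ b i) z :=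
    fun i ↦ exists_section_secOf hx (Eventually.of_forall fun _ ↦ contDiffAt_const)
  choose e he using he
  have hf : ∀ i, ∃ f : C^∞⟮𝓘(ℝ, E), M; 𝓘(ℝ), ℝ⟯, ∀ᶠ z in 𝓝 x, f z = l i (T (chartAt E p z)) := by
    intro i
    apply exists_function_eventuallyEq
    filter_upwards [(chartAt E p).open_source.mem_nhds hx.1, eventually_nhds_chart hx.1 hT]
      with z hz hz'
    exact (((l i).contDiff.contDiffAt.comp _ hz').contMDiffAt.comp z (contMDiffAt_chart hz))
  choose f hf using hf
  let g : ∀ i, Cₛ^∞⟮𝓘(ℝ, E); F, A⟯ := fun i ↦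
    ⟨fun z ↦ f i z • e i z, ContMDiff.smul_section (f i).contMDiff (e i).contMDiff⟩
  have h1 : 𝒜.bracket σ τ x = evalSection x (𝒜.bracket σ (∑ i, g i)) := by
    have := 𝒜.bracket_eq_zero_of_eventually σ (τ - ∑ i, g i) x (by
      filter_upwards [hτ, eventually_all.2 he, eventually_all.2 hf] with z h1 h2 h3
      change evalSection z (τ - ∑ i, g i) = 0
      rw [map_sub, map_sum, sub_eq_zero]
      change τ z = ∑ i, f i z • e i z
      simp_rw [h1, h2, h3, secOf, ← map_smul, ← map_sum, hb])
    rw [map_sub] at this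
    exact sub_eq_zero.1 this
  have h2 : 𝒜.bracket σ τ₀ x = evalSection x (𝒜.bracket σ (∑ i, f i x • e i)) := by
    have := 𝒜.bracket_eq_zero_of_eventually σ (τ₀ - ∑ i, f i x • e i) x (by
      filter_upwards [hτ₀, eventually_all.2 he] with z h1 h2
      change evalSection z (τ₀ - ∑ i, f i x • e i) = 0
      rw [map_sub, map_sum, sub_eq_zero]
      change τ₀ z = ∑ i, f i x • e i z
      simp_rw [h1, h2, (hf _).self_of_nhds, secOf, ← map_smul, ← map_sum, hb])
    rw [map_sub] at this
    exact sub_eq_zero.1 this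
  rw [h1, h2, map_sum, map_sum, map_sum, map_sum, map_sum, map_sum, ← sub_eq_iff_eq_add',
    ← Finset.sum_sub_distrib]
  have hd : DifferentiableAt ℝ T (chartAt E p x) := hT.self_of_nhds.differentiableAt (by simp)
  rw [← hb (fderiv ℝ T (chartAt E p x) (chartDeriv E p x (𝒜.anchor x (σ x))))]
  refine Finset.sum_congr rfl fun i _ ↦ ?_
  have h3 := 𝒜.leibniz (f i) σ (e i) (g i) (fun _ ↦ rfl) x
  have h4 : (show ℝ from mfderiv 𝓘(ℝ, E) 𝓘(ℝ) (f i) x (𝒜.anchor x (σ x))) =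
      l i (fderiv ℝ T (chartAt E p x) (chartDeriv E p x (𝒜.anchor x (σ x)))) := by
    rw [(show (f i : M → ℝ) =ᶠ[𝓝 x] _ from hf i).mfderiv_eq]
    have h5 := mfderiv_comp_chart (S := fun y ↦ l i (T y)) hx.1
      ((l i).differentiableAt.comp _ hd) (𝒜.anchor x (σ x))
    have h6 : HasFDerivAt (fun y ↦ l i (T y)) ((l i).comp (fderiv ℝ T (chartAt E p x)))
      (chartAt E p x) := (l i).hasFDerivAt.comp _ hd.hasFDerivAt
    exact h5.trans (congrArg (fun L ↦ L (chartDeriv E p x (𝒜.anchor x (σ x)))) h6.fderiv)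
  change toF F p x (𝒜.bracket σ (g i) x) - toF F p x (evalSection x (𝒜.bracket σ (f i x • e i))) = _
  rw [h3, h4]
  simp only [map_smul, map_add]
  change _ + l i _ • toF F p x (e i x) - f i x • toF F p x (𝒜.bracket σ (e i) x) = _
  rw [add_sub_cancel_left, (he i).self_of_nhds, toF_secOf hx]

variable {𝒜}

/-- The germ of `σ` at `x` is the germ of a global smooth section. On such germs the local bracket
is determined by the global one. -/
def HasExtension (F : Type*) [NormedAddCommGroup F] [NormedSpace ℝ F]
    {A : M → Type*} [TopologicalSpace (TotalSpace F A)] [∀ x, TopologicalSpace (A x)]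
    [∀ x, AddCommGroup (A x)] [∀ x, Module ℝ (A x)] [FiberBundle F A] [VectorBundle ℝ F A]
    (σ : Π x, A x) (x : M) : Prop :=
  ∃ σ' : Cₛ^∞⟮𝓘(ℝ, E); F, A⟯, ∀ᶠ z in 𝓝 x, σ' z = σ z

theorem hasExtension_secOf {p x : M} (hx : x ∈ chartDom (E := E) F A p) {S : E → F}
    (hS : ∀ᶠ y in 𝓝 (chartAt E p x), ContDiffAt ℝ ∞ S y) :
    HasExtension (E := E) F (secOf F A p S) x := exists_section_secOf hx hS

theorem hasExtension_const {p x : M} (hx : x ∈ chartDom (E := E) F A p) (a : F) :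
    HasExtension (E := E) F (secOf F A p (fun _ : E ↦ a)) x :=
  exists_section_secOf hx (Eventually.of_forall fun _ ↦ contDiffAt_const)

variable {σ σ₂ τ τ₂ : Π x, A x} {x : M}

theorem toLocal_bracket_congr (hσ : HasExtension (E := E) F σ x)
    (hτ : HasExtension (E := E) F τ x) (h₁ : ∀ᶠ z in 𝓝 x, σ₂ z = σ z)
    (h₂ : ∀ᶠ z in 𝓝 x, τ₂ z = τ z) : 𝒜.toLocal.bracket σ₂ τ₂ x = 𝒜.toLocal.bracket σ τ x := by
  obtain ⟨σ', hσ⟩ := hσ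
  obtain ⟨τ', hτ⟩ := hτ
  rw [𝒜.toLocal_bracket σ τ σ' τ' x hσ hτ, 𝒜.toLocal_bracket σ₂ τ₂ σ' τ' x]
  · filter_upwards [hσ, h₁] with z h h'
    rw [h, h']
  · filter_upwards [hτ, h₂] with z h h'
    rw [h, h']

theorem toLocal_bracket_skew (hσ : HasExtension (E := E) F σ x)
    (hτ : HasExtension (E := E) F τ x) :
    𝒜.toLocal.bracket σ τ x = - 𝒜.toLocal.bracket τ σ x := by
  obtain ⟨σ', hσ⟩ := hσ
  obtain ⟨τ', hτ⟩ := hτ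
  rw [𝒜.toLocal_bracket σ τ σ' τ' x hσ hτ, 𝒜.toLocal_bracket τ σ τ' σ' x hτ hσ, 𝒜.bracket_skew]
  rfl

theorem toLocal_bracket_add_right (hσ : HasExtension (E := E) F σ x)
    (hτ : HasExtension (E := E) F τ x) (hτ₂ : HasExtension (E := E) F τ₂ x) :
    𝒜.toLocal.bracket σ (fun z ↦ τ z + τ₂ z) x =
      𝒜.toLocal.bracket σ τ x + 𝒜.toLocal.bracket σ τ₂ x := by
  obtain ⟨σ', hσ⟩ := hσ
  obtain ⟨τ', hτ⟩ := hτ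
  obtain ⟨τ₂', hτ₂⟩ := hτ₂
  rw [𝒜.toLocal_bracket σ τ σ' τ' x hσ hτ, 𝒜.toLocal_bracket σ τ₂ σ' τ₂' x hσ hτ₂,
    𝒜.toLocal_bracket σ _ σ' (τ' + τ₂') x hσ, map_add]
  · rfl
  · filter_upwards [hτ, hτ₂] with z h1 h2
    change τ' z + τ₂' z = _
    rw [h1, h2]

theorem toLocal_bracket_smul_right (hσ : HasExtension (E := E) F σ x)
    (hτ : HasExtension (E := E) F τ x) (r : ℝ) :
    𝒜.toLocal.bracket σ (fun z ↦ r • τ z) x = r • 𝒜.toLocal.bracket σ τ x := by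
  obtain ⟨σ', hσ⟩ := hσ
  obtain ⟨τ', hτ⟩ := hτ
  rw [𝒜.toLocal_bracket σ τ σ' τ' x hσ hτ, 𝒜.toLocal_bracket σ _ σ' (r • τ') x hσ, map_smul]
  · rfl
  · filter_upwards [hτ] with z h1
    change r • τ' z = _
    rw [h1]

theorem toLocal_bracket_zero_left (hτ : HasExtension (E := E) F τ x) :
    𝒜.toLocal.bracket (fun z ↦ (0 : A z)) τ x = 0 := by
  obtain ⟨τ', hτ⟩ := hτ
  rw [𝒜.toLocal_bracket (fun z ↦ (0 : A z)) τ 0 τ' x (Eventually.of_forall fun _ ↦ rfl) hτ]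
  simp

theorem toLocal_bracket_eventuallyEq {σ' τ' : Cₛ^∞⟮𝓘(ℝ, E); F, A⟯}
    (hσ : ∀ᶠ z in 𝓝 x, σ' z = σ z) (hτ : ∀ᶠ z in 𝓝 x, τ' z = τ z) :
    ∀ᶠ z in 𝓝 x, 𝒜.bracket σ' τ' z = 𝒜.toLocal.bracket σ τ z := by
  filter_upwards [eventually_eventually_nhds.2 hσ, eventually_eventually_nhds.2 hτ] with z h1 h2
  rw [𝒜.toLocal_bracket σ τ σ' τ' z h1 h2]

theorem toLocal_jacobi {υ : Π x, A x} (hσ : HasExtension (E := E) F σ x)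
    (hτ : HasExtension (E := E) F τ x) (hυ : HasExtension (E := E) F υ x) :
    𝒜.toLocal.bracket σ (𝒜.toLocal.bracket τ υ) x =
      𝒜.toLocal.bracket (𝒜.toLocal.bracket σ τ) υ x +
        𝒜.toLocal.bracket τ (𝒜.toLocal.bracket σ υ) x := by
  obtain ⟨σ', hσ⟩ := hσ
  obtain ⟨τ', hτ⟩ := hτ
  obtain ⟨υ', hυ⟩ := hυ
  rw [𝒜.toLocal_bracket _ _ _ _ x hσ (toLocal_bracket_eventuallyEq hτ hυ),
    𝒜.toLocal_bracket _ _ _ _ x (toLocal_bracket_eventuallyEq hσ hτ) hυ,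
    𝒜.toLocal_bracket _ _ _ _ x hτ (toLocal_bracket_eventuallyEq hσ hυ), 𝒜.jacobi]
  rfl

theorem secOf_const_add (p : M) (a b : F) : secOf F A p (fun _ : E ↦ a + b) =
    fun z ↦ secOf F A p (fun _ : E ↦ a) z + secOf F A p (fun _ : E ↦ b) z := by
  funext z; simp [secOf]

theorem secOf_const_smul (p : M) (r : ℝ) (a : F) : secOf F A p (fun _ : E ↦ r • a) =
    fun z ↦ r • secOf F A p (fun _ : E ↦ a) z := by
  funext z; simp [secOf]

variable (𝒜)

open Classical in
/-- The bracket of the sections with constant coordinates, in the coordinates at `p`, extended by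
zero outside the coordinate domain. -/
def coordBracket (p : M) (y : E) : F →L[ℝ] F →L[ℝ] F :=
  if hy : y ∈ coordDom F A p then
    LinearMap.toContinuousBilinearMap <| LinearMap.mk₂ ℝ
      (fun a b ↦ toF F p ((chartAt E p).symm y) (𝒜.toLocal.bracket (secOf F A p fun _ : E ↦ a)
        (secOf F A p fun _ : E ↦ b) ((chartAt E p).symm y)))
      (fun a a' b ↦ by
        have h := symm_mem_chartDom hy
        rw [toLocal_bracket_skew (hasExtension_const h _) (hasExtension_const h _),
          secOf_const_add, toLocal_bracket_add_right (hasExtension_const h _)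
            (hasExtension_const h _) (hasExtension_const h _),
          toLocal_bracket_skew (hasExtension_const h a) (hasExtension_const h _),
          toLocal_bracket_skew (hasExtension_const h a') (hasExtension_const h _),
          neg_add, map_add])
      (fun r a b ↦ by
        have h := symm_mem_chartDom hy
        rw [toLocal_bracket_skew (hasExtension_const h _) (hasExtension_const h _),
          secOf_const_smul, toLocal_bracket_smul_right (hasExtension_const h _)
            (hasExtension_const h _),
          toLocal_bracket_skew (hasExtension_const h a) (hasExtension_const h _),
          ← smul_neg, map_smul])
      (fun a b b' ↦ by
        have h := symm_mem_chartDom hy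
        rw [secOf_const_add, toLocal_bracket_add_right (hasExtension_const h _)
            (hasExtension_const h _) (hasExtension_const h _), map_add])
      (fun r a b ↦ by
        have h := symm_mem_chartDom hy
        rw [secOf_const_smul, toLocal_bracket_smul_right (hasExtension_const h _)
            (hasExtension_const h _), map_smul])
  else 0

theorem coordBracket_symm_apply {p : M} {y : E} (hy : y ∈ coordDom F A p) (a b : F) :
    coordBracket 𝒜 p y a b = toF F p ((chartAt E p).symm y) (𝒜.toLocal.bracket
      (secOf F A p fun _ : E ↦ a) (secOf F A p fun _ : E ↦ b) ((chartAt E p).symm y)) := by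
  rw [coordBracket, dif_pos hy]
  rfl

theorem coordBracket_apply {p x : M} (hx : x ∈ chartDom (E := E) F A p) (a b : F) :
    coordBracket 𝒜 p (chartAt E p x) a b = toF F p x (𝒜.toLocal.bracket
      (secOf F A p fun _ : E ↦ a) (secOf F A p fun _ : E ↦ b) x) := by
  rw [coordBracket_symm_apply 𝒜 (map_mem_coordDom hx), (chartAt E p).left_inv hx.1]

/-- The Leibniz rule in coordinates. -/
theorem toF_bracket_right {p : M} (hx : x ∈ chartDom (E := E) F A p)
    (hσ : HasExtension (E := E) F σ x) {T : E → F}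
    (hT : ∀ᶠ y in 𝓝 (chartAt E p x), ContDiffAt ℝ ∞ T y) :
    toF F p x (𝒜.toLocal.bracket σ (secOf F A p T) x) =
      toF F p x (𝒜.toLocal.bracket σ (secOf F A p (fun _ : E ↦ T (chartAt E p x))) x) +
      fderiv ℝ T (chartAt E p x) (coordAnchor 𝒜 p (chartAt E p x) (toF F p x (σ x))) := by
  obtain ⟨σ', hσ⟩ := hσ
  obtain ⟨τ, hτ⟩ := exists_section_secOf hx hT
  obtain ⟨τ₀, hτ₀⟩ := hasExtension_const hx (A := A) (T (chartAt E p x))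
  rw [𝒜.toLocal_bracket _ _ _ _ x hσ hτ, 𝒜.toLocal_bracket _ _ _ _ x hσ hτ₀,
    𝒜.toF_bracket_secOf_right hx σ' τ τ₀ hT hτ hτ₀, coordAnchor_apply 𝒜 hx, hσ.self_of_nhds]

/-- The bracket in coordinates is the bracket of constant sections corrected by the derivatives of
the coordinates along the anchor. -/
theorem toF_bracket_secOf {p : M} (hx : x ∈ chartDom (E := E) F A p) {S T : E → F}
    (hS : ∀ᶠ y in 𝓝 (chartAt E p x), ContDiffAt ℝ ∞ S y)
    (hT : ∀ᶠ y in 𝓝 (chartAt E p x), ContDiffAt ℝ ∞ T y) :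
    toF F p x (𝒜.toLocal.bracket (secOf F A p S) (secOf F A p T) x) =
      coordBracket 𝒜 p (chartAt E p x) (S (chartAt E p x)) (T (chartAt E p x))
        + fderiv ℝ T (chartAt E p x)
            (coordAnchor 𝒜 p (chartAt E p x) (S (chartAt E p x)))
        - fderiv ℝ S (chartAt E p x)
            (coordAnchor 𝒜 p (chartAt E p x) (T (chartAt E p x))) := by
  have h1 := hasExtension_secOf (A := A) hx hS
  have h2 := hasExtension_const (A := A) hx (T (chartAt E p x))
  have h3 := hasExtension_const (A := A) hx (S (chartAt E p x))
  rw [toF_bracket_right 𝒜 hx h1 hT, toLocal_bracket_skew h1 h2, map_neg,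
    toF_bracket_right 𝒜 hx h2 hS, coordBracket_apply 𝒜 hx, toLocal_bracket_skew h3 h2, map_neg,
    toF_secOf hx, toF_secOf hx]
  abel

/-- The bracket in coordinates, as a section. -/
theorem bracket_secOf_eventuallyEq {p : M} (hx : x ∈ chartDom (E := E) F A p) {S T : E → F}
    (hS : ∀ᶠ y in 𝓝 (chartAt E p x), ContDiffAt ℝ ∞ S y)
    (hT : ∀ᶠ y in 𝓝 (chartAt E p x), ContDiffAt ℝ ∞ T y) :
    ∀ᶠ z in 𝓝 x, secOf F A p (fun y ↦ coordBracket 𝒜 p y (S y) (T y)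
        + fderiv ℝ T y (coordAnchor 𝒜 p y (S y)) - fderiv ℝ S y (coordAnchor 𝒜 p y (T y))) z =
      𝒜.toLocal.bracket (secOf F A p S) (secOf F A p T) z := by
  filter_upwards [(isOpen_chartDom p).mem_nhds hx,
    eventually_nhds_chart hx.1 (eventually_eventually_nhds.2 hS),
    eventually_nhds_chart hx.1 (eventually_eventually_nhds.2 hT)] with z hz h1 h2
  apply toF_injective hz
  rw [toF_secOf hz, toF_bracket_secOf 𝒜 hz h1 h2]

theorem contDiffOn_coordBracket (p : M) :
    ContDiffOn ℝ ∞ (coordBracket 𝒜 p) (coordDom F A p) := by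
  rw [contDiffOn_clm_apply]
  intro a
  rw [contDiffOn_clm_apply]
  intro b y hy
  apply ContDiffAt.contDiffWithinAt
  have hx := symm_mem_chartDom hy
  have hy' : chartAt E p ((chartAt E p).symm y) = y := (chartAt E p).right_inv hy.1
  obtain ⟨σ, hσ⟩ := hasExtension_const (A := A) hx a
  obtain ⟨τ, hτ⟩ := hasExtension_const (A := A) hx b
  have h := (contMDiffAt_section_iff_coord hx).1 (𝒜.bracket σ τ).contMDiff.contMDiffAt
  rw [hy'] at h
  refine h.congr_of_eventuallyEq ?_
  have h2 := eventually_nhds_symm hx.1 (toLocal_bracket_eventuallyEq (𝒜 := 𝒜) hσ hτ)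
  rw [hy'] at h2
  filter_upwards [(isOpen_coordDom p).mem_nhds hy, h2] with z hz h3
  rw [coordBracket_symm_apply 𝒜 hz, ← h3]

end LocalForm

/-! ### The structure equations and symplectic forms in coordinates -/

section LocalAlgebra

variable {E : Type*} [NormedAddCommGroup E] [NormedSpace ℝ E] [FiniteDimensional ℝ E]
  {M : Type*} [TopologicalSpace M] [T2Space M] [ChartedSpace E M] [IsManifold 𝓘(ℝ, E) ∞ M]
  {F : Type*} [NormedAddCommGroup F] [NormedSpace ℝ F] [FiniteDimensional ℝ F]
  {A : M → Type*} [TopologicalSpace (TotalSpace F A)] [∀ x, TopologicalSpace (A x)]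
  [∀ x, AddCommGroup (A x)] [∀ x, Module ℝ (A x)]
  [FiberBundle F A] [VectorBundle ℝ F A] [ContMDiffVectorBundle ∞ F A 𝓘(ℝ, E)]
  (𝒜 : LieAlgebroid 𝓘(ℝ, E) F A)

theorem coordBracket_skew {p : M} {y : E} (hy : y ∈ coordDom F A p) (a b : F) :
    coordBracket 𝒜 p y a b = - coordBracket 𝒜 p y b a := by
  have h := symm_mem_chartDom hy
  rw [coordBracket_symm_apply 𝒜 hy, coordBracket_symm_apply 𝒜 hy,
    toLocal_bracket_skew (hasExtension_const h _) (hasExtension_const h _), map_neg]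

/-- The bracket of the sections with coordinates `S` and `T`. -/
def coordSectionBracket (p : M) (S T : E → F) (y : E) : F :=
  coordBracket 𝒜 p y (S y) (T y) + fderiv ℝ T y (coordAnchor 𝒜 p y (S y))
    - fderiv ℝ S y (coordAnchor 𝒜 p y (T y))

theorem contDiffAt_coordSectionBracket {p : M} {y : E} (hy : y ∈ coordDom F A p) {S T : E → F}
    (hS : ContDiffAt ℝ ∞ S y) (hT : ContDiffAt ℝ ∞ T y) :
    ContDiffAt ℝ ∞ (coordSectionBracket 𝒜 p S T) y := by
  have hΩ := (isOpen_coordDom (F := F) (A := A) p).mem_nhds hy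
  have hc := (contDiffOn_coordBracket 𝒜 p).contDiffAt hΩ
  have hρ := (contDiffOn_coordAnchor 𝒜 p).contDiffAt hΩ
  exact (((hc.clm_apply hS).clm_apply hT).add
    ((hT.fderiv_right (m := ∞) (by simp)).clm_apply (hρ.clm_apply hS))).sub
    ((hS.fderiv_right (m := ∞) (by simp)).clm_apply (hρ.clm_apply hT))

/-- The Jacobi identity for sections with arbitrary smooth coordinates. -/
theorem coordSectionBracket_jacobi {p : M} {y : E} (hy : y ∈ coordDom F A p) {S T R : E → F}
    (hS : ContDiff ℝ ∞ S) (hT : ContDiff ℝ ∞ T) (hR : ContDiff ℝ ∞ R) :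
    coordSectionBracket 𝒜 p S (coordSectionBracket 𝒜 p T R) y =
      coordSectionBracket 𝒜 p (coordSectionBracket 𝒜 p S T) R y +
        coordSectionBracket 𝒜 p T (coordSectionBracket 𝒜 p S R) y := by
  have h := symm_mem_chartDom hy
  have hy' : chartAt E p ((chartAt E p).symm y) = y := (chartAt E p).right_inv hy.1
  set x := (chartAt E p).symm y
  have ev : ∀ {S : E → F}, ContDiff ℝ ∞ S → ∀ᶠ y in 𝓝 (chartAt E p x), ContDiffAt ℝ ∞ S y :=
    fun hS ↦ Eventually.of_forall fun _ ↦ hS.contDiffAt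
  have ev2 : ∀ {S T : E → F}, ContDiff ℝ ∞ S → ContDiff ℝ ∞ T →
      ∀ᶠ y in 𝓝 (chartAt E p x), ContDiffAt ℝ ∞ (coordSectionBracket 𝒜 p S T) y := by
    intro S T hS hT
    rw [hy']
    filter_upwards [(isOpen_coordDom (F := F) (A := A) p).mem_nhds hy] with z hz
    exact contDiffAt_coordSectionBracket 𝒜 hz hS.contDiffAt hT.contDiffAt
  have ex : ∀ {S : E → F}, ContDiff ℝ ∞ S → HasExtension (E := E) F (secOf F A p S) x :=
    fun hS ↦ hasExtension_secOf h (ev hS)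
  have key : ∀ {S T R : E → F}, ContDiff ℝ ∞ S → ContDiff ℝ ∞ T → ContDiff ℝ ∞ R →
      toF F p x (𝒜.toLocal.bracket (secOf F A p S)
        (𝒜.toLocal.bracket (secOf F A p T) (secOf F A p R)) x) =
      coordSectionBracket 𝒜 p S (coordSectionBracket 𝒜 p T R) y := by
    intro S T R hS hT hR
    have e := bracket_secOf_eventuallyEq 𝒜 h (ev hT) (ev hR)
    rw [toLocal_bracket_congr (ex hS) (hasExtension_secOf h (ev2 hT hR))
      (Eventually.of_forall fun _ ↦ rfl) (e.mono fun z hz ↦ hz.symm),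
      toF_bracket_secOf 𝒜 h (ev hS) (ev2 hT hR), hy']
    rfl
  have key' : toF F p x (𝒜.toLocal.bracket
        (𝒜.toLocal.bracket (secOf F A p S) (secOf F A p T)) (secOf F A p R) x) =
      coordSectionBracket 𝒜 p (coordSectionBracket 𝒜 p S T) R y := by
    have e := bracket_secOf_eventuallyEq 𝒜 h (ev hS) (ev hT)
    rw [toLocal_bracket_congr (hasExtension_secOf h (ev2 hS hT)) (ex hR)
      (e.mono fun z hz ↦ hz.symm) (Eventually.of_forall fun _ ↦ rfl),
      toF_bracket_secOf 𝒜 h (ev2 hS hT) (ev hR), hy']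
    rfl
  rw [← key hS hT hR, ← key hT hS hR, ← key', ← map_add,
    toLocal_jacobi (ex hS) (ex hT) (ex hR)]

theorem coordSectionBracket_const (p : M) (a b : F) :
    coordSectionBracket 𝒜 p (fun _ : E ↦ a) (fun _ ↦ b) = fun y ↦ coordBracket 𝒜 p y a b := by
  funext y
  simp [coordSectionBracket]

theorem hasFDerivAt_coordBracket_apply {p : M} {y : E} (hy : y ∈ coordDom F A p) (a b : F) :
    HasFDerivAt (fun y ↦ coordBracket 𝒜 p y a b)
      (((ContinuousLinearMap.apply ℝ F b).comp
        (ContinuousLinearMap.apply ℝ (F →L[ℝ] F) a)).comp (fderiv ℝ (coordBracket 𝒜 p) y)) y := by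
  have hΩ := (isOpen_coordDom (F := F) (A := A) p).mem_nhds hy
  have hc := (((contDiffOn_coordBracket 𝒜 p).contDiffAt hΩ).differentiableAt
    (by simp)).hasFDerivAt
  exact (((ContinuousLinearMap.apply ℝ F b).comp
    (ContinuousLinearMap.apply ℝ (F →L[ℝ] F) a)).hasFDerivAt (x := coordBracket 𝒜 p y)).comp y hc

/-- The anchor preserves brackets. This is not part of the definition but follows from the Leibniz
rule and the Jacobi identity. -/
theorem coordBracket_anchor {p : M} {y : E} (hy : y ∈ coordDom F A p) (a b : F) :
    coordAnchor 𝒜 p y (coordBracket 𝒜 p y a b) =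
      fderiv ℝ (coordAnchor 𝒜 p) y (coordAnchor 𝒜 p y a) b
        - fderiv ℝ (coordAnchor 𝒜 p) y (coordAnchor 𝒜 p y b) a := by
  -- compare the Jacobi identities for `a`, `b`, `g • d` and for `a`, `b`, `d`, with `g` a linear
  -- function on `E` and `d` a nonzero vector; if `F = 0` there is nothing to prove
  rcases subsingleton_or_nontrivial F with hF | hF
  · rw [Subsingleton.elim a 0, Subsingleton.elim b 0]; simp
  obtain ⟨d, hd⟩ := exists_ne (0 : F)
  refine (SeparatingDual.eq_iff_forall_dual_eq (R := ℝ) (V := E)).2 fun g ↦ ?_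
  have hΩ := (isOpen_coordDom (F := F) (A := A) p).mem_nhds hy
  have hρ := (((contDiffOn_coordAnchor 𝒜 p).contDiffAt hΩ).differentiableAt
    (by simp)).hasFDerivAt
  let R : E → F := fun z ↦ g z • d
  have hR : ContDiff ℝ ∞ R := g.contDiff.smul contDiff_const
  have hRd : ∀ z, HasFDerivAt R (g.smulRight d) z := fun z ↦ (g.smulRight d).hasFDerivAt
  have hca := fun a b ↦ hasFDerivAt_coordBracket_apply 𝒜 hy a b
  have hbr : ∀ b : F, coordSectionBracket 𝒜 p (fun _ ↦ b) R =
      fun z ↦ g z • coordBracket 𝒜 p z b d + g (coordAnchor 𝒜 p z b) • d := by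
    intro b
    funext z
    simp [coordSectionBracket, (hRd z).fderiv, R]
  have hbr' : ∀ b : F, HasFDerivAt (coordSectionBracket 𝒜 p (fun _ ↦ b) R)
      (g y • (((ContinuousLinearMap.apply ℝ F d).comp
        (ContinuousLinearMap.apply ℝ (F →L[ℝ] F) b)).comp (fderiv ℝ (coordBracket 𝒜 p) y))
        + g.smulRight (coordBracket 𝒜 p y b d)
        + (g.comp ((ContinuousLinearMap.apply ℝ E b).comp
            (fderiv ℝ (coordAnchor 𝒜 p) y))).smulRight d) y := by
    intro b
    rw [hbr]
    refine (g.hasFDerivAt.smul (hca b d)).add ?_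
    have h1 : HasFDerivAt (fun z ↦ g (coordAnchor 𝒜 p z b)) (g.comp
        ((ContinuousLinearMap.apply ℝ E b).comp (fderiv ℝ (coordAnchor 𝒜 p) y))) y :=
      (g.comp (ContinuousLinearMap.apply ℝ E b)).hasFDerivAt.comp y hρ
    exact h1.smul_const d
  have hJ := coordSectionBracket_jacobi 𝒜 hy (contDiff_const (c := a)) (contDiff_const (c := b)) hR
  have hJ' := coordSectionBracket_jacobi 𝒜 hy (contDiff_const (c := a)) (contDiff_const (c := b))
    (contDiff_const (c := d))
  rw [coordSectionBracket_const, coordSectionBracket_const, coordSectionBracket_const] at hJ'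
  rw [coordSectionBracket_const] at hJ
  have hv : ∀ b, coordSectionBracket 𝒜 p (fun _ ↦ b) R y =
    g y • coordBracket 𝒜 p y b d + g (coordAnchor 𝒜 p y b) • d := fun b ↦ by rw [hbr]
  have h0 : ∀ (b : F) (T : E → F), coordSectionBracket 𝒜 p (fun _ ↦ b) T y =
      coordBracket 𝒜 p y b (T y) + fderiv ℝ T y (coordAnchor 𝒜 p y b) := by
    intro b T
    simp [coordSectionBracket]
  have h1 : ∀ T : E → F, coordSectionBracket 𝒜 p (fun y ↦ coordBracket 𝒜 p y a b) T y =
      coordBracket 𝒜 p y (coordBracket 𝒜 p y a b) (T y)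
        + fderiv ℝ T y (coordAnchor 𝒜 p y (coordBracket 𝒜 p y a b))
        - fderiv ℝ (coordBracket 𝒜 p) y (coordAnchor 𝒜 p y (T y)) a b := by
    intro T
    rw [coordSectionBracket, (hca a b).fderiv]
    rfl
  rw [h0, h0, h1, (hca b d).fderiv, (hca a d).fderiv] at hJ'
  rw [h0 a (coordSectionBracket _ _ _ _), h0 b (coordSectionBracket _ _ _ _), h1, hv, hv,
    (hbr' a).fderiv, (hbr' b).fderiv, (hRd y).fderiv] at hJ
  simp only [R, map_add, map_smul, add_apply, smul_apply,
    ContinuousLinearMap.comp_apply, ContinuousLinearMap.apply_apply, fderiv_fun_const,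
    Pi.zero_apply, zero_apply, add_zero,
    ContinuousLinearMap.smulRight_apply] at hJ hJ'
  have : (g (coordAnchor 𝒜 p y (coordBracket 𝒜 p y a b)) -
      g (fderiv ℝ (coordAnchor 𝒜 p) y (coordAnchor 𝒜 p y a) b
        - fderiv ℝ (coordAnchor 𝒜 p) y (coordAnchor 𝒜 p y b) a)) • d = 0 := by
    rw [map_sub]
    linear_combination (norm := module) (g y) • hJ' - hJ
  exact sub_eq_zero.1 ((smul_eq_zero.1 this).resolve_right hd)

/-- In coordinates, a Lie algebroid satisfies the structure equations. -/
theorem locAlg (p : M) : LocAlg (coordDom F A p) (coordAnchor 𝒜 p) (coordBracket 𝒜 p) where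
  isOpen := isOpen_coordDom p
  smooth_anchor := contDiffOn_coordAnchor 𝒜 p
  smooth_bracket := contDiffOn_coordBracket 𝒜 p
  skew _ hx a b := coordBracket_skew 𝒜 hx a b
  anchor _ hx a b := coordBracket_anchor 𝒜 hx a b
  jacobi y hy a b d := by
    have hJ := coordSectionBracket_jacobi 𝒜 hy (contDiff_const (c := a)) (contDiff_const (c := b))
      (contDiff_const (c := d))
    rw [coordSectionBracket_const, coordSectionBracket_const, coordSectionBracket_const] at hJ
    have hca := fun a b ↦ (hasFDerivAt_coordBracket_apply 𝒜 hy a b).fderiv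
    simp only [coordSectionBracket, hca, fderiv_fun_const, Pi.zero_apply,
      zero_apply, ContinuousLinearMap.comp_apply,
      ContinuousLinearMap.apply_apply, add_zero, sub_zero] at hJ
    have hsk : ∀ u, fderiv ℝ (coordBracket 𝒜 p) y u d a =
        - fderiv ℝ (coordBracket 𝒜 p) y u a d := by
      intro u
      have e : (fun z ↦ coordBracket 𝒜 p z d a) =ᶠ[𝓝 y] fun z ↦ - coordBracket 𝒜 p z a d := by
        filter_upwards [(isOpen_coordDom (F := F) (A := A) p).mem_nhds hy] with z hz
        exact coordBracket_skew 𝒜 hz d a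
      have h1 := e.fderiv_eq (𝕜 := ℝ)
      rw [hca, fderiv_fun_neg, hca] at h1
      exact congrArg (fun L ↦ L u) h1
    rw [hsk, coordBracket_skew 𝒜 hy d a, map_neg, coordBracket_skew 𝒜 hy d (_ : F)]
    linear_combination (norm := module) hJ

end LocalAlgebra

section Forms

variable {E : Type*} [NormedAddCommGroup E] [NormedSpace ℝ E] [FiniteDimensional ℝ E]
  {M : Type*} [TopologicalSpace M] [T2Space M] [ChartedSpace E M] [IsManifold 𝓘(ℝ, E) ∞ M]
  {F : Type*} [NormedAddCommGroup F] [NormedSpace ℝ F] [FiniteDimensional ℝ F]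
  {A : M → Type*} [TopologicalSpace (TotalSpace F A)] [∀ x, TopologicalSpace (A x)]
  [∀ x, AddCommGroup (A x)] [∀ x, Module ℝ (A x)]
  [∀ x, ContinuousAdd (A x)] [∀ x, ContinuousSMul ℝ (A x)]
  [FiberBundle F A] [VectorBundle ℝ F A] [ContMDiffVectorBundle ∞ F A 𝓘(ℝ, E)]
  {𝒜 : LieAlgebroid 𝓘(ℝ, E) F A} (ω₀ : SymplecticForm 𝒜)

/-- A two-form on `A` in the coordinates at `p`. -/
def coordForm (p : M) (y : E) : F →L[ℝ] F →L[ℝ] ℝ :=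
  LinearMap.toContinuousBilinearMap <| LinearMap.mk₂ ℝ
    (fun a b ↦ ω₀.form ((chartAt E p).symm y) (ofF F p ((chartAt E p).symm y) a)
      (ofF F p ((chartAt E p).symm y) b))
    (by intros; rw [map_add, map_add]; rfl) (by intros; rw [map_smul, map_smul]; rfl)
    (by intros; rw [map_add, map_add]) (by intros; rw [map_smul, map_smul])

theorem coordForm_symm_apply (p : M) (y : E) (a b : F) :
    coordForm ω₀ p y a b = ω₀.form ((chartAt E p).symm y) (ofF F p ((chartAt E p).symm y) a)
      (ofF F p ((chartAt E p).symm y) b) := rfl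

theorem coordForm_apply {p x : M} (hx : x ∈ chartDom (E := E) F A p) (a b : A x) :
    coordForm ω₀ p (chartAt E p x) (toF F p x a) (toF F p x b) = ω₀.form x a b := by
  rw [coordForm_symm_apply, (chartAt E p).left_inv hx.1, ofF_toF hx, ofF_toF hx]

theorem form_skew (x : M) (a b : A x) : ω₀.form x a b = - ω₀.form x b a := by
  have := ω₀.alternating x (a + b)
  simp only [map_add, add_apply, ω₀.alternating, zero_add, add_zero] at this
  linarith

theorem coordForm_skew (p : M) (y : E) (a b : F) :
    coordForm ω₀ p y a b = - coordForm ω₀ p y b a := form_skew ω₀ _ _ _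

theorem contDiffOn_coordForm (p : M) : ContDiffOn ℝ ∞ (coordForm ω₀ p) (coordDom F A p) := by
  rw [contDiffOn_clm_apply]
  intro a
  rw [contDiffOn_clm_apply]
  intro b y hy
  apply ContDiffAt.contDiffWithinAt
  have hx := symm_mem_chartDom hy
  have h := ContMDiffAt.clm_bundle_apply₂ (ω₀.smooth.contMDiffAt)
    (contMDiffAt_secOf hx (S := fun _ : E ↦ a) contDiffAt_const)
    (contMDiffAt_secOf hx (S := fun _ : E ↦ b) contDiffAt_const)
  have h2 : ContMDiffAt 𝓘(ℝ, E) 𝓘(ℝ, ℝ) ∞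
      (fun z ↦ ω₀.form z (secOf F A p (fun _ : E ↦ a) z) (secOf F A p (fun _ : E ↦ b) z))
      ((chartAt E p).symm y) := (contMDiffAt_totalSpace.1 h).2
  rw [contMDiffAt_iff_chart hx.1, (chartAt E p).right_inv hy.1] at h2
  exact h2

theorem coordForm_nondegenerate {p : M} {y : E} (hy : y ∈ coordDom F A p) {a : F}
    (h : ∀ b, coordForm ω₀ p y a b = 0) : a = 0 := by
  have hx := symm_mem_chartDom hy
  have := ω₀.nondegenerate _ (ofF F p ((chartAt E p).symm y) a) (fun b ↦ by
    rw [← ofF_toF hx b]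
    exact h _)
  rw [← toF_ofF hx a, this, map_zero]

/-- In finite dimensions nondegeneracy means that the form is an isomorphism from `F` to its dual.
-/
theorem coordForm_mem_range {p : M} {y : E} (hy : y ∈ coordDom F A p) :
    coordForm ω₀ p y ∈ range ((↑) : (F ≃L[ℝ] F →L[ℝ] ℝ) → F →L[ℝ] F →L[ℝ] ℝ) := by
  have hinj : Function.Injective (coordForm ω₀ p y).toLinearMap := by
    rw [← LinearMap.ker_eq_bot, LinearMap.ker_eq_bot']
    exact fun a h ↦ coordForm_nondegenerate ω₀ hy fun b ↦ congrArg (fun L ↦ L b) h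
  have hd : Module.finrank ℝ F = Module.finrank ℝ (F →L[ℝ] ℝ) := by
    rw [← (LinearMap.toContinuousLinearMap (𝕜 := ℝ) (E := F) (F' := ℝ)).finrank_eq,
      Subspace.dual_finrank_eq]
  refine ⟨(LinearEquiv.ofInjectiveOfFinrankEq _ hinj hd).toContinuousLinearEquiv, ?_⟩
  ext a b
  rfl

/-- A symplectic form is closed in coordinates: evaluate its differential on global sections that
are constant in coordinates near the given point. -/
theorem locClosed_coordForm {p : M} {y : E} (hy : y ∈ coordDom F A p) :
    LocClosed (coordAnchor 𝒜 p) (coordBracket 𝒜 p) (coordForm ω₀ p) y := by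
  intro a b d
  have hx := symm_mem_chartDom hy
  have hy' : chartAt E p ((chartAt E p).symm y) = y := (chartAt E p).right_inv hy.1
  set x := (chartAt E p).symm y with hxy
  obtain ⟨σ₁, h₁⟩ := hasExtension_const (A := A) hx a
  obtain ⟨σ₂, h₂⟩ := hasExtension_const (A := A) hx b
  obtain ⟨σ₃, h₃⟩ := hasExtension_const (A := A) hx d
  have hd := ((contDiffOn_coordForm ω₀ p).contDiffAt
    ((isOpen_coordDom (F := F) (A := A) p).mem_nhds hy)).differentiableAt (by simp)
  have key : ∀ (σ τ υ : Cₛ^∞⟮𝓘(ℝ, E); F, A⟯) (a b d : F),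
      (∀ᶠ z in 𝓝 x, σ z = secOf F A p (fun _ : E ↦ a) z) →
      (∀ᶠ z in 𝓝 x, τ z = secOf F A p (fun _ : E ↦ b) z) →
      (∀ᶠ z in 𝓝 x, υ z = secOf F A p (fun _ : E ↦ d) z) →
      (show ℝ from mfderiv 𝓘(ℝ, E) 𝓘(ℝ) (fun y ↦ ω₀.form y (τ y) (υ y)) x (𝒜.anchor x (σ x))) =
        fderiv ℝ (coordForm ω₀ p) y (coordAnchor 𝒜 p y a) b d := by
    intro σ τ υ a b d hσ hτ hυ
    obtain ⟨hdf, hval⟩ := hasFDerivAt_apply₂ hd.hasFDerivAt (hasFDerivAt_const b y)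
      (hasFDerivAt_const d y)
    have e : (fun y ↦ ω₀.form y (τ y) (υ y)) =ᶠ[𝓝 x]
        fun z ↦ (fun y ↦ coordForm ω₀ p y b d) (chartAt E p z) := by
      filter_upwards [hτ, hυ, (isOpen_chartDom p).mem_nhds hx] with z h2 h3 hz
      rw [h2, h3, ← coordForm_apply ω₀ hz, toF_secOf hz, toF_secOf hz]
    rw [e.mfderiv_eq]
    have h4 := mfderiv_comp_chart (S := fun y ↦ coordForm ω₀ p y b d) hx.1
      (by rw [hy']; exact hdf) (𝒜.anchor x (σ x))
    refine h4.trans ?_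
    rw [hy', hval, hσ.self_of_nhds, zero_apply, map_zero, map_zero, zero_apply,
      add_zero, add_zero]
    change fderiv ℝ (coordForm ω₀ p) y (chartDeriv E p x (𝒜.anchor x _)) b d = _
    rw [← coordAnchor_apply 𝒜 hx, toF_secOf hx, hy']
  have key2 : ∀ (σ τ υ : Cₛ^∞⟮𝓘(ℝ, E); F, A⟯) (a b d : F),
      (∀ᶠ z in 𝓝 x, σ z = secOf F A p (fun _ : E ↦ a) z) →
      (∀ᶠ z in 𝓝 x, τ z = secOf F A p (fun _ : E ↦ b) z) →
      (∀ᶠ z in 𝓝 x, υ z = secOf F A p (fun _ : E ↦ d) z) →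
      ω₀.form x (𝒜.bracket σ τ x) (υ x) = coordForm ω₀ p y (coordBracket 𝒜 p y a b) d := by
    intro σ τ υ a b d hσ hτ hυ
    rw [← coordForm_apply ω₀ hx, ← 𝒜.toLocal_bracket _ _ _ _ x hσ hτ, hy',
      coordBracket_symm_apply 𝒜 hy, hυ.self_of_nhds, toF_secOf hx]
  have h := ω₀.closed σ₁ σ₂ σ₃ x
  rw [key _ _ _ _ _ _ h₁ h₂ h₃, key _ _ _ _ _ _ h₂ h₁ h₃, key _ _ _ _ _ _ h₃ h₁ h₂,
    key2 _ _ _ _ _ _ h₁ h₂ h₃, key2 _ _ _ _ _ _ h₁ h₃ h₂, key2 _ _ _ _ _ _ h₂ h₃ h₁] at h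
  exact h

end Forms

/-! ### Morphisms in coordinates -/

section ExternalProduct

variable {E : Type*} [NormedAddCommGroup E] [NormedSpace ℝ E]
  {H : Type*} [TopologicalSpace H] {I : ModelWithCorners ℝ E H}
  {M : Type*} [TopologicalSpace M] [ChartedSpace H M]
  {F : Type*} [NormedAddCommGroup F] [NormedSpace ℝ F]
  {A : M → Type*} [TopologicalSpace (TotalSpace F A)] [∀ x, TopologicalSpace (A x)]
  [∀ x, AddCommGroup (A x)] [∀ x, Module ℝ (A x)] [FiberBundle F A] [VectorBundle ℝ F A]
  {E' : Type*} [NormedAddCommGroup E'] [NormedSpace ℝ E']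
  {H' : Type*} [TopologicalSpace H'] {J : ModelWithCorners ℝ E' H'}
  {N : Type*} [TopologicalSpace N] [ChartedSpace H' N]
  {F' : Type*} [NormedAddCommGroup F'] [NormedSpace ℝ F']
  {B : N → Type*} [TopologicalSpace (TotalSpace F' B)] [∀ x, TopologicalSpace (B x)]
  [∀ x, AddCommGroup (B x)] [∀ x, Module ℝ (B x)] [FiberBundle F' B] [VectorBundle ℝ F' B]
  {E'' : Type*} [NormedAddCommGroup E''] [NormedSpace ℝ E'']
  {H'' : Type*} [TopologicalSpace H''] {K : ModelWithCorners ℝ E'' H''}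
  {X : Type*} [TopologicalSpace X] [ChartedSpace H'' X]

/-- A map into an external product bundle is smooth if and only if its two components are. -/
theorem contMDiffWithinAt_extProd_iff {g : X → M × N} {s : Π x, ExtProd A B (g x)} {S : Set X}
    {x₀ : X} :
    ContMDiffWithinAt K ((I.prod J).prod 𝓘(ℝ, F × F')) ∞
      (fun x ↦ TotalSpace.mk' (F × F') (g x) (s x)) S x₀ ↔
    ContMDiffWithinAt K (I.prod 𝓘(ℝ, F)) ∞
      (fun x ↦ TotalSpace.mk' F (E := A) (g x).1 (s x).1) S x₀ ∧
    ContMDiffWithinAt K (J.prod 𝓘(ℝ, F')) ∞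
      (fun x ↦ TotalSpace.mk' F' (E := B) (g x).2 (s x).2) S x₀ := by
  rw [contMDiffWithinAt_totalSpace, contMDiffWithinAt_totalSpace, contMDiffWithinAt_totalSpace,
    contMDiffWithinAt_prod_iff, contMDiffWithinAt_prod_module_iff]
  exact and_and_and_comm

theorem contMDiffAt_extProd_iff {g : X → M × N} {s : Π x, ExtProd A B (g x)} {x₀ : X} :
    ContMDiffAt K ((I.prod J).prod 𝓘(ℝ, F × F')) ∞
      (fun x ↦ TotalSpace.mk' (F × F') (g x) (s x)) x₀ ↔
    ContMDiffAt K (I.prod 𝓘(ℝ, F)) ∞ (fun x ↦ TotalSpace.mk' F (E := A) (g x).1 (s x).1) x₀ ∧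
    ContMDiffAt K (J.prod 𝓘(ℝ, F')) ∞ (fun x ↦ TotalSpace.mk' F' (E := B) (g x).2 (s x).2) x₀ :=
  contMDiffWithinAt_extProd_iff

theorem fibreDeriv_const (y : N) (b : B y) (x : M) (v : TangentSpace I x) :
    fibreDeriv I F' B y (fun _ ↦ b) x v = 0 := by
  unfold fibreDeriv
  simp only [mfderiv_const]
  exact map_zero _

end ExternalProduct

section Opens

variable {E : Type*} [NormedAddCommGroup E] [NormedSpace ℝ E]
  {H : Type*} [TopologicalSpace H] {I : ModelWithCorners ℝ E H}
  {M : Type*} [TopologicalSpace M] [ChartedSpace H M]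

/-- The tangent spaces of an open subset are those of the manifold. -/
theorem mfderiv_opens_val_bijective (W : TopologicalSpace.Opens M) (x : W) :
    Function.Bijective (mfderiv I I (Subtype.val : W → M) x) := by
  classical
  -- a local inverse of the inclusion, continued by a constant
  let s : M → W := fun z ↦ if h : z ∈ W then ⟨z, h⟩ else x
  have hs : ∀ z : W, s z = z := fun z ↦ dif_pos z.2
  have hs' : Subtype.val ∘ s =ᶠ[𝓝 (x : M)] id := by
    filter_upwards [W.isOpen.mem_nhds x.2] with z hz
    change ((s z : W) : M) = z
    rw [show s z = ⟨z, hz⟩ from dif_pos hz]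
  have h1 : MDifferentiableAt I I (Subtype.val : W → M) x :=
    (contMDiff_subtype_val (n := 1)).contMDiffAt.mdifferentiableAt (by simp)
  have h2 : MDifferentiableAt I I s x := by
    refine ContMDiffAt.mdifferentiableAt (n := ∞) ?_ (by simp)
    rw [← ContMDiffAt.subtypeVal_comp_iff]
    exact contMDiffAt_id.congr_of_eventuallyEq hs'
  constructor
  · have h := mfderiv_comp x (f := (Subtype.val : W → M)) (g := s) (I' := I) h2 h1
    rw [show s ∘ (Subtype.val : W → M) = id from funext hs, mfderiv_id] at h
    intro v w hvw
    have := fun v ↦ congrArg (fun L ↦ L v) h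
    have hv : v = mfderiv I I s x (mfderiv I I (Subtype.val : W → M) x v) := this v
    have hw : w = mfderiv I I s x (mfderiv I I (Subtype.val : W → M) x w) := this w
    rw [hv, hw, hvw]
  · have h1' : MDifferentiableAt I I (Subtype.val : W → M) (s x) := by rwa [hs]
    have h := mfderiv_comp (x : M) (f := s) (g := (Subtype.val : W → M)) (I' := I) h1' h2
    rw [hs'.mfderiv_eq, mfderiv_id] at h
    intro v
    have := congrArg (fun L ↦ L v) h
    refine ⟨mfderiv I I s x v, ?_⟩
    rw [hs] at this
    exact this.symm

end Opens

section FibreDerivative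

variable {E : Type*} [NormedAddCommGroup E] [NormedSpace ℝ E]
  {M : Type*} [TopologicalSpace M] [ChartedSpace E M] [IsManifold 𝓘(ℝ, E) ∞ M]
  {F : Type*} [NormedAddCommGroup F] [NormedSpace ℝ F]
  {A : M → Type*} [TopologicalSpace (TotalSpace F A)] [∀ x, TopologicalSpace (A x)]
  [∀ x, AddCommGroup (A x)] [∀ x, Module ℝ (A x)] [FiberBundle F A] [VectorBundle ℝ F A]
  {E' : Type*} [NormedAddCommGroup E'] [NormedSpace ℝ E']
  {H' : Type*} [TopologicalSpace H'] {J : ModelWithCorners ℝ E' H'}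
  {N : Type*} [TopologicalSpace N] [ChartedSpace H' N]

/-- The derivative of a map into a fibre may be computed in any trivialization. -/
theorem toF_fibreDeriv {p y : M} (hy : y ∈ chartDom (E := E) F A p) {f : N → A y} {x : N}
    (hf : MDifferentiableAt J 𝓘(ℝ, F) (fun z ↦ toF F p y (f z)) x) (v : TangentSpace J x) :
    toF F p y (fibreDeriv J F A y f x v) =
      mfderiv J 𝓘(ℝ, F) (fun z ↦ toF F p y (f z)) x v := by
  let e : A y ≃L[ℝ] F := (trivializationAt F A y).continuousLinearEquivAt ℝ y
    (mem_baseSet_trivializationAt F A y)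
  let L : F →L[ℝ] F := (e : A y →L[ℝ] F).comp (ofF F p y)
  have h1 : (fun z ↦ e (f z)) = L ∘ fun z ↦ toF F p y (f z) := by
    funext z
    change _ = e (ofF F p y (toF F p y (f z)))
    rw [ofF_toF hy]
  have h2 : mfderiv J 𝓘(ℝ, F) (fun z ↦ e (f z)) x v =
      L (mfderiv J 𝓘(ℝ, F) (fun z ↦ toF F p y (f z)) x v) := by
    rw [h1]
    have := mfderiv_comp_apply (I := J) (I' := 𝓘(ℝ, F)) (I'' := 𝓘(ℝ, F)) x
      (g := L) (L.differentiableAt (x := toF F p y (f x))).mdifferentiableAt hf v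
    rw [mfderiv_eq_fderiv, L.fderiv] at this
    exact this
  change toF F p y (e.symm (mfderiv J 𝓘(ℝ, F) (fun z ↦ e (f z)) x v)) = _
  rw [h2]
  change toF F p y (e.symm (e (ofF F p y _))) = _
  rw [e.symm_apply_apply]
  exact toF_ofF hy _

end FibreDerivative

section Extraction

variable {E : Type*} [NormedAddCommGroup E] [NormedSpace ℝ E] [FiniteDimensional ℝ E]
  {M : Type*} [TopologicalSpace M] [T2Space M] [ChartedSpace E M] [IsManifold 𝓘(ℝ, E) ∞ M]
  {F : Type*} [NormedAddCommGroup F] [NormedSpace ℝ F] [FiniteDimensional ℝ F]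
  {A : M → Type*} [TopologicalSpace (TotalSpace F A)] [∀ x, TopologicalSpace (A x)]
  [∀ x, AddCommGroup (A x)] [∀ x, Module ℝ (A x)]
  [FiberBundle F A] [VectorBundle ℝ F A] [ContMDiffVectorBundle ∞ F A 𝓘(ℝ, E)]
  {𝒜 : LieAlgebroid 𝓘(ℝ, E) F A}
  {E' : Type*} [NormedAddCommGroup E'] [NormedSpace ℝ E']
  {H' : Type*} [TopologicalSpace H'] {K : ModelWithCorners ℝ E' H'}
  {X : Type*} [TopologicalSpace X] [T2Space X] [ChartedSpace H' X]
  {F' : Type*} [NormedAddCommGroup F'] [NormedSpace ℝ F']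
  {S : X → Type*} [TopologicalSpace (TotalSpace F' S)] [∀ x, TopologicalSpace (S x)]
  [∀ x, AddCommGroup (S x)] [∀ x, Module ℝ (S x)]
  [FiberBundle F' S] [VectorBundle ℝ F' S]
  {𝒮 : LocalBracket K S} {W : TopologicalSpace.Opens X} {W' : TopologicalSpace.Opens M}
  {φ : BundleMap S A}

/-- The image under a morphism of a smooth section is smooth. -/
theorem IsLieMorphism.contMDiffAt_apply (h : IsLieMorphism F' F 𝒮 𝒜.toLocal W W' φ) {x : X}
    (hx : x ∈ W) {σ : Π x, S x} (hσ : ContMDiffAt K (K.prod 𝓘(ℝ, F')) ∞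
      (fun x ↦ TotalSpace.mk' F' x (σ x)) x) :
    ContMDiffAt K (𝓘(ℝ, E).prod 𝓘(ℝ, F)) ∞
      (fun x ↦ TotalSpace.mk' F (E := A) (φ.base x) (φ.fibre x (σ x))) x := by
  have hW : IsOpen {z : TotalSpace F' S | z.1 ∈ W} :=
    W.isOpen.preimage (FiberBundle.continuous_proj F' S)
  have h1 : ContMDiffAt (K.prod 𝓘(ℝ, F')) (𝓘(ℝ, E).prod 𝓘(ℝ, F)) ∞ (φ.toTotal F' F)
      (TotalSpace.mk' F' x (σ x)) := h.smooth.contMDiffAt (hW.mem_nhds hx)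
  exact ContMDiffAt.comp x h1 hσ

theorem IsLieMorphism.contMDiffAt_toF_apply (h : IsLieMorphism F' F 𝒮 𝒜.toLocal W W' φ) {x : X}
    (hx : x ∈ W) {q : M} (hq : φ.base x ∈ chartDom (E := E) F A q) {σ : Π x, S x}
    (hσ : ContMDiffAt K (K.prod 𝓘(ℝ, F')) ∞ (fun x ↦ TotalSpace.mk' F' x (σ x)) x) :
    ContMDiffAt K 𝓘(ℝ, F) ∞ (fun z ↦ toF F q (φ.base z) (φ.fibre z (σ z))) x := by
  obtain ⟨h1, h2⟩ := ((trivializationAt F A q).contMDiffAt_iff (by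
    rw [Trivialization.mem_source]; exact hq.2)).1 (h.contMDiffAt_apply hx hσ)
  refine h2.congr_of_eventuallyEq ?_
  filter_upwards [h1.continuousAt.preimage_mem_nhds ((isOpen_chartDom q).mem_nhds hq)] with z hz
  rw [toF_eq_trivializationAt hz]

theorem IsLieMorphism.contMDiffAt_base (h : IsLieMorphism F' F 𝒮 𝒜.toLocal W W' φ) {x : X}
    (hx : x ∈ W) : ContMDiffAt K 𝓘(ℝ, E) ∞ φ.base x := by
  have h0 : ContMDiffAt K (K.prod 𝓘(ℝ, F')) ∞
      (fun x ↦ TotalSpace.mk' F' x (0 : S x)) x := contMDiffAt_zeroSection ℝ S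
  exact (contMDiffAt_totalSpace.1 (h.contMDiffAt_apply hx h0)).1

/-- A morphism is compatible with the anchors, because the anchor of the product maps the graph of
`φ` to the tangent spaces of the graph of the base map. -/
theorem IsLieMorphism.mfderiv_base_anchor (h : IsLieMorphism F' F 𝒮 𝒜.toLocal W W' φ) {x : X}
    (hx : x ∈ W) (a : S x) : mfderiv K 𝓘(ℝ, E) φ.base x (𝒮.anchor x a) =
      𝒜.anchor (φ.base x) (φ.fibre x a) := by
  obtain ⟨v, hv⟩ := h.graph.anchor_mem ⟨x, hx⟩ (show ExtProd S A (x, φ.base x) from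
    (a, φ.fibre x a)) (by
      change φ.fibre x a = φ.fibre x a
      rfl)
  have h1 : MDifferentiableAt K K (Subtype.val : W → X) ⟨x, hx⟩ :=
    (contMDiff_subtype_val (n := 1)).contMDiffAt.mdifferentiableAt (by simp)
  have h2 : MDifferentiableAt K 𝓘(ℝ, E) φ.base x :=
    (h.contMDiffAt_base hx).mdifferentiableAt (by simp)
  have h3 : MDifferentiableAt K 𝓘(ℝ, E) (fun z : W ↦ φ.base z) ⟨x, hx⟩ :=
    MDifferentiableAt.comp (g := φ.base) (f := (Subtype.val : W → X)) (I' := K) ⟨x, hx⟩ h2 h1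
  rw [mfderiv_prodMk h1 h3] at hv
  have hv1 : mfderiv K K (Subtype.val : W → X) ⟨x, hx⟩ v = 𝒮.anchor x a := congrArg Prod.fst hv
  have hv2 : mfderiv K 𝓘(ℝ, E) (fun z : W ↦ φ.base z) ⟨x, hx⟩ v =
    𝒜.anchor (φ.base x) (φ.fibre x a) := congrArg Prod.snd hv
  have h4 : mfderiv K 𝓘(ℝ, E) (fun z : W ↦ φ.base z) ⟨x, hx⟩ v =
      mfderiv K 𝓘(ℝ, E) φ.base x (mfderiv K K (Subtype.val : W → X) ⟨x, hx⟩ v) :=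
    mfderiv_comp_apply (g := φ.base) (f := (Subtype.val : W → X)) (I' := K) ⟨x, hx⟩ h2 h1 v
  rw [← hv2, h4, hv1]

/-- The graph of a continuous map is a closed embedded submanifold of each product of open sets
whose first factor is mapped into the second one. -/
theorem isAdapted_graph (h : IsLieMorphism F' F 𝒮 𝒜.toLocal W W' φ) {V : Set X} {V' : Set M}
    (hV : IsOpen V) (hVW : V ⊆ W) (hV' : IsOpen V') (hVV' : MapsTo φ.base V V') :
    IsAdapted (fun x : W ↦ ((x : X), φ.base x)) (V ×ˢ V') (Subtype.val ⁻¹' V) := by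
  refine ⟨hV.prod hV', hV.preimage continuous_subtype_val, fun x hx ↦ ⟨hx, hVV' hx⟩, ?_⟩
  refine Function.LeftInverse.isClosedEmbedding
    (f := fun q : V ×ˢ V' ↦ (⟨⟨q.1.1, hVW q.2.1⟩, q.2.1⟩ : (Subtype.val ⁻¹' V : Set W)))
    (fun x ↦ rfl) (by fun_prop) ?_
  refine Continuous.subtype_mk ?_ _
  have hc : Continuous fun x : W ↦ φ.base x := continuous_iff_continuousAt.2 fun x ↦
    (h.contMDiffAt_base x.2).continuousAt.comp continuous_subtype_val.continuousAt
  exact (continuous_subtype_val.prodMk hc).comp continuous_subtype_val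

/-- The compatibility of a morphism with the brackets, in coordinates of the target. It is the
closure under brackets of the graph of `φ`, applied to the sections `(σ, φ(σ))` and `(τ, φ(τ))`,
extended off the graph of the base map such that the second entries have coordinates that depend
only on the first variable. -/
theorem IsLieMorphism.toF_bracket (h : IsLieMorphism F' F 𝒮 𝒜.toLocal W W' φ) {x : X}
    (hx : x ∈ W) {q : M} (hq : φ.base x ∈ chartDom (E := E) F A q) {V : Set X} (hV : IsOpen V)
    (hxV : x ∈ V) {σ τ : Π x, S x} (hσ : SmoothSectionOn K F' S V σ)
    (hτ : SmoothSectionOn K F' S V τ) :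
    toF F q (φ.base x) (φ.fibre x (𝒮.bracket σ τ x)) =
      coordBracket 𝒜 q (chartAt E q (φ.base x)) (toF F q (φ.base x) (φ.fibre x (σ x)))
        (toF F q (φ.base x) (φ.fibre x (τ x)))
      + (show F from mfderiv K 𝓘(ℝ, F) (fun z ↦ toF F q (φ.base z) (φ.fibre z (τ z))) x
          (𝒮.anchor x (σ x)))
      - (show F from mfderiv K 𝓘(ℝ, F) (fun z ↦ toF F q (φ.base z) (φ.fibre z (σ z))) x
          (𝒮.anchor x (τ x))) := by
  let V₁ : Set X := V ∩ (W ∩ φ.base ⁻¹' chartDom (E := E) F A q)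
  have hcont : ContinuousOn φ.base W := fun z hz ↦
    (h.contMDiffAt_base hz).continuousAt.continuousWithinAt
  have hV₁ : IsOpen V₁ := hV.inter (hcont.isOpen_inter_preimage W.isOpen (isOpen_chartDom q))
  have hxV₁ : x ∈ V₁ := ⟨hxV, hx, hq⟩
  have had := isAdapted_graph h hV₁ (fun z hz ↦ hz.2.1) (isOpen_chartDom (E := E) (F := F) q)
    (fun z hz ↦ hz.2.2)
  have hsm : ∀ {σ : Π x, S x}, SmoothSectionOn K F' S V σ → ∀ z ∈ V₁,
      ContMDiffAt K 𝓘(ℝ, F) ∞ (fun z ↦ toF F q (φ.base z) (φ.fibre z (σ z))) z := by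
    intro σ hσ z hz
    exact h.contMDiffAt_toF_apply hz.2.1 hz.2.2 (hσ.contMDiffAt (hV.mem_nhds hz.1))
  -- the sections `(x, y) ↦ (σ x, φ (σ x))`, the second entry having constant coordinates in `y`
  let ext : (Π x, S x) → Π p : X × M, ExtProd S A p := fun σ p ↦
    (σ p.1, ofF F q p.2 (toF F q (φ.base p.1) (φ.fibre p.1 (σ p.1))))
  have hext : ∀ {σ : Π x, S x}, SmoothSectionOn K F' S V σ →
      SmoothSectionOn (K.prod 𝓘(ℝ, E)) (F' × F) (ExtProd S A) (V₁ ×ˢ chartDom (E := E) F A q)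
        (ext σ) := by
    intro σ hσ p hp
    apply ContMDiffAt.contMDiffWithinAt
    rw [contMDiffAt_extProd_iff]
    constructor
    · exact ContMDiffAt.comp p (hσ.contMDiffAt (hV.mem_nhds hp.1.1)) contMDiffAt_fst
    · rw [(trivializationAt F A q).contMDiffAt_iff (by
        rw [Trivialization.mem_source]; exact hp.2.2)]
      refine ⟨contMDiffAt_snd, ?_⟩
      have h3 : ContMDiffAt (K.prod 𝓘(ℝ, E)) 𝓘(ℝ, F) ∞
          (fun p : X × M ↦ toF F q (φ.base p.1) (φ.fibre p.1 (σ p.1))) p :=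
        ContMDiffAt.comp p (hsm hσ p.1 hp.1) contMDiffAt_fst
      refine h3.congr_of_eventuallyEq ?_
      filter_upwards [(hV₁.prod (isOpen_chartDom (E := E) (F := F) q)).mem_nhds hp] with p hp
      change ((trivializationAt F A q) ⟨p.2, ofF F q p.2 _⟩).2 = _
      rw [← toF_eq_trivializationAt hp.2, toF_ofF hp.2]
  have hmem : ∀ σ : Π x, S x, ∀ z : W, z ∈ (Subtype.val ⁻¹' V₁ : Set W) →
      ext σ ((z : X), φ.base z) ∈ φ.graph z := by
    intro σ z hz
    change ofF F q (φ.base z) (toF F q (φ.base z) (φ.fibre z (σ z))) = φ.fibre z (σ z)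
    exact ofF_toF hz.2.2 _
  have key := h.graph.bracket_mem _ _ had (ext σ) (ext τ) (hext hσ) (hext hτ) (hmem σ) (hmem τ)
    ⟨x, hx⟩ hxV₁
  have key' : 𝒜.toLocal.bracket (secOf F A q (fun _ : E ↦ toF F q (φ.base x) (φ.fibre x (σ x))))
        (secOf F A q (fun _ : E ↦ toF F q (φ.base x) (φ.fibre x (τ x)))) (φ.base x)
      + fibreDeriv K F A (φ.base x) (fun z ↦ ofF F q (φ.base x)
          (toF F q (φ.base z) (φ.fibre z (τ z)))) x (𝒮.anchor x (σ x))
      - fibreDeriv K F A (φ.base x) (fun z ↦ ofF F q (φ.base x)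
          (toF F q (φ.base z) (φ.fibre z (σ z)))) x (𝒮.anchor x (τ x)) =
      φ.fibre x (𝒮.bracket σ τ x
        + fibreDeriv 𝓘(ℝ, E) F' S x (fun _ : M ↦ τ x) (φ.base x)
            (𝒜.anchor (φ.base x) (ofF F q (φ.base x) (toF F q (φ.base x) (φ.fibre x (σ x)))))
        - fibreDeriv 𝓘(ℝ, E) F' S x (fun _ : M ↦ σ x) (φ.base x)
            (𝒜.anchor (φ.base x) (ofF F q (φ.base x) (toF F q (φ.base x) (φ.fibre x (τ x)))))) :=
    key
  have hmd : ∀ {σ : Π x, S x}, SmoothSectionOn K F' S V σ → (fun z ↦ toF F q (φ.base x)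
      (ofF F q (φ.base x) (toF F q (φ.base z) (φ.fibre z (σ z))))) =
      fun z ↦ toF F q (φ.base z) (φ.fibre z (σ z)) := fun _ ↦ by
    funext z
    rw [toF_ofF hq]
  have hd : ∀ {σ : Π x, S x}, SmoothSectionOn K F' S V σ → ∀ v : TangentSpace K x,
      (show F from mfderiv K 𝓘(ℝ, F) (fun z ↦ toF F q (φ.base x) (ofF F q (φ.base x)
        (toF F q (φ.base z) (φ.fibre z (σ z))))) x v) =
      (show F from mfderiv K 𝓘(ℝ, F) (fun z ↦ toF F q (φ.base z) (φ.fibre z (σ z))) x v) :=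
    fun hσ v ↦ by rw [hmd hσ]; rfl
  rw [fibreDeriv_const, fibreDeriv_const, add_zero, sub_zero] at key'
  rw [← key', map_sub, map_add, ← coordBracket_apply 𝒜 hq, toF_fibreDeriv hq, toF_fibreDeriv hq]
  · exact congrArg₂ (· - ·) (congrArg₂ (· + ·) rfl (hd hτ _)) (hd hσ _)
  · rw [hmd hσ]
    exact (hsm hσ x hxV₁).mdifferentiableAt (by simp)
  · rw [hmd hτ]
    exact (hsm hτ x hxV₁).mdifferentiableAt (by simp)

end Extraction

/-! ### Bundle maps that satisfy the structure equations are morphisms -/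

section GraphAlgebra

variable {E : Type*} [NormedAddCommGroup E] [NormedSpace ℝ E]
  {F : Type*} [NormedAddCommGroup F] [NormedSpace ℝ F]
  {ρ : E → F →L[ℝ] E} {c : E → F →L[ℝ] F →L[ℝ] F} {f : E → E} {Φ : E → F →L[ℝ] F} {u : E}

/-- The derivative of a function along a graph is the sum of its partial derivatives. -/
theorem fderiv_along_graph {t : E × E → F} (ht : DifferentiableAt ℝ t (u, f u))
    (hf : DifferentiableAt ℝ f u) (a : E) :
    fderiv ℝ (fun z ↦ t (z, f z)) u a =
      fderiv ℝ (fun z ↦ t (z, f u)) u a + fderiv ℝ (fun z ↦ t (u, z)) (f u) (fderiv ℝ f u a) := by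
  have h1 : HasFDerivAt (fun z ↦ t (z, f z)) ((fderiv ℝ t (u, f u)).comp
      ((ContinuousLinearMap.id ℝ E).prod (fderiv ℝ f u))) u :=
    HasFDerivAt.comp (f := fun z ↦ (z, f z)) u ht.hasFDerivAt
      ((hasFDerivAt_id u).prodMk hf.hasFDerivAt)
  have h2 : HasFDerivAt (fun z ↦ t (z, f u)) ((fderiv ℝ t (u, f u)).comp
      ((ContinuousLinearMap.id ℝ E).prod 0)) u :=
    HasFDerivAt.comp (f := fun z ↦ (z, f u)) u ht.hasFDerivAt
      ((hasFDerivAt_id u).prodMk (hasFDerivAt_const (f u) u))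
  have h3 : HasFDerivAt (fun z ↦ t (u, z)) ((fderiv ℝ t (u, f u)).comp
      ((0 : E →L[ℝ] E).prod (ContinuousLinearMap.id ℝ E))) (f u) :=
    HasFDerivAt.comp (f := fun z ↦ (u, z)) (f u) ht.hasFDerivAt
      ((hasFDerivAt_const u (f u)).prodMk (hasFDerivAt_id (f u)))
  rw [h1.fderiv, h2.fderiv, h3.fderiv]
  simp only [ContinuousLinearMap.comp_apply, ContinuousLinearMap.prod_apply,
    ContinuousLinearMap.id_apply, zero_apply]
  rw [← map_add]
  simp

/-- The two components of the bracket of two sections of `A × A` which take their values in the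
graph of a morphism along the graph of its base map. -/
theorem IsLocMor.graph_bracket (h : IsLocMor ρ c f Φ u) (hf : DifferentiableAt ℝ f u)
    (hΦ : DifferentiableAt ℝ Φ u) {s₁ s₂ t₁ t₂ : E × E → F}
    (hs₁ : DifferentiableAt ℝ s₁ (u, f u)) (hs₂ : DifferentiableAt ℝ s₂ (u, f u))
    (ht₁ : DifferentiableAt ℝ t₁ (u, f u)) (ht₂ : DifferentiableAt ℝ t₂ (u, f u))
    (hs : ∀ᶠ z in 𝓝 u, s₂ (z, f z) = Φ z (s₁ (z, f z)))
    (ht : ∀ᶠ z in 𝓝 u, t₂ (z, f z) = Φ z (t₁ (z, f z))) :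
    c (f u) (s₂ (u, f u)) (t₂ (u, f u))
        + fderiv ℝ (fun z ↦ t₂ (u, z)) (f u) (ρ (f u) (s₂ (u, f u)))
        - fderiv ℝ (fun z ↦ s₂ (u, z)) (f u) (ρ (f u) (t₂ (u, f u)))
        + fderiv ℝ (fun z ↦ t₂ (z, f u)) u (ρ u (s₁ (u, f u)))
        - fderiv ℝ (fun z ↦ s₂ (z, f u)) u (ρ u (t₁ (u, f u))) =
      Φ u (c u (s₁ (u, f u)) (t₁ (u, f u))
        + fderiv ℝ (fun z ↦ t₁ (z, f u)) u (ρ u (s₁ (u, f u)))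
        - fderiv ℝ (fun z ↦ s₁ (z, f u)) u (ρ u (t₁ (u, f u)))
        + fderiv ℝ (fun z ↦ t₁ (u, z)) (f u) (ρ (f u) (s₂ (u, f u)))
        - fderiv ℝ (fun z ↦ s₁ (u, z)) (f u) (ρ (f u) (t₂ (u, f u)))) := by
  have key : ∀ {t₁ t₂ : E × E → F}, DifferentiableAt ℝ t₁ (u, f u) →
      DifferentiableAt ℝ t₂ (u, f u) → (∀ᶠ z in 𝓝 u, t₂ (z, f z) = Φ z (t₁ (z, f z))) →
      ∀ a, fderiv ℝ (fun z ↦ t₂ (z, f u)) u a +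
          fderiv ℝ (fun z ↦ t₂ (u, z)) (f u) (fderiv ℝ f u a) =
        fderiv ℝ Φ u a (t₁ (u, f u)) + Φ u (fderiv ℝ (fun z ↦ t₁ (z, f u)) u a +
          fderiv ℝ (fun z ↦ t₁ (u, z)) (f u) (fderiv ℝ f u a)) := by
    intro t₁ t₂ ht₁ ht₂ ht a
    rw [← fderiv_along_graph ht₁ hf, ← fderiv_along_graph ht₂ hf,
      EventuallyEq.fderiv_eq (show (fun z ↦ t₂ (z, f z)) =ᶠ[𝓝 u] _ from ht)]
    have hg : DifferentiableAt ℝ (fun z ↦ t₁ (z, f z)) u :=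
      DifferentiableAt.comp (f := fun z ↦ (z, f z)) u ht₁ (differentiableAt_id.prodMk hf)
    rw [(hΦ.hasFDerivAt.clm_apply hg.hasFDerivAt).fderiv]
    simp [add_comm]
  have h1 := key ht₁ ht₂ ht (ρ u (s₁ (u, f u)))
  have h2 := key hs₁ hs₂ hs (ρ u (t₁ (u, f u)))
  have h3 := h.bracket (s₁ (u, f u)) (t₁ (u, f u))
  rw [hs.self_of_nhds, ht.self_of_nhds]
  rw [h.anchor] at h1 h2
  simp only [map_add, map_sub] at h1 h2 ⊢
  rw [← h3]
  linear_combination (norm := module) h1 - h2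

end GraphAlgebra

section LocalForm

variable {E : Type*} [NormedAddCommGroup E] [NormedSpace ℝ E] [FiniteDimensional ℝ E]
  {M : Type*} [TopologicalSpace M] [T2Space M] [ChartedSpace E M] [IsManifold 𝓘(ℝ, E) ∞ M]
  {F : Type*} [NormedAddCommGroup F] [NormedSpace ℝ F] [FiniteDimensional ℝ F]
  {A : M → Type*} [TopologicalSpace (TotalSpace F A)] [∀ x, TopologicalSpace (A x)]
  [∀ x, AddCommGroup (A x)] [∀ x, Module ℝ (A x)]
  [FiberBundle F A] [VectorBundle ℝ F A] [ContMDiffVectorBundle ∞ F A 𝓘(ℝ, E)]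
  (𝒜 : LieAlgebroid 𝓘(ℝ, E) F A)

/-- Near `x₀`, the bundle map `φ` is given by `f` and `Φ` in the coordinates at `p`, and these
satisfy the structure equations of a morphism. -/
structure HasLocalForm (φ : BundleMap A A) (p : M) (f : E → E) (Φ : E → F →L[ℝ] F) (x₀ : M) :
    Prop where
  mem : x₀ ∈ chartDom (E := E) F A p
  smooth : ∀ᶠ y in 𝓝 (chartAt E p x₀), ContDiffAt ℝ ∞ f y ∧ ContDiffAt ℝ ∞ Φ y ∧
    IsLocMor (coordAnchor 𝒜 p) (coordBracket 𝒜 p) f Φ y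
  eq : ∀ᶠ x in 𝓝 x₀, φ.base x ∈ chartDom (E := E) F A p ∧
    chartAt E p (φ.base x) = f (chartAt E p x) ∧
    ∀ a, toF F p (φ.base x) (φ.fibre x a) = Φ (chartAt E p x) (toF F p x a)

variable {𝒜} {φ : BundleMap A A} {p : M} {f : E → E} {Φ : E → F →L[ℝ] F} {x₀ : M}

theorem HasLocalForm.contMDiffAt_base (h : HasLocalForm 𝒜 φ p f Φ x₀) :
    ContMDiffAt 𝓘(ℝ, E) 𝓘(ℝ, E) ∞ φ.base x₀ := by
  obtain ⟨h1, h2, -⟩ := h.eq.self_of_nhds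
  have h3 : ContMDiffAt 𝓘(ℝ, E) 𝓘(ℝ, E) ∞ (fun x ↦ f (chartAt E p x)) x₀ :=
    ContMDiffAt.comp (g := f) x₀ h.smooth.self_of_nhds.1.contMDiffAt (contMDiffAt_chart h.mem.1)
  have h4 : ContMDiffAt 𝓘(ℝ, E) 𝓘(ℝ, E) ∞
      (fun x ↦ (chartAt E p).symm (f (chartAt E p x))) x₀ := by
    refine ContMDiffAt.comp x₀ (contMDiffAt_chart_symm ?_) h3
    rw [← h2]
    exact (chartAt E p).map_source h1.1
  refine h4.congr_of_eventuallyEq ?_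
  filter_upwards [h.eq] with x hx
  rw [← hx.2.1, (chartAt E p).left_inv hx.1.1]

theorem HasLocalForm.contMDiffAt_toTotal (h : HasLocalForm 𝒜 φ p f Φ x₀) (a : A x₀) :
    ContMDiffAt (𝓘(ℝ, E).prod 𝓘(ℝ, F)) (𝓘(ℝ, E).prod 𝓘(ℝ, F)) ∞ (φ.toTotal F F)
      ⟨x₀, a⟩ := by
  have hproj : ContMDiffAt (𝓘(ℝ, E).prod 𝓘(ℝ, F)) 𝓘(ℝ, E) ∞ (fun z : TotalSpace F A ↦ z.1)
    ⟨x₀, a⟩ := contMDiffAt_proj A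
  rw [(trivializationAt F A p).contMDiffAt_iff (by
    rw [Trivialization.mem_source]; exact h.eq.self_of_nhds.1.2)]
  refine ⟨ContMDiffAt.comp (g := φ.base) (f := fun z : TotalSpace F A ↦ z.1) ⟨x₀, a⟩
    h.contMDiffAt_base hproj, ?_⟩
  have h1 : ContMDiffAt (𝓘(ℝ, E).prod 𝓘(ℝ, F)) 𝓘(ℝ, F) ∞
      (fun z : TotalSpace F A ↦ ((trivializationAt F A p) z).2) ⟨x₀, a⟩ :=
    (((trivializationAt F A p).contMDiffAt_iff (f := fun z ↦ z) (by
      rw [Trivialization.mem_source]; exact h.mem.2)).1 contMDiffAt_id).2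
  have h2 : ContMDiffAt (𝓘(ℝ, E).prod 𝓘(ℝ, F)) 𝓘(ℝ, F →L[ℝ] F) ∞
      (fun z : TotalSpace F A ↦ Φ (chartAt E p z.1)) ⟨x₀, a⟩ :=
    ContMDiffAt.comp (g := fun x ↦ Φ (chartAt E p x)) (f := fun z : TotalSpace F A ↦ z.1)
      ⟨x₀, a⟩ (ContMDiffAt.comp (g := Φ) x₀ h.smooth.self_of_nhds.2.1.contMDiffAt
        (contMDiffAt_chart h.mem.1)) hproj
  refine (h2.clm_apply h1).congr_of_eventuallyEq ?_
  have h3 : ∀ᶠ z : TotalSpace F A in 𝓝 ⟨x₀, a⟩, z.1 ∈ chartDom (E := E) F A p ∧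
    φ.base z.1 ∈ chartDom (E := E) F A p ∧
    ∀ a, toF F p (φ.base z.1) (φ.fibre z.1 a) = Φ (chartAt E p z.1) (toF F p z.1 a) := by
    have hc : ContinuousAt (fun z : TotalSpace F A ↦ z.1) ⟨x₀, a⟩ := hproj.continuousAt
    filter_upwards [hc.eventually h.eq, hc.eventually ((isOpen_chartDom p).mem_nhds h.mem)]
      with z hz hz'
    exact ⟨hz', hz.1, hz.2.2⟩
  filter_upwards [h3] with z hz
  change ((trivializationAt F A p) ⟨φ.base z.1, φ.fibre z.1 z.2⟩).2 = _
  rw [← toF_eq_trivializationAt hz.2.1, hz.2.2, toF_eq_trivializationAt hz.1]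

theorem HasLocalForm.mfderiv_base_anchor (h : HasLocalForm 𝒜 φ p f Φ x₀) (a : A x₀) :
    mfderiv 𝓘(ℝ, E) 𝓘(ℝ, E) φ.base x₀ (𝒜.anchor x₀ a) =
      𝒜.anchor (φ.base x₀) (φ.fibre x₀ a) := by
  obtain ⟨h1, h2, h3⟩ := h.eq.self_of_nhds
  obtain ⟨hf, hΦ, hm⟩ := h.smooth.self_of_nhds
  apply chartDeriv_injective h1.1
  rw [← coordAnchor_apply 𝒜 h1, h3, h2, ← hm.anchor, coordAnchor_apply 𝒜 h.mem,
    ← mfderiv_comp_chart h.mem.1 (hf.differentiableAt (by simp))]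
  have e : (fun z ↦ f (chartAt E p z)) =ᶠ[𝓝 x₀] chartAt E p ∘ φ.base := by
    filter_upwards [h.eq] with z hz
    exact hz.2.1.symm
  rw [e.mfderiv_eq]
  exact (mfderiv_comp_apply x₀ ((contMDiffAt_chart h1.1).mdifferentiableAt (by simp))
    (h.contMDiffAt_base.mdifferentiableAt (by simp)) _).symm

variable (F) in
/-- A map with values in the pullback of `A` to `M × M` along the first projection, in the
coordinates at `p`. -/
def pairCoord (p : M) (g : Π x : M, M → A x) (q : E × E) : F :=
  toF F p ((chartAt E p).symm q.1) (g ((chartAt E p).symm q.1) ((chartAt E p).symm q.2))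

theorem pairCoord_apply {x y : M} (hx : x ∈ (chartAt E p).source)
    (hy : y ∈ (chartAt E p).source) (g : Π x : M, M → A x) :
    pairCoord F p g (chartAt E p x, chartAt E p y) = toF F p x (g x y) := by
  simp only [pairCoord]
  rw [(chartAt E p).left_inv hx, (chartAt E p).left_inv hy]

theorem contDiffAt_pairCoord {x y : M} (hx : x ∈ chartDom (E := E) F A p)
    (hy : y ∈ chartDom (E := E) F A p) {g : Π x : M, M → A x}
    (hg : ContMDiffAt (𝓘(ℝ, E).prod 𝓘(ℝ, E)) (𝓘(ℝ, E).prod 𝓘(ℝ, F)) ∞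
      (fun z : M × M ↦ TotalSpace.mk' F z.1 (g z.1 z.2)) (x, y)) :
    ContDiffAt ℝ ∞ (pairCoord F p g) (chartAt E p x, chartAt E p y) := by
  have h1 := (((trivializationAt F A p).contMDiffAt_iff (by
      rw [Trivialization.mem_source]; exact hx.2)).1 hg).2
  have h2 : ContMDiffAt 𝓘(ℝ, E × E) (𝓘(ℝ, E).prod 𝓘(ℝ, E)) ∞
      (fun q : E × E ↦ ((chartAt E p).symm q.1, (chartAt E p).symm q.2))
      (chartAt E p x, chartAt E p y) :=
    (ContMDiffAt.comp (f := fun q : E × E ↦ q.1) (I' := 𝓘(ℝ, E)) (chartAt E p x, chartAt E p y)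
      (contMDiffAt_chart_symm ((chartAt E p).map_source hx.1)) contDiffAt_fst.contMDiffAt).prodMk
    (ContMDiffAt.comp (f := fun q : E × E ↦ q.2) (I' := 𝓘(ℝ, E)) (chartAt E p x, chartAt E p y)
      (contMDiffAt_chart_symm ((chartAt E p).map_source hy.1)) contDiffAt_snd.contMDiffAt)
  have h3 : ContMDiffAt 𝓘(ℝ, E × E) 𝓘(ℝ, F) ∞ (fun q : E × E ↦ ((trivializationAt F A p)
      ⟨(chartAt E p).symm q.1, g ((chartAt E p).symm q.1) ((chartAt E p).symm q.2)⟩).2)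
      (chartAt E p x, chartAt E p y) := by
    refine ContMDiffAt.comp (chartAt E p x, chartAt E p y) (g := fun z : M × M ↦
      ((trivializationAt F A p) ⟨z.1, g z.1 z.2⟩).2) ?_ h2
    simp only
    rw [(chartAt E p).left_inv hx.1, (chartAt E p).left_inv hy.1]
    exact h1
  refine h3.contDiffAt.congr_of_eventuallyEq ?_
  filter_upwards [continuousAt_fst.eventually ((isOpen_coordDom (F := F) (A := A) p).mem_nhds
    (map_mem_coordDom hx))] with q hq
  exact toF_eq_trivializationAt (symm_mem_chartDom hq) _

theorem eventually_contDiffAt_pairCoord {x y : M} (hx : x ∈ chartDom (E := E) F A p)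
    (hy : y ∈ chartDom (E := E) F A p) {g : Π x : M, M → A x}
    (hg : ∀ᶠ z in 𝓝 (x, y), ContMDiffAt (𝓘(ℝ, E).prod 𝓘(ℝ, E)) (𝓘(ℝ, E).prod 𝓘(ℝ, F)) ∞
      (fun z : M × M ↦ TotalSpace.mk' F z.1 (g z.1 z.2)) z) :
    ∀ᶠ q in 𝓝 (chartAt E p x, chartAt E p y), ContDiffAt ℝ ∞ (pairCoord F p g) q := by
  have hc : ContinuousAt (fun q : E × E ↦ ((chartAt E p).symm q.1, (chartAt E p).symm q.2))
      (chartAt E p x, chartAt E p y) :=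
    (ContinuousAt.comp (f := Prod.fst) (x := (chartAt E p x, chartAt E p y))
      ((chartAt E p).continuousAt_symm ((chartAt E p).map_source hx.1)) continuousAt_fst).prodMk
    (ContinuousAt.comp (f := Prod.snd) (x := (chartAt E p x, chartAt E p y))
      ((chartAt E p).continuousAt_symm ((chartAt E p).map_source hy.1)) continuousAt_snd)
  have h1 := hc.eventually (by
    simp only [(chartAt E p).left_inv hx.1, (chartAt E p).left_inv hy.1]; exact hg)
  filter_upwards [h1, ((isOpen_coordDom (F := F) (A := A) p).prod
    (isOpen_coordDom (F := F) (A := A) p)).mem_nhds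
    (show (chartAt E p x, chartAt E p y) ∈ _ from ⟨map_mem_coordDom hx, map_mem_coordDom hy⟩)]
    with q hq hq'
  have := contDiffAt_pairCoord (symm_mem_chartDom hq'.1) (symm_mem_chartDom hq'.2) hq
  rwa [(chartAt E p).right_inv hq'.1.1, (chartAt E p).right_inv hq'.2.1] at this

/-- One component of the bracket of the product algebroid, in coordinates: the bracket of the factor
plus the derivatives in the direction of the other factor. -/
theorem toF_pair_bracket {x y : M} (hx : x ∈ chartDom (E := E) F A p)
    (hy : y ∈ chartDom (E := E) F A p) {g k : Π x : M, M → A x}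
    (hg : ∀ᶠ q in 𝓝 (chartAt E p x, chartAt E p y), ContDiffAt ℝ ∞ (pairCoord F p g) q)
    (hk : ∀ᶠ q in 𝓝 (chartAt E p x, chartAt E p y), ContDiffAt ℝ ∞ (pairCoord F p k) q)
    (w₁ w₂ : TangentSpace 𝓘(ℝ, E) y) :
    toF F p x (𝒜.toLocal.bracket (fun x ↦ g x y) (fun x ↦ k x y) x
      + fibreDeriv 𝓘(ℝ, E) F A x (fun y ↦ k x y) y w₁
      - fibreDeriv 𝓘(ℝ, E) F A x (fun y ↦ g x y) y w₂) =
    coordBracket 𝒜 p (chartAt E p x) (toF F p x (g x y)) (toF F p x (k x y))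
      + fderiv ℝ (fun z ↦ pairCoord F p k (z, chartAt E p y)) (chartAt E p x)
          (coordAnchor 𝒜 p (chartAt E p x) (toF F p x (g x y)))
      - fderiv ℝ (fun z ↦ pairCoord F p g (z, chartAt E p y)) (chartAt E p x)
          (coordAnchor 𝒜 p (chartAt E p x) (toF F p x (k x y)))
      + fderiv ℝ (fun z ↦ pairCoord F p k (chartAt E p x, z)) (chartAt E p y)
          (chartDeriv E p y w₁)
      - fderiv ℝ (fun z ↦ pairCoord F p g (chartAt E p x, z)) (chartAt E p y)
          (chartDeriv E p y w₂) := by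
  have hdiag : ∀ {g : Π x : M, M → A x},
      (∀ᶠ q in 𝓝 (chartAt E p x, chartAt E p y), ContDiffAt ℝ ∞ (pairCoord F p g) q) →
      ∀ᶠ z in 𝓝 (chartAt E p x),
        ContDiffAt ℝ ∞ (fun z ↦ pairCoord F p g (z, chartAt E p y)) z := by
    intro g hg
    have hc : ContinuousAt (fun z : E ↦ (z, chartAt E p y)) (chartAt E p x) := by fun_prop
    filter_upwards [hc.eventually hg] with z hz
    exact ContDiffAt.comp (f := fun z ↦ (z, chartAt E p y)) z hz
      (contDiffAt_id.prodMk contDiffAt_const)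
  have hsec : ∀ {g : Π x : M, M → A x}, ∀ᶠ z in 𝓝 x, g z y =
      secOf F A p (fun z ↦ pairCoord F p g (z, chartAt E p y)) z := by
    intro g
    filter_upwards [(isOpen_chartDom p).mem_nhds hx] with z hz
    apply toF_injective hz
    rw [toF_secOf hz, pairCoord_apply hz.1 hy.1]
  have hfib : ∀ {g : Π x : M, M → A x},
      (∀ᶠ q in 𝓝 (chartAt E p x, chartAt E p y), ContDiffAt ℝ ∞ (pairCoord F p g) q) →
      ∀ w, toF F p x (fibreDeriv 𝓘(ℝ, E) F A x (fun y ↦ g x y) y w) =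
        fderiv ℝ (fun z ↦ pairCoord F p g (chartAt E p x, z)) (chartAt E p y)
          (chartDeriv E p y w) := by
    intro g hg w
    have hd : DifferentiableAt ℝ (fun z ↦ pairCoord F p g (chartAt E p x, z)) (chartAt E p y) :=
      DifferentiableAt.comp (f := fun z ↦ (chartAt E p x, z)) (chartAt E p y)
        (hg.self_of_nhds.differentiableAt (by simp))
        ((differentiableAt_const _).prodMk differentiableAt_id)
    have e : (fun y ↦ toF F p x (g x y)) =ᶠ[𝓝 y]
        fun z ↦ (fun z ↦ pairCoord F p g (chartAt E p x, z)) (chartAt E p z) := by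
      filter_upwards [(isOpen_chartDom (F := F) (A := A) p).mem_nhds hy] with z hz
      exact (pairCoord_apply hx.1 hz.1 g).symm
    have hm := MDifferentiableAt.comp (I' := 𝓘(ℝ, E)) y hd.mdifferentiableAt
      ((contMDiffAt_chart hy.1).mdifferentiableAt (by simp))
    rw [toF_fibreDeriv hx (hm.congr_of_eventuallyEq e), e.mfderiv_eq]
    exact mfderiv_comp_chart hy.1 hd w
  rw [map_sub, map_add, hfib hg, hfib hk,
    toLocal_bracket_congr (hasExtension_secOf hx (hdiag hg)) (hasExtension_secOf hx (hdiag hk))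
      hsec hsec, toF_bracket_secOf 𝒜 hx (hdiag hg) (hdiag hk), pairCoord_apply hx.1 hy.1,
    pairCoord_apply hx.1 hy.1]

/-- Sections of `A × A` that take values in the graph of `φ` along the graph of its base map have a
bracket with the same property, if `φ` satisfies the structure equations in coordinates. -/
theorem graph_bracket_mem (h : HasLocalForm 𝒜 φ p f Φ x₀) {U : Set (M × M)} (hU : IsOpen U)
    (hx₀ : (x₀, φ.base x₀) ∈ U) {σ τ : Π x : M × M, ExtProd A A x}
    (hσ : SmoothSectionOn (𝓘(ℝ, E).prod 𝓘(ℝ, E)) (F × F) (ExtProd A A) U σ)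
    (hτ : SmoothSectionOn (𝓘(ℝ, E).prod 𝓘(ℝ, E)) (F × F) (ExtProd A A) U τ)
    (hσg : ∀ᶠ x in 𝓝 x₀, (σ (x, φ.base x)).2 = φ.fibre x (σ (x, φ.base x)).1)
    (hτg : ∀ᶠ x in 𝓝 x₀, (τ (x, φ.base x)).2 = φ.fibre x (τ (x, φ.base x)).1) :
    ((𝒜.toLocal.prod F F 𝒜.toLocal).bracket σ τ (x₀, φ.base x₀)).2 =
      φ.fibre x₀ ((𝒜.toLocal.prod F F 𝒜.toLocal).bracket σ τ (x₀, φ.base x₀)).1 := by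
  obtain ⟨hy, hfx, hΦx⟩ := h.eq.self_of_nhds
  obtain ⟨hf, hΦ, hm⟩ := h.smooth.self_of_nhds
  have hx := h.mem
  set y₀ := φ.base x₀ with hy₀
  have h1 : ∀ {σ : Π x : M × M, ExtProd A A x},
      SmoothSectionOn (𝓘(ℝ, E).prod 𝓘(ℝ, E)) (F × F) (ExtProd A A) U σ →
      ∀ᶠ q in 𝓝 (chartAt E p x₀, chartAt E p y₀),
        ContDiffAt ℝ ∞ (pairCoord F p fun x y ↦ (σ (x, y)).1) q := by
    intro σ hσ
    apply eventually_contDiffAt_pairCoord hx hy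
    filter_upwards [hU.mem_nhds hx₀] with z hz
    exact (contMDiffAt_extProd_iff.1 (hσ.contMDiffAt (hU.mem_nhds hz))).1
  have h2 : ∀ {σ : Π x : M × M, ExtProd A A x},
      SmoothSectionOn (𝓘(ℝ, E).prod 𝓘(ℝ, E)) (F × F) (ExtProd A A) U σ →
      ∀ᶠ q in 𝓝 (chartAt E p y₀, chartAt E p x₀),
        ContDiffAt ℝ ∞ (pairCoord F p fun y x ↦ (σ (x, y)).2) q := by
    intro σ hσ
    apply eventually_contDiffAt_pairCoord hy hx
    have hc : ContinuousAt (Prod.swap : M × M → M × M) (y₀, x₀) := continuous_swap.continuousAt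
    filter_upwards [hc.eventually (hU.mem_nhds hx₀)] with z hz
    exact ContMDiffAt.comp (g := fun w : M × M ↦ TotalSpace.mk' F (E := A) w.2 (σ w).2)
      (f := fun z : M × M ↦ (z.2, z.1)) z
      (contMDiffAt_extProd_iff.1 (hσ.contMDiffAt (hU.mem_nhds hz))).2
      (contMDiffAt_snd.prodMk contMDiffAt_fst)
  have hg : ∀ {σ : Π x : M × M, ExtProd A A x},
      (∀ᶠ x in 𝓝 x₀, (σ (x, φ.base x)).2 = φ.fibre x (σ (x, φ.base x)).1) →
      ∀ᶠ z in 𝓝 (chartAt E p x₀), pairCoord F p (fun y x ↦ (σ (x, y)).2) (f z, z) =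
        Φ z (pairCoord F p (fun x y ↦ (σ (x, y)).1) (z, f z)) := by
    intro σ hσ
    filter_upwards [eventually_nhds_symm hx.1 (hσ.and h.eq),
      (isOpen_coordDom (F := F) (A := A) p).mem_nhds (map_mem_coordDom hx)] with z hz hz'
    obtain ⟨e1, e2, e3, e4⟩ := hz
    have hz1 := symm_mem_chartDom hz'
    have e5 := e4 (σ ((chartAt E p).symm z, φ.base ((chartAt E p).symm z))).1
    rw [← e1, ← pairCoord_apply e2.1 hz1.1 (fun y x ↦ (σ (x, y)).2),
      ← pairCoord_apply hz1.1 e2.1 (fun x y ↦ (σ (x, y)).1), e3,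
      (chartAt E p).right_inv hz'.1] at e5
    exact e5
  apply toF_injective hy
  rw [hΦx]
  have B1 := toF_pair_bracket (𝒜 := 𝒜) hx hy (h1 hσ) (h1 hτ)
    (𝒜.anchor y₀ (σ (x₀, y₀)).2) (𝒜.anchor y₀ (τ (x₀, y₀)).2)
  have B2 := toF_pair_bracket (𝒜 := 𝒜) hy hx (h2 hσ) (h2 hτ)
    (𝒜.anchor x₀ (σ (x₀, y₀)).1) (𝒜.anchor x₀ (τ (x₀, y₀)).1)
  refine B2.trans ((Eq.trans ?_ (congrArg (Φ (chartAt E p x₀)) B1).symm))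
  have hd1 := fun {σ} hσ ↦ (h1 (σ := σ) hσ).self_of_nhds.differentiableAt (by simp)
  have hd2 : ∀ {σ : Π x : M × M, ExtProd A A x},
      SmoothSectionOn (𝓘(ℝ, E).prod 𝓘(ℝ, E)) (F × F) (ExtProd A A) U σ →
      DifferentiableAt ℝ (fun q : E × E ↦ pairCoord F p (fun y x ↦ (σ (x, y)).2) (q.2, q.1))
        (chartAt E p x₀, chartAt E p y₀) := fun hσ ↦
    DifferentiableAt.comp (f := fun q : E × E ↦ (q.2, q.1)) (chartAt E p x₀, chartAt E p y₀)
      ((h2 hσ).self_of_nhds.differentiableAt (by simp)) (by fun_prop)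
  rw [hfx] at hd1 hd2
  have key := hm.graph_bracket (hf.differentiableAt (by simp)) (hΦ.differentiableAt (by simp))
    (hd1 hσ) (hd2 hσ) (hd1 hτ) (hd2 hτ) (hg hσg) (hg hτg)
  simp only [← hfx, pairCoord_apply hx.1 hy.1, pairCoord_apply hy.1 hx.1] at key
  simp only [← coordAnchor_apply 𝒜 hx, ← coordAnchor_apply 𝒜 hy]
  exact key

/-- A bundle map that satisfies the structure equations in coordinates near every point is a
morphism of Lie algebroids in the sense of graphs. -/
theorem isLieMorphism_of_hasLocalForm {W W' : TopologicalSpace.Opens M}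
    (hmap : MapsTo φ.base W W')
    (hloc : ∀ x₀ ∈ W, ∃ p f Φ, HasLocalForm 𝒜 φ p f Φ x₀) :
    IsLieMorphism F F 𝒜.toLocal 𝒜.toLocal W W' φ := by
  have hbase : ∀ x ∈ W, ContMDiffAt 𝓘(ℝ, E) 𝓘(ℝ, E) ∞ φ.base x := fun x hx ↦ by
    obtain ⟨p, f, Φ, h⟩ := hloc x hx
    exact h.contMDiffAt_base
  have hval : ∀ x : W, ContMDiffAt 𝓘(ℝ, E) 𝓘(ℝ, E) ∞ (Subtype.val : W → M) x := fun x ↦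
    contMDiff_subtype_val.contMDiffAt
  have hbase' : ∀ x : W, ContMDiffAt 𝓘(ℝ, E) 𝓘(ℝ, E) ∞ (fun x : W ↦ φ.base x) x := fun x ↦
    ContMDiffAt.comp (g := φ.base) x (hbase x x.2) (hval x)
  have hder : ∀ x : W, ∀ v, mfderiv 𝓘(ℝ, E) (𝓘(ℝ, E).prod 𝓘(ℝ, E))
      (fun x : W ↦ ((x : M), φ.base x)) x v =
      (mfderiv 𝓘(ℝ, E) 𝓘(ℝ, E) (Subtype.val : W → M) x v, mfderiv 𝓘(ℝ, E) 𝓘(ℝ, E) φ.base x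
        (mfderiv 𝓘(ℝ, E) 𝓘(ℝ, E) (Subtype.val : W → M) x v)) := by
    intro x v
    rw [mfderiv_prodMk ((hval x).mdifferentiableAt (by simp))
      ((hbase' x).mdifferentiableAt (by simp))]
    refine Prod.ext rfl ?_
    exact mfderiv_comp_apply (g := φ.base) (f := (Subtype.val : W → M)) x
      ((hbase x x.2).mdifferentiableAt (by simp)) ((hval x).mdifferentiableAt (by simp)) v
  refine ⟨hmap, ?_, ?_⟩
  · rintro ⟨x, a⟩ hx
    obtain ⟨p, f, Φ, h⟩ := hloc x hx
    exact (h.contMDiffAt_toTotal a).contMDiffWithinAt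
  refine ⟨⟨?_, ?_, ?_, ?_⟩, ?_, ?_⟩
  · exact fun x ↦ (hval x).prodMk (hbase' x)
  · exact fun x y hxy ↦ Subtype.ext (congrArg Prod.fst hxy)
  · intro x v w hvw
    rw [hder, hder] at hvw
    exact (mfderiv_opens_val_bijective W x).1 (congrArg Prod.fst hvw)
  · intro x₀
    let b := Module.finBasis ℝ F
    refine ⟨Subtype.val ⁻¹' chartDom (E := E) F A x₀.1,
      ((isOpen_chartDom _).preimage continuous_subtype_val).mem_nhds (mem_chartDom_self _),
      Module.finrank ℝ F, fun i x ↦ (ofF F x₀.1 x (b i), φ.fibre x (ofF F x₀.1 x (b i))),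
      fun i x hx ↦ ?_, fun x hx ↦ ?_⟩
    · obtain ⟨p, f, Φ, h⟩ := hloc x x.2
      apply ContMDiffAt.contMDiffWithinAt
      refine (contMDiffAt_extProd_iff (A := A) (B := A) (g := fun y : W ↦ ((y : M), φ.base y))
        (s := fun y ↦ (ofF F x₀.1 y (b i), φ.fibre y (ofF F x₀.1 y (b i))))).2 ?_
      have h1 : ContMDiffAt 𝓘(ℝ, E) (𝓘(ℝ, E).prod 𝓘(ℝ, F)) ∞
          (fun x : W ↦ TotalSpace.mk' F (E := A) x (ofF F x₀.1 x (b i))) x :=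
        ContMDiffAt.comp (f := (Subtype.val : W → M)) x
          (contMDiffAt_secOf hx (S := fun _ : E ↦ b i) contDiffAt_const) (hval x)
      exact ⟨h1, ContMDiffAt.comp x (h.contMDiffAt_toTotal _) h1⟩
    · let L : F →ₗ[ℝ] A x × A (φ.base x) :=
        (LinearMap.prod LinearMap.id (φ.fibre x)) ∘ₗ (ofF F x₀.1 (x : M)).toLinearMap
      have hL : (fun i ↦ ((ofF F x₀.1 x (b i), φ.fibre x (ofF F x₀.1 x (b i))) :
        A x × A (φ.base x))) = L ∘ b := rfl
      have hinj : Function.Injective L := by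
        intro u v huv
        have h1 : ofF F x₀.1 (x : M) u = ofF F x₀.1 (x : M) v := congrArg Prod.fst huv
        rw [← toF_ofF hx u, h1, toF_ofF hx]
      change LinearIndependent ℝ (fun i ↦ ((ofF F x₀.1 x (b i),
          φ.fibre x (ofF F x₀.1 x (b i))) : A x × A (φ.base x))) ∧
        Submodule.span ℝ (range fun i ↦ ((ofF F x₀.1 x (b i),
          φ.fibre x (ofF F x₀.1 x (b i))) : A x × A (φ.base x))) = LinearMap.graph (φ.fibre x)
      rw [hL]
      refine ⟨b.linearIndependent.map' L (LinearMap.ker_eq_bot.2 hinj), ?_⟩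
      rw [range_comp, Submodule.span_image, b.span_eq]
      ext ⟨u, v⟩
      rw [LinearMap.mem_graph_iff, Submodule.map_top, LinearMap.mem_range]
      constructor
      · rintro ⟨w, hw⟩
        have h1 : ofF F x₀.1 (x : M) w = u := congrArg Prod.fst hw
        have h2 : φ.fibre x (ofF F x₀.1 (x : M) w) = v := congrArg Prod.snd hw
        exact h2.symm.trans (congrArg _ h1)
      · intro h
        refine ⟨toF F x₀.1 x u, Prod.ext (ofF_toF hx u) ?_⟩
        exact (congrArg (φ.fibre x) (ofF_toF hx u)).trans h.symm
  · intro x b hb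
    obtain ⟨p, f, Φ, h⟩ := hloc x x.2
    obtain ⟨v, hv⟩ := (mfderiv_opens_val_bijective W x).2 (𝒜.anchor x b.1)
    refine ⟨v, ?_⟩
    rw [hder, hv]
    refine Prod.ext rfl ?_
    have hb' : b.2 = φ.fibre x b.1 := hb
    exact (h.mfderiv_base_anchor b.1).trans (congrArg (𝒜.anchor _) hb'.symm)
  · rintro U V ⟨hU, hV, hUV, -⟩ σ τ hσ hτ hσB hτB x hxV
    obtain ⟨p, f, Φ, h⟩ := hloc x x.2
    have hV' : ∀ᶠ z : M in 𝓝 (x : M), ∃ hz : z ∈ W, (⟨z, hz⟩ : W) ∈ V := by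
      have := (W.isOpen.isOpenMap_subtype_val V hV).mem_nhds (mem_image_of_mem _ hxV)
      filter_upwards [this] with z hz
      obtain ⟨z', hz', rfl⟩ := hz
      exact ⟨z'.2, hz'⟩
    refine graph_bracket_mem h hU (hUV hxV) hσ hτ ?_ ?_
    · filter_upwards [hV'] with z ⟨hz, hz'⟩
      exact hσB ⟨z, hz⟩ hz'
    · filter_upwards [hV'] with z ⟨hz, hz'⟩
      exact hτB ⟨z, hz⟩ hz'

end LocalForm

/-! ### Reparametrization of the unit interval -/

section Clock

/-- A smooth map from the real line to the unit interval which is `0` for `t ≤ 0` and `1` for `1 ≤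
t`. Reparametrization by it turns a homotopy over `[0,1]` into one over the real line, in which the
time parameter has no boundary. -/
def clock (t : ℝ) : Icc (0 : ℝ) 1 :=
  ⟨Real.smoothTransition t, Real.smoothTransition.nonneg t, Real.smoothTransition.le_one t⟩

theorem clock_zero : clock 0 = 0 := Subtype.ext (Real.smoothTransition.zero_of_nonpos le_rfl)

theorem clock_one : clock 1 = 1 := Subtype.ext (Real.smoothTransition.one_of_one_le le_rfl)

theorem contMDiff_clock : ContMDiff 𝓘(ℝ, ℝ) (𝓡∂ 1) ∞ clock := by
  rw [contMDiff_iff_comp_subtypeVal_Icc]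
  refine ⟨?_, ?_⟩
  · exact Continuous.subtype_mk Real.smoothTransition.continuous _
  · exact Real.smoothTransition.contDiff.contMDiff

/-- The velocity of the map `clock`. -/
def clockVel (t : ℝ) : TangentSpace (𝓡∂ 1) (clock t) :=
  mfderiv 𝓘(ℝ, ℝ) (𝓡∂ 1) clock t (show TangentSpace 𝓘(ℝ, ℝ) t from (1 : ℝ))

theorem contMDiff_clockVel : ContMDiff 𝓘(ℝ, ℝ) ((𝓡∂ 1).prod 𝓘(ℝ, EuclideanSpace ℝ (Fin 1))) ∞
    (fun t ↦ TotalSpace.mk' (EuclideanSpace ℝ (Fin 1))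
      (E := (TangentSpace (𝓡∂ 1) : Icc (0 : ℝ) 1 → Type _)) (clock t) (clockVel t)) := by
  have h1 := contMDiff_clock.contMDiff_tangentMap (m := ∞) (by simp)
  have h2 : ContMDiff 𝓘(ℝ, ℝ) 𝓘(ℝ, ℝ).tangent ∞
      (fun t : ℝ ↦ (⟨t, (1 : ℝ)⟩ : TangentBundle 𝓘(ℝ, ℝ) ℝ)) :=
    contMDiff_vectorSpace_iff_contDiff.2 contDiff_const
  exact h1.comp h2

end Clock

section Homotopy

variable {E : Type*} [NormedAddCommGroup E] [NormedSpace ℝ E] [FiniteDimensional ℝ E]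
  {M : Type*} [TopologicalSpace M] [T2Space M] [ChartedSpace E M] [IsManifold 𝓘(ℝ, E) ∞ M]
  {G : Type*} [NormedAddCommGroup G] [NormedSpace ℝ G]

/-- The point of `[0,1] × M` at the clock time `q.1` with the coordinates `q.2` in the chart at `p`.
-/
def clockPt (p : M) (q : ℝ × E) : Icc (0 : ℝ) 1 × M := (clock q.1, (chartAt E p).symm q.2)

theorem contMDiffAt_clockPt {p : M} {q : ℝ × E} (hq : q.2 ∈ (chartAt E p).target) :
    ContMDiffAt 𝓘(ℝ, ℝ × E) ((𝓡∂ 1).prod 𝓘(ℝ, E)) ∞ (clockPt p) q :=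
  (ContMDiffAt.comp (f := fun q : ℝ × E ↦ q.1) (I' := 𝓘(ℝ, ℝ)) q
    contMDiff_clock.contMDiffAt contDiffAt_fst.contMDiffAt).prodMk
  (ContMDiffAt.comp (f := fun q : ℝ × E ↦ q.2) (I' := 𝓘(ℝ, E)) q
    (contMDiffAt_chart_symm hq) contDiffAt_snd.contMDiffAt)

theorem mfderiv_chart_symm_chartDeriv {p x : M} (hx : x ∈ (chartAt E p).source)
    (v : TangentSpace 𝓘(ℝ, E) x) :
    mfderiv 𝓘(ℝ, E) 𝓘(ℝ, E) (chartAt E p).symm (chartAt E p x) (chartDeriv E p x v) = v := by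
  have h1 := (contMDiffAt_chart (E := E) hx).mdifferentiableAt (by simp)
  have h2 := (contMDiffAt_chart_symm (E := E) ((chartAt E p).map_source hx)).mdifferentiableAt
    (by simp)
  have h := mfderiv_comp x h2 h1
  have e : (chartAt E p).symm ∘ (chartAt E p) =ᶠ[𝓝 x] id := by
    filter_upwards [(chartAt E p).open_source.mem_nhds hx] with z hz
    exact (chartAt E p).left_inv hz
  rw [e.mfderiv_eq, mfderiv_id] at h
  exact (congrArg (fun L ↦ L v) h).symm

/-- The chain rule for a function on `[0,1] × M` in the coordinates given by the clock and the
chart. -/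
theorem fderiv_comp_clockPt {p : M} {q : ℝ × E} (hq : q.2 ∈ (chartAt E p).target)
    {g : Icc (0 : ℝ) 1 × M → G}
    (hg : MDifferentiableAt ((𝓡∂ 1).prod 𝓘(ℝ, E)) 𝓘(ℝ, G) g (clockPt p q)) (s : ℝ) (u : E) :
    fderiv ℝ (fun q ↦ g (clockPt p q)) q (s, u) =
      (show G from mfderiv ((𝓡∂ 1).prod 𝓘(ℝ, E)) 𝓘(ℝ, G) g (clockPt p q)
        (s • clockVel q.1, mfderiv 𝓘(ℝ, E) 𝓘(ℝ, E) (chartAt E p).symm q.2 u)) := by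
  have h1 : MDifferentiableAt 𝓘(ℝ, ℝ × E) (𝓡∂ 1) (fun q : ℝ × E ↦ clock q.1) q :=
    (ContMDiffAt.comp (f := fun q : ℝ × E ↦ q.1) (I' := 𝓘(ℝ, ℝ)) q
      contMDiff_clock.contMDiffAt contDiffAt_fst.contMDiffAt).mdifferentiableAt (by simp)
  have h2 : MDifferentiableAt 𝓘(ℝ, ℝ × E) 𝓘(ℝ, E)
      (fun q : ℝ × E ↦ (chartAt E p).symm q.2) q :=
    (ContMDiffAt.comp (f := fun q : ℝ × E ↦ q.2) (I' := 𝓘(ℝ, E)) q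
      (contMDiffAt_chart_symm hq) contDiffAt_snd.contMDiffAt).mdifferentiableAt (by simp)
  have h3 : mfderiv 𝓘(ℝ, ℝ × E) (𝓡∂ 1) (fun q : ℝ × E ↦ clock q.1) q
      (show TangentSpace 𝓘(ℝ, ℝ × E) q from (s, u)) = s • clockVel q.1 := by
    have := mfderiv_comp_apply (I := 𝓘(ℝ, ℝ × E)) (I' := 𝓘(ℝ, ℝ)) (I'' := 𝓡∂ 1) q (g := clock)
      (f := Prod.fst) (contMDiff_clock.contMDiffAt.mdifferentiableAt (by simp))
      differentiableAt_fst.mdifferentiableAt (show TangentSpace 𝓘(ℝ, ℝ × E) q from (s, u))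
    rw [mfderiv_eq_fderiv (f := Prod.fst), fderiv_fst] at this
    refine this.trans ?_
    rw [clockVel, ← map_smul]
    congr 1
    change s = s • (1 : ℝ)
    simp
  have h4 : mfderiv 𝓘(ℝ, ℝ × E) 𝓘(ℝ, E) (fun q : ℝ × E ↦ (chartAt E p).symm q.2) q
      (show TangentSpace 𝓘(ℝ, ℝ × E) q from (s, u)) =
      mfderiv 𝓘(ℝ, E) 𝓘(ℝ, E) (chartAt E p).symm q.2 u := by
    have := mfderiv_comp_apply (I := 𝓘(ℝ, ℝ × E)) (I' := 𝓘(ℝ, E)) (I'' := 𝓘(ℝ, E)) q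
      (g := (chartAt E p).symm)
      (f := Prod.snd) ((contMDiffAt_chart_symm hq).mdifferentiableAt (by simp))
      differentiableAt_snd.mdifferentiableAt (show TangentSpace 𝓘(ℝ, ℝ × E) q from (s, u))
    rw [mfderiv_eq_fderiv (f := Prod.snd), fderiv_snd] at this
    exact this
  have h5 := mfderiv_comp_apply (I := 𝓘(ℝ, ℝ × E)) (I' := (𝓡∂ 1).prod 𝓘(ℝ, E))
    (I'' := 𝓘(ℝ, G)) q (g := g) (f := clockPt p) hg
    ((contMDiffAt_clockPt hq).mdifferentiableAt (by simp))
    (show TangentSpace 𝓘(ℝ, ℝ × E) q from (s, u))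
  rw [mfderiv_eq_fderiv] at h5
  have h6 : mfderiv 𝓘(ℝ, ℝ × E) ((𝓡∂ 1).prod 𝓘(ℝ, E)) (clockPt p) q
      (show TangentSpace 𝓘(ℝ, ℝ × E) q from (s, u)) =
      (s • clockVel q.1, mfderiv 𝓘(ℝ, E) 𝓘(ℝ, E) (chartAt E p).symm q.2 u) := by
    refine (congrArg (fun L ↦ L (show TangentSpace 𝓘(ℝ, ℝ × E) q from (s, u)))
      (mfderiv_prodMk h1 h2)).trans ?_
    exact Prod.ext h3 h4
  rw [h6] at h5
  exact h5

end Homotopy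

/-! ### Homotopies in coordinates -/

section Homotopy

variable {E : Type*} [NormedAddCommGroup E] [NormedSpace ℝ E] [FiniteDimensional ℝ E]
  {M : Type*} [TopologicalSpace M] [T2Space M] [ChartedSpace E M] [IsManifold 𝓘(ℝ, E) ∞ M]
  {F : Type*} [NormedAddCommGroup F] [NormedSpace ℝ F] [FiniteDimensional ℝ F]
  {A : M → Type*} [TopologicalSpace (TotalSpace F A)] [∀ x, TopologicalSpace (A x)]
  [∀ x, AddCommGroup (A x)] [∀ x, Module ℝ (A x)]
  [FiberBundle F A] [VectorBundle ℝ F A] [ContMDiffVectorBundle ∞ F A 𝓘(ℝ, E)]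

/-- The tangent spaces of the unit interval. -/
abbrev IccTangent : Icc (0 : ℝ) 1 → Type := TangentSpace (𝓡∂ 1)

/-- `ϱ` is a morphism of Lie algebroids from `T[0,1] × A|_U` to `A|_U`. -/
abbrev IsHomotopy (𝒜 : LieAlgebroid 𝓘(ℝ, E) F A) (U : TopologicalSpace.Opens M)
    (ϱ : BundleMap (ExtProd IccTangent A) A) : Prop :=
  IsLieMorphism (EuclideanSpace ℝ (Fin 1) × F) F
    ((tangentAlgebroid (𝓡∂ 1) (Icc (0 : ℝ) 1)).prod (EuclideanSpace ℝ (Fin 1)) F 𝒜.toLocal)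
    𝒜.toLocal ⟨{p | p.2 ∈ U}, U.isOpen.preimage continuous_snd⟩ U ϱ

variable {𝒜 : LieAlgebroid 𝓘(ℝ, E) F A} {U : TopologicalSpace.Opens M}
  (ϱ : BundleMap (ExtProd IccTangent A) A)

/-- The base map of the homotopy `ϱ` in coordinates. -/
def homBase (p : M) (q : ℝ × E) : E := chartAt E p (ϱ.base (clockPt p q))

/-- The inclusion of the first factor in a fibre of `T[0,1] × A`. -/
def timeIncl (z : Icc (0 : ℝ) 1 × M) : IccTangent z.1 →ₗ[ℝ] ExtProd IccTangent A z :=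
  LinearMap.inl ℝ (IccTangent z.1) (A z.2)

/-- The inclusion of the second factor in a fibre of `T[0,1] × A`. -/
def spaceIncl (z : Icc (0 : ℝ) 1 × M) : A z.2 →ₗ[ℝ] ExtProd IccTangent A z :=
  LinearMap.inr ℝ (IccTangent z.1) (A z.2)

theorem hom_pair {z : Icc (0 : ℝ) 1 × M} (L : ExtProd IccTangent A z →ₗ[ℝ] F)
    (u : IccTangent z.1) (a : A z.2) :
    L ((u, a) : IccTangent z.1 × A z.2) = L (timeIncl z u) + L (spaceIncl z a) :=
  Eq.trans (congrArg L (Prod.ext (add_zero u).symm (zero_add a).symm)) (map_add L _ _)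

/-- The restriction of the homotopy `ϱ` to `A`, in coordinates. -/
def homFibre (p : M) (q : ℝ × E) : F →L[ℝ] F :=
  LinearMap.toContinuousLinearMap ((toF F (A := A) p (ϱ.base (clockPt p q)) : _ →ₗ[ℝ] F) ∘ₗ
    ϱ.fibre (clockPt p q) ∘ₗ spaceIncl (clockPt p q) ∘ₗ
      (ofF F (A := A) p (clockPt p q).2 : F →ₗ[ℝ] A (clockPt p q).2))

/-- The image under the homotopy `ϱ` of the velocity of the clock, in coordinates. -/
def homTime (p : M) (q : ℝ × E) : F :=
  toF F p (ϱ.base (clockPt p q)) (ϱ.fibre (clockPt p q) (timeIncl (clockPt p q) (clockVel q.1)))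

variable (E F U) in
/-- The points at which the homotopy `ϱ` stays in the coordinate domain at `p`. -/
def homDom (p : M) : Set (ℝ × E) :=
  {q | q.2 ∈ coordDom (E := E) F A p ∧ (chartAt E p).symm q.2 ∈ U ∧
    ϱ.base (clockPt p q) ∈ chartDom (E := E) F A p}

variable {ϱ}

theorem isOpen_homDom (h : IsHomotopy 𝒜 U ϱ) (p : M) : IsOpen (homDom E F U ϱ p) := by
  have h1 : IsOpen {q : ℝ × E | q.2 ∈ coordDom (E := E) F A p ∧ (chartAt E p).symm q.2 ∈ U} := by
    have : IsOpen (coordDom F A p ∩ (chartAt E p).symm ⁻¹' U : Set E) := by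
      have := ((chartAt E p).isOpen_inter_preimage_symm U.isOpen).inter
        (isOpen_coordDom (F := F) (A := A) p)
      convert this using 1
      ext y
      simp only [mem_inter_iff, coordDom]
      tauto
    exact this.preimage continuous_snd
  have h2 : ContinuousOn (fun q ↦ ϱ.base (clockPt p q))
      {q : ℝ × E | q.2 ∈ coordDom (E := E) F A p ∧ (chartAt E p).symm q.2 ∈ U} := fun q hq ↦
    (ContinuousAt.comp (f := clockPt p) (g := ϱ.base) (x := q)
      (h.contMDiffAt_base (show clockPt p q ∈ _ from hq.2)).continuousAt
      (contMDiffAt_clockPt hq.1.1).continuousAt).continuousWithinAt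
  convert h2.isOpen_inter_preimage h1 (isOpen_chartDom (E := E) (F := F) (A := A) p) using 1
  ext q
  simp only [homDom, mem_ofPred_eq, mem_inter_iff, mem_preimage, and_assoc]

/-- The image under the homotopy of a smooth family of vectors is smooth in coordinates. -/
theorem contDiffAt_hom (h : IsHomotopy 𝒜 U ϱ) {p : M} {q : ℝ × E}
    (hq : q ∈ homDom E F U ϱ p) {s : Π q : ℝ × E, ExtProd IccTangent A (clockPt p q)}
    (hs : ContMDiffAt 𝓘(ℝ, ℝ × E) (((𝓡∂ 1).prod 𝓘(ℝ, E)).prod 𝓘(ℝ, EuclideanSpace ℝ (Fin 1) × F))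
      ∞ (fun q ↦ TotalSpace.mk' (EuclideanSpace ℝ (Fin 1) × F) (clockPt p q) (s q)) q) :
    ContDiffAt ℝ ∞ (fun q ↦ toF F p (ϱ.base (clockPt p q)) (ϱ.fibre (clockPt p q) (s q))) q := by
  have hW : IsOpen {z : TotalSpace (EuclideanSpace ℝ (Fin 1) × F) (ExtProd IccTangent A) |
      z.1.2 ∈ U} := (U.isOpen.preimage continuous_snd).preimage
        (FiberBundle.continuous_proj (EuclideanSpace ℝ (Fin 1) × F) (ExtProd IccTangent A))
  have h1 := ContMDiffAt.comp q (h.smooth.contMDiffAt (hW.mem_nhds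
    (show (TotalSpace.mk' (EuclideanSpace ℝ (Fin 1) × F) (clockPt p q) (s q)).1.2 ∈ U
      from hq.2.1))) hs
  have h2 := (((trivializationAt F A p).contMDiffAt_iff (by
    rw [Trivialization.mem_source]; exact hq.2.2.2)).1 h1).2
  refine h2.contDiffAt.congr_of_eventuallyEq ?_
  filter_upwards [(isOpen_homDom h p).mem_nhds hq] with q hq
  rw [toF_eq_trivializationAt hq.2.2]
  rfl

theorem contDiffAt_homTime (h : IsHomotopy 𝒜 U ϱ) {p : M} {q : ℝ × E}
    (hq : q ∈ homDom E F U ϱ p) : ContDiffAt ℝ ∞ (homTime (F := F) ϱ p) q := by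
  refine contDiffAt_hom h hq (s := fun q ↦ ((clockVel q.1, 0) :
    IccTangent (clockPt p q).1 × A (clockPt p q).2)) ?_
  refine (contMDiffAt_extProd_iff (A := IccTangent) (B := A) (g := clockPt p)
    (s := fun q ↦ ((clockVel q.1, 0) :
      IccTangent (clockPt p q).1 × A (clockPt p q).2))).2 ⟨?_, ?_⟩
  · exact ContMDiffAt.comp (f := fun q : ℝ × E ↦ q.1) (I' := 𝓘(ℝ, ℝ)) q
      contMDiff_clockVel.contMDiffAt contDiffAt_fst.contMDiffAt
  · have h0 : ContMDiffAt 𝓘(ℝ, E) (𝓘(ℝ, E).prod 𝓘(ℝ, F)) ∞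
      (fun x ↦ TotalSpace.mk' F x (0 : A x)) (clockPt p q).2 := contMDiffAt_zeroSection ℝ A
    exact ContMDiffAt.comp (f := fun q : ℝ × E ↦ (clockPt p q).2) q h0
      (contMDiffAt_clockPt hq.1.1).snd

theorem contMDiffAt_spaceSection {p : M} {q : ℝ × E} (hq : q.2 ∈ coordDom (E := E) F A p) (a : F) :
    ContMDiffAt 𝓘(ℝ, ℝ × E)
      (((𝓡∂ 1).prod 𝓘(ℝ, E)).prod 𝓘(ℝ, EuclideanSpace ℝ (Fin 1) × F)) ∞
      (fun q ↦ TotalSpace.mk' (EuclideanSpace ℝ (Fin 1) × F) (E := ExtProd IccTangent A)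
        (clockPt p q) (spaceIncl (clockPt p q) (ofF F (A := A) p (clockPt p q).2 a))) q := by
  refine (contMDiffAt_extProd_iff (A := IccTangent) (B := A) (g := clockPt p)
    (s := fun q ↦ spaceIncl (clockPt p q) (ofF F (A := A) p (clockPt p q).2 a))).2 ⟨?_, ?_⟩
  · have h0 : ContMDiffAt (𝓡∂ 1) ((𝓡∂ 1).prod 𝓘(ℝ, EuclideanSpace ℝ (Fin 1))) ∞
      (fun x ↦ TotalSpace.mk' (EuclideanSpace ℝ (Fin 1)) x (0 : IccTangent x)) (clockPt p q).1 :=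
      contMDiffAt_zeroSection ℝ IccTangent
    exact ContMDiffAt.comp (f := fun q : ℝ × E ↦ (clockPt p q).1) q h0
      (contMDiffAt_clockPt hq.1).fst
  · exact ContMDiffAt.comp (f := fun q : ℝ × E ↦ (clockPt p q).2) q
      (contMDiffAt_secOf (symm_mem_chartDom hq) (S := fun _ : E ↦ a) contDiffAt_const)
      (contMDiffAt_clockPt hq.1).snd

theorem contDiffAt_homFibre_apply (h : IsHomotopy 𝒜 U ϱ) {p : M} {q : ℝ × E}
    (hq : q ∈ homDom E F U ϱ p) (a : F) : ContDiffAt ℝ ∞ (fun q ↦ homFibre ϱ p q a) q :=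
  contDiffAt_hom h hq (s := fun q ↦ spaceIncl (clockPt p q) (ofF F (A := A) p (clockPt p q).2 a))
    (contMDiffAt_spaceSection hq.1 a)

theorem contDiffOn_homFibre (h : IsHomotopy 𝒜 U ϱ) (p : M) :
    ContDiffOn ℝ ∞ (homFibre (F := F) ϱ p) (homDom E F U ϱ p) :=
  contDiffOn_clm_apply.2 fun a _ hq ↦ (contDiffAt_homFibre_apply h hq a).contDiffWithinAt

theorem contDiffAt_homBase (h : IsHomotopy 𝒜 U ϱ) {p : M} {q : ℝ × E}
    (hq : q ∈ homDom E F U ϱ p) : ContDiffAt ℝ ∞ (homBase ϱ p) q :=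
  (ContMDiffAt.comp (f := fun q ↦ ϱ.base (clockPt p q)) q (contMDiffAt_chart hq.2.2.1)
    (ContMDiffAt.comp (f := clockPt p) q (h.contMDiffAt_base (show clockPt p q ∈ _ from hq.2.1))
      (contMDiffAt_clockPt hq.1.1))).contDiffAt

variable (𝒜) in
/-- The chart maps `coordAnchor` back to the anchor. -/
theorem mfderiv_chart_symm_coordAnchor {p : M} {y : E} (hy : y ∈ coordDom (E := E) F A p) (a : F) :
    mfderiv 𝓘(ℝ, E) 𝓘(ℝ, E) (chartAt E p).symm y (coordAnchor 𝒜 p y a) =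
      𝒜.anchor _ (ofF F p ((chartAt E p).symm y) a) := by
  have hx := symm_mem_chartDom hy
  have h2 := coordAnchor_apply 𝒜 hx (ofF F p ((chartAt E p).symm y) a)
  have h3 := mfderiv_chart_symm_chartDeriv hx.1 (𝒜.anchor _ (ofF F p ((chartAt E p).symm y) a))
  rw [← h2, toF_ofF hx, (chartAt E p).right_inv hy.1] at h3
  exact h3

/-- Compatibility of the homotopy with the anchors, in the time direction and along `A`. -/
theorem fderiv_homBase (h : IsHomotopy 𝒜 U ϱ) {p : M} {q : ℝ × E}
    (hq : q ∈ homDom E F U ϱ p) (s : ℝ) (a : F) :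
    fderiv ℝ (homBase ϱ p) q (s, coordAnchor 𝒜 p q.2 a) =
      coordAnchor 𝒜 p (homBase ϱ p q)
        (s • homTime (F := F) ϱ p q + homFibre (F := F) ϱ p q a) := by
  have hx := symm_mem_chartDom hq.1
  have hb := (h.contMDiffAt_base (show clockPt p q ∈ _ from hq.2.1)).mdifferentiableAt (by simp)
  have h1 := fderiv_comp_clockPt (g := chartAt E p ∘ ϱ.base) hq.1.1
    (((contMDiffAt_chart hq.2.2.1).mdifferentiableAt (by simp)).comp (I' := 𝓘(ℝ, E)) _ hb)
    s (coordAnchor 𝒜 p q.2 a)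
  refine h1.trans ?_
  have h2 := mfderiv_chart_symm_coordAnchor 𝒜 hq.1 a
  have h3 := mfderiv_comp_apply (clockPt p q)
    ((contMDiffAt_chart hq.2.2.1).mdifferentiableAt (by simp)) hb
    (s • clockVel q.1, mfderiv 𝓘(ℝ, E) 𝓘(ℝ, E) (chartAt E p).symm q.2 (coordAnchor 𝒜 p q.2 a))
  refine h3.trans ?_
  have h4 := h.mfderiv_base_anchor (show clockPt p q ∈ _ from hq.2.1)
    ((s • clockVel q.1, ofF F p (clockPt p q).2 a) :
      IccTangent (clockPt p q).1 × A (clockPt p q).2)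
  have h5 : mfderiv ((𝓡∂ 1).prod 𝓘(ℝ, E)) 𝓘(ℝ, E) ϱ.base (clockPt p q)
      (s • clockVel q.1, mfderiv 𝓘(ℝ, E) 𝓘(ℝ, E) (chartAt E p).symm q.2
        (coordAnchor 𝒜 p q.2 a)) = 𝒜.anchor (ϱ.base (clockPt p q)) (ϱ.fibre (clockPt p q)
      ((s • clockVel q.1, ofF F p (clockPt p q).2 a) :
      IccTangent (clockPt p q).1 × A (clockPt p q).2)) := by
    rw [← h4]
    exact congrArg _ (Prod.ext rfl h2)
  rw [h5]
  refine (coordAnchor_apply 𝒜 hq.2.2 _).symm.trans ?_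
  change coordAnchor 𝒜 p (homBase ϱ p q) _ = _
  congr 1
  refine (hom_pair ((toF F (A := A) p (ϱ.base (clockPt p q)) : _ →ₗ[ℝ] F) ∘ₗ
    ϱ.fibre (clockPt p q)) (s • clockVel q.1) (ofF F (A := A) p (clockPt p q).2 a)).trans ?_
  congr 1
  exact map_smul ((toF F (A := A) p (ϱ.base (clockPt p q)) : _ →ₗ[ℝ] F) ∘ₗ
    ϱ.fibre (clockPt p q) ∘ₗ timeIncl (clockPt p q)) s (clockVel q.1)

/-- A tangent vector of the unit interval extends to a smooth vector field nearby. -/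
theorem exists_smoothSectionOn_eq {t : Icc (0 : ℝ) 1} (v : IccTangent t) :
    ∃ (V : Π t, IccTangent t) (O : Set (Icc (0 : ℝ) 1)), IsOpen O ∧ t ∈ O ∧
      SmoothSectionOn (𝓡∂ 1) (EuclideanSpace ℝ (Fin 1)) IccTangent O V ∧ V t = v := by
  let e := trivializationAt (EuclideanSpace ℝ (Fin 1)) IccTangent t
  have ht : t ∈ e.baseSet := mem_baseSet_trivializationAt _ _ _
  refine ⟨fun t' ↦ e.symm t' (e ⟨t, v⟩).2, e.baseSet, e.open_baseSet, ht, ?_, ?_⟩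
  · refine (e.contMDiffOn_section_baseSet_iff).2 ?_
    refine (contMDiffOn_const (c := (e ⟨t, v⟩).2)).congr fun t' ht' ↦ ?_
    rw [e.apply_mk_symm ht']
  · exact e.symm_apply_apply_mk ht v

theorem fderiv_hom_section (h : IsHomotopy 𝒜 U ϱ) {p : M} {q : ℝ × E}
    (hq : q ∈ homDom E F U ϱ p) {σ : Π z, ExtProd IccTangent A z}
    (hσ : ContMDiffAt ((𝓡∂ 1).prod 𝓘(ℝ, E))
      (((𝓡∂ 1).prod 𝓘(ℝ, E)).prod 𝓘(ℝ, EuclideanSpace ℝ (Fin 1) × F)) ∞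
      (fun z ↦ TotalSpace.mk' (EuclideanSpace ℝ (Fin 1) × F) z (σ z)) (clockPt p q))
    (s : ℝ) (a : F) :
    fderiv ℝ (fun q ↦ toF F p (ϱ.base (clockPt p q)) (ϱ.fibre (clockPt p q) (σ (clockPt p q)))) q
        (s, coordAnchor 𝒜 p q.2 a) =
      (show F from mfderiv ((𝓡∂ 1).prod 𝓘(ℝ, E)) 𝓘(ℝ, F)
        (fun z ↦ toF F p (ϱ.base z) (ϱ.fibre z (σ z))) (clockPt p q)
        (s • clockVel q.1, 𝒜.anchor _ (ofF F p ((chartAt E p).symm q.2) a))) := by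
  rw [← mfderiv_chart_symm_coordAnchor 𝒜 hq.1]
  exact fderiv_comp_clockPt hq.1.1 ((h.contMDiffAt_toF_apply (show clockPt p q ∈ _ from hq.2.1)
    hq.2.2 hσ).mdifferentiableAt (by simp)) s _

theorem smoothSectionOn_timeIncl {O : Set (Icc (0 : ℝ) 1)} {V : Π t, IccTangent t}
    (hV : SmoothSectionOn (𝓡∂ 1) (EuclideanSpace ℝ (Fin 1)) IccTangent O V) (D : Set M) :
    SmoothSectionOn ((𝓡∂ 1).prod 𝓘(ℝ, E)) (EuclideanSpace ℝ (Fin 1) × F)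
      (ExtProd IccTangent A) (O ×ˢ D) (fun z ↦ timeIncl z (V z.1)) := by
  intro z hz
  refine (contMDiffWithinAt_extProd_iff (A := IccTangent) (B := A) (g := fun z ↦ z)
    (s := fun z ↦ timeIncl z (V z.1))).2 ⟨?_, ?_⟩
  · exact ContMDiffWithinAt.comp (f := fun z : Icc (0 : ℝ) 1 × M ↦ z.1) z (hV z.1 hz.1)
      contMDiffWithinAt_fst (fun z hz ↦ hz.1)
  · have h0 : ContMDiffAt 𝓘(ℝ, E) (𝓘(ℝ, E).prod 𝓘(ℝ, F)) ∞
      (fun x ↦ TotalSpace.mk' F x (0 : A x)) z.2 := contMDiffAt_zeroSection ℝ A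
    exact (ContMDiffAt.comp (f := fun z : Icc (0 : ℝ) 1 × M ↦ z.2) z h0
      contMDiffAt_snd).contMDiffWithinAt

theorem smoothSectionOn_spaceIncl {D : Set M} {σ : Π x, A x}
    (hσ : SmoothSectionOn 𝓘(ℝ, E) F A D σ) (O : Set (Icc (0 : ℝ) 1)) :
    SmoothSectionOn ((𝓡∂ 1).prod 𝓘(ℝ, E)) (EuclideanSpace ℝ (Fin 1) × F)
      (ExtProd IccTangent A) (O ×ˢ D) (fun z ↦ spaceIncl z (σ z.2)) := by
  intro z hz
  refine (contMDiffWithinAt_extProd_iff (A := IccTangent) (B := A) (g := fun z ↦ z)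
    (s := fun z ↦ spaceIncl z (σ z.2))).2 ⟨?_, ?_⟩
  · have h0 : ContMDiffAt (𝓡∂ 1) ((𝓡∂ 1).prod 𝓘(ℝ, EuclideanSpace ℝ (Fin 1))) ∞
      (fun x ↦ TotalSpace.mk' (EuclideanSpace ℝ (Fin 1)) x (0 : IccTangent x)) z.1 :=
      contMDiffAt_zeroSection ℝ IccTangent
    exact (ContMDiffAt.comp (f := fun z : Icc (0 : ℝ) 1 × M ↦ z.1) z h0
      contMDiffAt_fst).contMDiffWithinAt
  · exact ContMDiffWithinAt.comp (f := fun z : Icc (0 : ℝ) 1 × M ↦ z.2) z (hσ z.2 hz.2)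
      contMDiffWithinAt_snd (fun z hz ↦ hz.2)

theorem prod_bracket_timeIncl_spaceIncl (V : Π t, IccTangent t) {σ : Π x, A x}
    (z : Icc (0 : ℝ) 1 × M) (hσ : HasExtension (E := E) F σ z.2) :
    ((tangentAlgebroid (𝓡∂ 1) (Icc (0 : ℝ) 1)).prod (EuclideanSpace ℝ (Fin 1)) F
      𝒜.toLocal).bracket (fun z ↦ timeIncl z (V z.1)) (fun z ↦ spaceIncl z (σ z.2)) z = 0 := by
  refine Prod.ext ?_ ?_
  · change VectorField.mlieBracket (𝓡∂ 1) V 0 z.1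
      + fibreDeriv 𝓘(ℝ, E) (EuclideanSpace ℝ (Fin 1)) IccTangent z.1 (fun y : M ↦ 0) z.2 _
      - fibreDeriv 𝓘(ℝ, E) (EuclideanSpace ℝ (Fin 1)) IccTangent z.1 (fun y : M ↦ V z.1) z.2 _ = 0
    rw [VectorField.mlieBracket_zero_right, fibreDeriv_const, fibreDeriv_const]
    simp
  · change 𝒜.toLocal.bracket (fun x ↦ (0 : A x)) σ z.2
      + fibreDeriv (𝓡∂ 1) F A z.2 (fun t : Icc (0 : ℝ) 1 ↦ σ z.2) z.1 _
      - fibreDeriv (𝓡∂ 1) F A z.2 (fun t : Icc (0 : ℝ) 1 ↦ 0) z.1 _ = 0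
    rw [toLocal_bracket_zero_left hσ, fibreDeriv_const, fibreDeriv_const]
    simp

theorem prod_bracket_spaceIncl (σ τ : Π x, A x) (z : Icc (0 : ℝ) 1 × M) :
    ((tangentAlgebroid (𝓡∂ 1) (Icc (0 : ℝ) 1)).prod (EuclideanSpace ℝ (Fin 1)) F
      𝒜.toLocal).bracket (fun z ↦ spaceIncl z (σ z.2)) (fun z ↦ spaceIncl z (τ z.2)) z =
      spaceIncl z (𝒜.toLocal.bracket σ τ z.2) := by
  refine Prod.ext ?_ ?_
  · change VectorField.mlieBracket (𝓡∂ 1) 0 0 z.1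
      + fibreDeriv 𝓘(ℝ, E) (EuclideanSpace ℝ (Fin 1)) IccTangent z.1 (fun y : M ↦ 0) z.2 _
      - fibreDeriv 𝓘(ℝ, E) (EuclideanSpace ℝ (Fin 1)) IccTangent z.1 (fun y : M ↦ 0) z.2 _ = 0
    rw [VectorField.mlieBracket_zero_right, fibreDeriv_const, fibreDeriv_const]
    simp
  · change 𝒜.toLocal.bracket σ τ z.2
      + fibreDeriv (𝓡∂ 1) F A z.2 (fun t : Icc (0 : ℝ) 1 ↦ τ z.2) z.1 _
      - fibreDeriv (𝓡∂ 1) F A z.2 (fun t : Icc (0 : ℝ) 1 ↦ σ z.2) z.1 _ =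
        𝒜.toLocal.bracket σ τ z.2
    rw [fibreDeriv_const, fibreDeriv_const]
    simp

theorem fderiv_homFibre_apply (h : IsHomotopy 𝒜 U ϱ) {p : M} {q : ℝ × E}
    (hq : q ∈ homDom E F U ϱ p) (a : F) (u : ℝ × E) :
    fderiv ℝ (fun q ↦ homFibre ϱ p q a) q u = fderiv ℝ (homFibre ϱ p) q u a := by
  have := ((contDiffOn_homFibre h p).contDiffAt
    ((isOpen_homDom h p).mem_nhds hq)).differentiableAt (by simp)
  rw [fderiv_clm_apply this (differentiableAt_const a)]
  simp

/-- Compatibility of the homotopy with the bracket of a vector field in the time direction and a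
section of `A`, which commute in the product algebroid. -/
theorem homotopy_bracket_time (h : IsHomotopy 𝒜 U ϱ) {p : M} {q : ℝ × E}
    (hq : q ∈ homDom E F U ϱ p) (a : F) :
    fderiv ℝ (homFibre ϱ p) q (1, 0) a = sndDeriv (homTime (F := F) ϱ p) q (coordAnchor 𝒜 p q.2 a)
      - coordBracket 𝒜 p (homBase ϱ p q) (homTime (F := F) ϱ p q) (homFibre ϱ p q a) := by
  have hx := symm_mem_chartDom hq.1
  -- The bracket condition concerns vector fields on `[0,1]`; any extension `V` of the velocity of
  -- the clock at the time `q.1` will do.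
  obtain ⟨V, O, hO, htO, hV, hVt⟩ := exists_smoothSectionOn_eq (clockVel q.1)
  let σ : Π z, ExtProd IccTangent A z := fun z ↦ timeIncl z (V z.1)
  let τ : Π z, ExtProd IccTangent A z := fun z ↦ spaceIncl z (secOf F A p (fun _ : E ↦ a) z.2)
  have hD : IsOpen (O ×ˢ chartDom (E := E) F A p) := hO.prod (isOpen_chartDom p)
  have hqD : clockPt p q ∈ O ×ˢ chartDom (E := E) F A p := ⟨htO, hx⟩
  have hσ : SmoothSectionOn ((𝓡∂ 1).prod 𝓘(ℝ, E)) (EuclideanSpace ℝ (Fin 1) × F)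
      (ExtProd IccTangent A) (O ×ˢ chartDom (E := E) F A p) σ := smoothSectionOn_timeIncl hV _
  have hτ : SmoothSectionOn ((𝓡∂ 1).prod 𝓘(ℝ, E)) (EuclideanSpace ℝ (Fin 1) × F)
      (ExtProd IccTangent A) (O ×ˢ chartDom (E := E) F A p) τ :=
    smoothSectionOn_spaceIncl (smoothSectionOn_secOf contDiffOn_const) _
  have key := h.toF_bracket (show clockPt p q ∈ _ from hq.2.1) hq.2.2 hD hqD hσ hτ
  have h0 : ((tangentAlgebroid (𝓡∂ 1) (Icc (0 : ℝ) 1)).prod (EuclideanSpace ℝ (Fin 1)) F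
      𝒜.toLocal).bracket σ τ (clockPt p q) = 0 :=
    prod_bracket_timeIncl_spaceIncl V (clockPt p q) (hasExtension_const hx a)
  rw [h0, map_zero, map_zero] at key
  have e1 : sndDeriv (homTime (F := F) ϱ p) q (coordAnchor 𝒜 p q.2 a) =
      (show F from mfderiv ((𝓡∂ 1).prod 𝓘(ℝ, E)) 𝓘(ℝ, F)
        (fun z ↦ toF F p (ϱ.base z) (ϱ.fibre z (σ z))) (clockPt p q)
        (((tangentAlgebroid (𝓡∂ 1) (Icc (0 : ℝ) 1)).prod (EuclideanSpace ℝ (Fin 1)) F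
          𝒜.toLocal).anchor (clockPt p q) (τ (clockPt p q)))) := by
    have e1 := fderiv_hom_section h hq (hσ.contMDiffAt (hD.mem_nhds hqD)) 0 a
    rw [zero_smul] at e1
    refine Eq.trans ?_ e1
    have hs := (h.contMDiffAt_toF_apply (show clockPt p q ∈ _ from hq.2.1)
      hq.2.2 (hσ.contMDiffAt (hD.mem_nhds hqD)))
    have h1 := (hasFDerivAt_slice (Y := fun q ↦ toF F p (ϱ.base (clockPt p q))
      (ϱ.fibre (clockPt p q) (σ (clockPt p q)))) (s := q.1) (z := q.2)
      ((ContMDiffAt.comp (f := clockPt p) q hs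
        (contMDiffAt_clockPt hq.1.1)).contDiffAt.differentiableAt (by simp))).fderiv
    have h2 := (hasFDerivAt_slice (Y := homTime (F := F) ϱ p) (s := q.1) (z := q.2)
      ((contDiffAt_homTime h hq).differentiableAt (by simp))).fderiv
    have h3 : (fun y : E ↦ toF F p (ϱ.base (clockPt p (q.1, y))) (ϱ.fibre (clockPt p (q.1, y))
        (σ (clockPt p (q.1, y))))) = fun y ↦ homTime (F := F) ϱ p (q.1, y) := by
      funext y
      exact congrArg (fun v ↦ toF F p (ϱ.base (clockPt p (q.1, y)))
        (ϱ.fibre (clockPt p (q.1, y)) (timeIncl (clockPt p (q.1, y)) v))) hVt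
    rw [h3] at h1
    exact congrArg (fun L ↦ L (coordAnchor 𝒜 p q.2 a)) (h2.symm.trans h1)
  have e2 : fderiv ℝ (homFibre ϱ p) q (1, 0) a =
      (show F from mfderiv ((𝓡∂ 1).prod 𝓘(ℝ, E)) 𝓘(ℝ, F)
        (fun z ↦ toF F p (ϱ.base z) (ϱ.fibre z (τ z))) (clockPt p q)
        (((tangentAlgebroid (𝓡∂ 1) (Icc (0 : ℝ) 1)).prod (EuclideanSpace ℝ (Fin 1)) F
          𝒜.toLocal).anchor (clockPt p q) (σ (clockPt p q)))) := by
    have e2 := fderiv_hom_section h hq (hτ.contMDiffAt (hD.mem_nhds hqD)) 1 0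
    rw [map_zero, map_zero, map_zero, one_smul, ← hVt] at e2
    refine Eq.trans ?_ (e2.trans ?_)
    · exact (fderiv_homFibre_apply h hq a _).symm
    · change _ = (show F from mfderiv ((𝓡∂ 1).prod 𝓘(ℝ, E)) 𝓘(ℝ, F)
        (fun z ↦ toF F p (ϱ.base z) (ϱ.fibre z (τ z))) (clockPt p q)
        (V (clock q.1), 𝒜.anchor _ 0))
      rw [map_zero]
      rfl
  rw [e1, e2]
  have e3 : toF F p (ϱ.base (clockPt p q)) (ϱ.fibre (clockPt p q) (σ (clockPt p q))) =
      homTime (F := F) ϱ p q :=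
    congrArg (fun v ↦ toF F p (ϱ.base (clockPt p q))
      (ϱ.fibre (clockPt p q) (timeIncl (clockPt p q) v))) hVt
  rw [e3] at key
  refine eq_sub_of_add_eq' ?_
  exact (sub_eq_zero.1 key.symm)

/-- Compatibility of the homotopy with the bracket of two sections of `A`. -/
theorem homotopy_bracket_space (h : IsHomotopy 𝒜 U ϱ) {p : M} {q : ℝ × E}
    (hq : q ∈ homDom E F U ϱ p) (a b : F) :
    sndDeriv (homFibre ϱ p) q (coordAnchor 𝒜 p q.2 a) b
      - sndDeriv (homFibre ϱ p) q (coordAnchor 𝒜 p q.2 b) a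
      + coordBracket 𝒜 p (homBase ϱ p q) (homFibre ϱ p q a) (homFibre ϱ p q b) =
    homFibre ϱ p q (coordBracket 𝒜 p q.2 a b) := by
  have hx := symm_mem_chartDom hq.1
  let σ : F → Π z, ExtProd IccTangent A z := fun a z ↦
    spaceIncl z (secOf F A p (fun _ : E ↦ a) z.2)
  have hD : IsOpen ((univ : Set (Icc (0 : ℝ) 1)) ×ˢ chartDom (E := E) F A p) :=
    isOpen_univ.prod (isOpen_chartDom p)
  have hqD : clockPt p q ∈ (univ : Set (Icc (0 : ℝ) 1)) ×ˢ chartDom (E := E) F A p :=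
    ⟨mem_univ _, hx⟩
  have hσ (a : F) : SmoothSectionOn ((𝓡∂ 1).prod 𝓘(ℝ, E)) (EuclideanSpace ℝ (Fin 1) × F)
      (ExtProd IccTangent A) (univ ×ˢ chartDom (E := E) F A p) (σ a) :=
    smoothSectionOn_spaceIncl (smoothSectionOn_secOf contDiffOn_const) _
  have key := h.toF_bracket (show clockPt p q ∈ _ from hq.2.1) hq.2.2 hD hqD (hσ a) (hσ b)
  have hd (a b : F) : sndDeriv (homFibre ϱ p) q (coordAnchor 𝒜 p q.2 a) b =
      (show F from mfderiv ((𝓡∂ 1).prod 𝓘(ℝ, E)) 𝓘(ℝ, F)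
        (fun z ↦ toF F p (ϱ.base z) (ϱ.fibre z (σ b z))) (clockPt p q)
        (((tangentAlgebroid (𝓡∂ 1) (Icc (0 : ℝ) 1)).prod (EuclideanSpace ℝ (Fin 1)) F
          𝒜.toLocal).anchor (clockPt p q) (σ a (clockPt p q)))) := by
    have e1 := fderiv_hom_section h hq ((hσ b).contMDiffAt (hD.mem_nhds hqD)) 0 a
    rw [zero_smul] at e1
    exact ((fderiv_homFibre_apply h hq b _).symm).trans e1
  have h0 := prod_bracket_spaceIncl (F := F) (𝒜 := 𝒜) (secOf F A p (fun _ : E ↦ a))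
    (secOf F A p (fun _ : E ↦ b)) (clockPt p q)
  have h1 : toF F p (ϱ.base (clockPt p q)) (ϱ.fibre (clockPt p q)
      (((tangentAlgebroid (𝓡∂ 1) (Icc (0 : ℝ) 1)).prod (EuclideanSpace ℝ (Fin 1)) F
      𝒜.toLocal).bracket (σ a) (σ b) (clockPt p q))) =
      homFibre ϱ p q (coordBracket 𝒜 p q.2 a b) := by
    rw [coordBracket_symm_apply 𝒜 hq.1]
    refine congrArg (fun v ↦ toF F p (ϱ.base (clockPt p q)) (ϱ.fibre (clockPt p q) v)) ?_
    refine h0.trans (congrArg (spaceIncl (clockPt p q)) ?_)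
    exact (ofF_toF hx _).symm
  rw [hd a b, hd b a, ← h1, key, add_sub_assoc, add_comm]
  rfl

/-- In coordinates, and reparametrized by the clock, a morphism from `T[0,1] × A|_U` to `A|_U`
satisfies the structure equations of a homotopy. -/
theorem locHomotopy (h : IsHomotopy 𝒜 U ϱ) (p : M) :
    LocHomotopy (coordDom F A p) (coordAnchor 𝒜 p) (coordBracket 𝒜 p) (homDom E F U ϱ p)
      (homBase ϱ p) (homFibre ϱ p) (homTime ϱ p) where
  isOpen := isOpen_homDom h p
  mem q hq := map_mem_coordDom hq.2.2
  smooth_base q hq := (contDiffAt_homBase h hq).contDiffWithinAt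
  smooth_fibre := contDiffOn_homFibre h p
  smooth_time q hq := (contDiffAt_homTime h hq).contDiffWithinAt
  anchor_time q hq := by simpa using fderiv_homBase h hq 1 0
  anchor_space q hq a := by simpa [sndDeriv] using fderiv_homBase h hq 0 a
  bracket_time q hq a := homotopy_bracket_time h hq a
  bracket_space q hq a b := homotopy_bracket_space h hq a b

end Homotopy

/-! ### Flow lines in the total space -/

section Uniqueness

variable {Z : Type*} [NormedAddCommGroup Z] [NormedSpace ℝ Z]

/-- Local uniqueness for solutions of a differential equation with continuously differentiable right
hand side. -/
theorem eventually_eq_of_hasDerivAt {X : ℝ × Z → Z} {h h' : ℝ → Z} {t : ℝ}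
    (hX : ContDiffAt ℝ 1 X (t, h t)) (hh : ∀ᶠ s in 𝓝 t, HasDerivAt h (X (s, h s)) s)
    (hh' : ∀ᶠ s in 𝓝 t, HasDerivAt h' (X (s, h' s)) s) (heq : h t = h' t) :
    ∀ᶠ s in 𝓝 t, h s = h' s := by
  obtain ⟨K, D, hD, hL⟩ := hX.exists_lipschitzOnWith
  obtain ⟨T, hT, S, hS, hTS⟩ := mem_nhds_prod_iff.1 hD
  have c1 : ∀ᶠ s in 𝓝 t, h s ∈ S := hh.self_of_nhds.continuousAt.eventually hS
  have c2 : ∀ᶠ s in 𝓝 t, h' s ∈ S :=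
    hh'.self_of_nhds.continuousAt.eventually (by rw [← heq]; exact hS)
  refine ODE_solution_unique_of_eventually (v := fun s z ↦ X (s, z)) (s := fun _ ↦ S) (K := K)
    ?_ (hh.and c1) (hh'.and c2) heq
  filter_upwards [hT] with s hs x hx y hy
  have := hL (x := (s, x)) (hTS ⟨hs, hx⟩) (y := (s, y)) (hTS ⟨hs, hy⟩)
  simpa [Prod.edist_eq] using this

end Uniqueness

section FlowLines

variable {E : Type*} [NormedAddCommGroup E] [NormedSpace ℝ E] [FiniteDimensional ℝ E]
  {M : Type*} [TopologicalSpace M] [T2Space M] [ChartedSpace E M] [IsManifold 𝓘(ℝ, E) ∞ M]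
  {F : Type*} [NormedAddCommGroup F] [NormedSpace ℝ F] [FiniteDimensional ℝ F]
  {A : M → Type*} [TopologicalSpace (TotalSpace F A)] [∀ x, TopologicalSpace (A x)]
  [∀ x, AddCommGroup (A x)] [∀ x, Module ℝ (A x)]
  [FiberBundle F A] [VectorBundle ℝ F A] [ContMDiffVectorBundle ∞ F A 𝓘(ℝ, E)]
  (𝒜 : LieAlgebroid 𝓘(ℝ, E) F A)

/-- The time-dependent section `v` of `A` in the coordinates at `p`. -/
def coordSec (F : Type*) [NormedAddCommGroup F] [NormedSpace ℝ F]
    {A : M → Type*} [TopologicalSpace (TotalSpace F A)] [∀ x, TopologicalSpace (A x)]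
    [∀ x, AddCommGroup (A x)] [∀ x, Module ℝ (A x)] [FiberBundle F A] [VectorBundle ℝ F A]
    (v : ℝ → Π x, A x) (p : M) (q : ℝ × E) : F :=
  toF F p ((chartAt E p).symm q.2) (v q.1 ((chartAt E p).symm q.2))

variable {v : ℝ → Π x, A x} {p p' x : M}

theorem coordSec_chart (hx : x ∈ (chartAt E p).source) (t : ℝ) :
    coordSec F v p (t, chartAt E p x) = toF F p x (v t x) := by
  simp only [coordSec]
  rw [(chartAt E p).left_inv hx]

/-- The equation for the base curve of a flow line does not depend on the chart. -/
theorem hasDerivAt_chart_change (hx : x ∈ chartDom (E := E) F A p)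
    (hx' : x ∈ chartDom (E := E) F A p') {t : ℝ} {f : ℝ → E} (hft : f t = chartAt E p' x)
    (hf : HasDerivAt f (coordAnchor 𝒜 p' (f t) (coordSec F v p' (t, f t))) t) :
    HasDerivAt (fun s ↦ chartAt E p ((chartAt E p').symm (f s)))
      (coordAnchor 𝒜 p (chartAt E p x) (coordSec F v p (t, chartAt E p x))) t := by
  have h1 := (contMDiffAt_iff_chart (E := E) hx'.1).1 (contMDiffAt_chart (E := E) hx.1)
  have h2 := (h1.differentiableAt (by simp))
  have h3 := mfderiv_comp_chart hx'.1 h2 (𝒜.anchor x (v t x))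
  have e : (fun z ↦ chartAt E p ((chartAt E p').symm (chartAt E p' z))) =ᶠ[𝓝 x] chartAt E p := by
    filter_upwards [(chartAt E p').open_source.mem_nhds hx'.1] with z hz
    rw [(chartAt E p').left_inv hz]
  rw [e.mfderiv_eq] at h3
  have h4 := hasDerivAt_comp_of_hasFDerivAt (g := f) (by rw [hft]; exact h2.hasFDerivAt) hf
  refine h4.congr_deriv ?_
  rw [hft, coordSec_chart hx.1, coordSec_chart hx'.1, coordAnchor_apply 𝒜 hx,
    coordAnchor_apply 𝒜 hx']
  exact h3.symm

/-- The change of trivialization from `p'` to `p`, in the coordinates at `p`. -/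
def coordChange (F : Type*) [NormedAddCommGroup F] [NormedSpace ℝ F]
    (A : M → Type*) [TopologicalSpace (TotalSpace F A)] [∀ x, TopologicalSpace (A x)]
    [∀ x, AddCommGroup (A x)] [∀ x, Module ℝ (A x)] [FiberBundle F A] [VectorBundle ℝ F A]
    (p' p : M) (y : E) : F →L[ℝ] F :=
  (toF F (A := A) p ((chartAt E p).symm y)).comp (ofF F p' ((chartAt E p).symm y))

theorem contDiffAt_coordChange (hx : x ∈ chartDom (E := E) F A p)
    (hx' : x ∈ chartDom (E := E) F A p') :
    ContDiffAt ℝ ∞ (coordChange (E := E) F A p' p) (chartAt E p x) := by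
  have h : ContDiffOn ℝ ∞ (coordChange (E := E) F A p' p)
      (coordDom (E := E) F A p ∩ (chartAt E p).symm ⁻¹' chartDom (E := E) F A p') := by
    refine contDiffOn_clm_apply.2 fun a y hy ↦ ContDiffAt.contDiffWithinAt ?_
    have h1 := contMDiffAt_secOf (E := E) (A := A) hy.2 (S := fun _ : E ↦ a) contDiffAt_const
    have h2 := (contMDiffAt_section_iff_coord (symm_mem_chartDom hy.1)).1 h1
    rw [(chartAt E p).right_inv hy.1.1] at h2
    exact h2
  refine h.contDiffAt ?_
  filter_upwards [(isOpen_coordDom (F := F) (A := A) p).mem_nhds (map_mem_coordDom hx),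
    eventually_nhds_symm hx.1 ((isOpen_chartDom (E := E) (F := F) (A := A) p').mem_nhds hx')]
    with y h1 h2 using ⟨h1, h2⟩

/-- The operator `a ↦ [a, v]` transforms under a change of coordinates like a connection: the change
of trivialization contributes its derivative along the anchor of `v`. Both sides compute the bracket
of `v` with the section that is constant in the coordinates at `p'`. -/
theorem adj_coordChange (hx : x ∈ chartDom (E := E) F A p)
    (hx' : x ∈ chartDom (E := E) F A p') {t : ℝ}
    (hv : ∀ᶠ y in 𝓝 (chartAt E p x), ContDiffAt ℝ ∞ (fun y : E ↦ coordSec F v p (t, y)) y)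
    (hv' : ∀ᶠ y in 𝓝 (chartAt E p' x), ContDiffAt ℝ ∞ (fun y : E ↦ coordSec F v p' (t, y)) y)
    (a : F) :
    adj (coordAnchor 𝒜 p) (coordBracket 𝒜 p) (fun y : E ↦ coordSec F v p (t, y)) (chartAt E p x)
        (coordChange (E := E) F A p' p (chartAt E p x) a) =
      fderiv ℝ (coordChange (E := E) F A p' p) (chartAt E p x) (coordAnchor 𝒜 p (chartAt E p x)
        (coordSec F v p (t, chartAt E p x))) a
      + coordChange (E := E) F A p' p (chartAt E p x) (adj (coordAnchor 𝒜 p') (coordBracket 𝒜 p')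
          (fun y : E ↦ coordSec F v p' (t, y)) (chartAt E p' x) a) := by
  have hG := contDiffAt_coordChange (E := E) (F := F) (A := A) hx hx'
  have hG' : ∀ᶠ y in 𝓝 (chartAt E p x),
      ContDiffAt ℝ ∞ (fun y ↦ coordChange (E := E) F A p' p y a) y := by
    have := ((isOpen_chartDom (E := E) (F := F) (A := A) p).inter
      (isOpen_chartDom p')).mem_nhds ⟨hx, hx'⟩
    filter_upwards [eventually_nhds_symm hx.1 this, (chartAt E p).open_target.mem_nhds
      ((chartAt E p).map_source hx.1)] with y hy hy'
    have := contDiffAt_coordChange (E := E) (F := F) (A := A) hy.1 hy.2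
    rw [(chartAt E p).right_inv hy'] at this
    exact this.clm_apply contDiffAt_const
  have h1 := toF_bracket_secOf 𝒜 hx hv hG'
  have h2 := toF_bracket_secOf 𝒜 hx' hv'
    (Eventually.of_forall fun y ↦ contDiffAt_const (c := a))
  have h3 : 𝒜.toLocal.bracket (secOf F A p fun y : E ↦ coordSec F v p (t, y))
      (secOf F A p fun y ↦ coordChange (E := E) F A p' p y a) x =
      𝒜.toLocal.bracket (secOf F A p' fun y : E ↦ coordSec F v p' (t, y))
        (secOf F A p' fun _ : E ↦ a) x := by
    refine toLocal_bracket_congr (hasExtension_secOf hx' hv') (hasExtension_const hx' a) ?_ ?_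
    · filter_upwards [eventuallyEq_secOf (E := E) hx (v t), eventuallyEq_secOf (E := E) hx' (v t)]
        with z h h'
      exact h.trans h'.symm
    · exact eventuallyEq_secOf (E := E) hx (secOf F A p' fun _ : E ↦ a)
  rw [h3] at h1
  have h4 : ∀ b : A x, toF F p x b =
      coordChange (E := E) F A p' p (chartAt E p x) (toF F p' x b) := by
    intro b
    simp only [coordChange, ContinuousLinearMap.comp_apply]
    rw [(chartAt E p).left_inv hx.1, ofF_toF hx']
  rw [h4, h2] at h1
  rw [fderiv_clm_apply (hG.differentiableAt (by simp)) (differentiableAt_const a)] at h1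
  simp only [fderiv_fun_const, Pi.zero_apply, zero_apply, add_zero, ContinuousLinearMap.comp_zero,
    zero_add, ContinuousLinearMap.flip_apply] at h1
  simp only [adj, sub_apply, ContinuousLinearMap.comp_apply, map_sub] at h1 ⊢
  linear_combination (norm := module) h1

/-- The equation for the fibre component of a flow line does not depend on the coordinates. -/
theorem hasDerivAt_fibre_change (hx : x ∈ chartDom (E := E) F A p)
    (hx' : x ∈ chartDom (E := E) F A p') {t : ℝ} {f : ℝ → E} {g : ℝ → F}
    (hv : ∀ᶠ y in 𝓝 (chartAt E p x), ContDiffAt ℝ ∞ (fun y : E ↦ coordSec F v p (t, y)) y)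
    (hv' : ∀ᶠ y in 𝓝 (chartAt E p' x), ContDiffAt ℝ ∞ (fun y : E ↦ coordSec F v p' (t, y)) y)
    (hft : f t = chartAt E p' x)
    (hf : HasDerivAt f (coordAnchor 𝒜 p' (f t) (coordSec F v p' (t, f t))) t)
    (hg : HasDerivAt g (adj (coordAnchor 𝒜 p') (coordBracket 𝒜 p')
      (fun y : E ↦ coordSec F v p' (t, y)) (f t) (g t)) t) :
    HasDerivAt (fun s ↦ toF F p ((chartAt E p').symm (f s))
        (ofF F p' ((chartAt E p').symm (f s)) (g s) : A _))
      (adj (coordAnchor 𝒜 p) (coordBracket 𝒜 p) (fun y : E ↦ coordSec F v p (t, y)) (chartAt E p x)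
        (toF F p x (ofF F p' x (g t) : A x))) t := by
  have h1 := hasDerivAt_chart_change 𝒜 hx hx' hft hf
  have hxt : (chartAt E p').symm (f t) = x := by rw [hft, (chartAt E p').left_inv hx'.1]
  have hG := (contDiffAt_coordChange (E := E) (F := F) (A := A) hx hx').differentiableAt (by simp)
  have h2 := hasDerivAt_comp_of_hasFDerivAt (C := coordChange (E := E) F A p' p)
    (g := fun s ↦ chartAt E p ((chartAt E p').symm (f s))) (by rw [hxt]; exact hG.hasFDerivAt) h1
  have h3 := h2.clm_apply hg
  have e : (fun s ↦ toF F p ((chartAt E p').symm (f s))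
        (ofF F p' ((chartAt E p').symm (f s)) (g s) : A _)) =ᶠ[𝓝 t]
      fun s ↦ coordChange (E := E) F A p' p (chartAt E p ((chartAt E p').symm (f s))) (g s) := by
    have c : ∀ᶠ y in 𝓝 (f t), (chartAt E p').symm y ∈ (chartAt E p).source := by
      rw [hft]
      exact eventually_nhds_symm hx'.1 ((chartAt E p).open_source.mem_nhds hx.1)
    filter_upwards [hf.continuousAt.eventually c] with s hs
    simp only [coordChange, ContinuousLinearMap.comp_apply]
    rw [(chartAt E p).left_inv hs]
  refine (h3.congr_of_eventuallyEq e).congr_deriv ?_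
  have h4 := adj_coordChange 𝒜 hx hx' hv hv' (g t)
  rw [hxt, hft, ← h4]
  simp only [coordChange, ContinuousLinearMap.comp_apply]
  rw [(chartAt E p).left_inv hx.1]

/-- The time-dependent section `v` is smooth on the open set `W` of times and coordinates at `p`. -/
structure IsSmoothField (v : ℝ → Π x, A x) (W : Set (ℝ × E)) (p : M) : Prop where
  isOpen : IsOpen W
  mem : ∀ q ∈ W, q.2 ∈ coordDom (E := E) F A p
  smooth : ContDiffOn ℝ ∞ (coordSec F v p) W

theorem IsSmoothField.eventually_contDiffAt {W : Set (ℝ × E)} (h : IsSmoothField (F := F) v W p)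
    {t : ℝ} {y : E} (hy : (t, y) ∈ W) :
    ∀ᶠ y in 𝓝 y, ContDiffAt ℝ ∞ (fun y : E ↦ coordSec F v p (t, y)) y := by
  filter_upwards [(h.isOpen.preimage (show Continuous fun y : E ↦ (t, y) by fun_prop)).mem_nhds hy]
    with z hz using contDiffAt_slice h.isOpen h.smooth hz

/-- The curve with the coordinates `f` and `g` at `p` is, between the times `a` and `b`, a flow line
in the total space of `A` of the time-dependent section `v`. -/
structure IsFlowLine (v : ℝ → Π x, A x) (W : Set (ℝ × E)) (p : M) (a b : ℝ) (f : ℝ → E)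
    (g : ℝ → F) : Prop where
  mem : ∀ t ∈ Ioo a b, (t, f t) ∈ W
  base : ∀ t ∈ Ioo a b, HasDerivAt f (coordAnchor 𝒜 p (f t) (coordSec F v p (t, f t))) t
  fibre : ∀ t ∈ Ioo a b, HasDerivAt g (adj (coordAnchor 𝒜 p) (coordBracket 𝒜 p)
    (fun y ↦ coordSec F v p (t, y)) (f t) (g t)) t

/-- The point of the total space of `A` with coordinates `y` and `u` at `p`. -/
def coordPt (F : Type*) [NormedAddCommGroup F] [NormedSpace ℝ F]
    (A : M → Type*) [TopologicalSpace (TotalSpace F A)] [∀ x, TopologicalSpace (A x)]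
    [∀ x, AddCommGroup (A x)] [∀ x, Module ℝ (A x)] [FiberBundle F A] [VectorBundle ℝ F A]
    (p : M) (y : E) (u : F) : TotalSpace F A :=
  ⟨(chartAt E p).symm y, ofF F p ((chartAt E p).symm y) u⟩

/-- The coordinates at `p` of a point of the total space of `A`. -/
def ptCoord (E : Type*) [NormedAddCommGroup E] [NormedSpace ℝ E] [ChartedSpace E M]
    (p : M) (z : TotalSpace F A) : E × F := (chartAt E p z.1, toF F p z.1 z.2)

theorem ptCoord_coordPt {y : E} (hy : y ∈ coordDom F A p) (u : F) :
    ptCoord E p (coordPt F A p y u) = (y, u) :=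
  Prod.ext ((chartAt E p).right_inv hy.1) (toF_ofF (symm_mem_chartDom hy) u)

theorem coordPt_ptCoord {z : TotalSpace F A} (hz : z.1 ∈ chartDom (E := E) F A p) :
    coordPt F A p (ptCoord E p z).1 (ptCoord E p z).2 = z := by
  obtain ⟨x, a⟩ := z
  have h : ∀ x', x' = x → (⟨x', ofF F p x' (toF F p x a)⟩ : TotalSpace F A) = ⟨x, a⟩ := by
    rintro _ rfl
    rw [ofF_toF hz]
  exact h _ ((chartAt E p).left_inv hz.1)

variable {𝒜} {W W' : Set (ℝ × E)} {a b : ℝ} {f f' : ℝ → E} {g g' : ℝ → F}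

/-- The vector field on `E × F` whose integral curves are the flow lines, in the coordinates at `p`,
is continuously differentiable. -/
theorem contDiffAt_flowField (hW : IsSmoothField (F := F) v W p) {t : ℝ} {y : E}
    (hy : (t, y) ∈ W) (u : F) :
    ContDiffAt ℝ 1 (fun q : ℝ × (E × F) ↦
      (coordAnchor 𝒜 p q.2.1 (coordSec F v p (q.1, q.2.1)),
        adj (coordAnchor 𝒜 p) (coordBracket 𝒜 p) (fun y ↦ coordSec F v p (q.1, y)) q.2.1 q.2.2))
      (t, (y, u)) := by
  have h := locAlg 𝒜 p
  have hn := hW.isOpen.mem_nhds hy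
  have h0 : ContDiffAt ℝ ∞ (fun q : ℝ × (E × F) ↦ (q.1, q.2.1)) (t, (y, u)) := by fun_prop
  have h1 := ((h.smooth_anchor.comp contDiffOn_snd hW.mem).clm_apply hW.smooth).contDiffAt hn
  have h2 := (h.contDiffOn_adj hW.isOpen hW.mem hW.smooth).contDiffAt hn
  have h3 : ContDiffAt ℝ ∞ (fun q : ℝ × (E × F) ↦ q.2.2) (t, (y, u)) := by fun_prop
  have h4 := (ContDiffAt.comp (t, (y, u)) h1 h0).prodMk
    ((ContDiffAt.comp (t, (y, u)) h2 h0).clm_apply h3)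
  exact h4.of_le (by simp)

/-- Flow lines in different coordinates that meet at a time agree for nearby times. -/
theorem IsFlowLine.eventually_eq (hW : IsSmoothField (F := F) v W p)
    (hW' : IsSmoothField (F := F) v W' p')
    (h : IsFlowLine 𝒜 v W p a b f g) (h' : IsFlowLine 𝒜 v W' p' a b f' g') {t : ℝ}
    (ht : t ∈ Ioo a b) (heq : coordPt F A p (f t) (g t) = coordPt F A p' (f' t) (g' t)) :
    ∀ᶠ s in 𝓝 t, coordPt F A p (f s) (g s) = coordPt F A p' (f' s) (g' s) := by
  have hIoo : ∀ᶠ s in 𝓝 t, s ∈ Ioo a b := Ioo_mem_nhds ht.1 ht.2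
  have hft := hW.mem _ (h.mem t ht)
  have hft' := hW'.mem _ (h'.mem t ht)
  have hc' : ContinuousAt (fun s ↦ (chartAt E p').symm (f' s)) t :=
    ContinuousAt.comp (f := f') ((chartAt E p').continuousAt_symm hft'.1)
      (h'.base t ht).continuousAt
  have hx := symm_mem_chartDom hft
  have hxx : (chartAt E p).symm (f t) = (chartAt E p').symm (f' t) := congrArg TotalSpace.proj heq
  have hcp : ∀ᶠ s in 𝓝 t, (chartAt E p').symm (f' s) ∈ chartDom (E := E) F A p :=
    hc'.eventually ((isOpen_chartDom p).mem_nhds (by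
      change (chartAt E p').symm (f' t) ∈ _
      rw [← hxx]
      exact hx))
  have hfx : chartAt E p ((chartAt E p').symm (f' t)) = f t := by
    rw [← hxx, (chartAt E p).right_inv hft.1]
  have hcW : ∀ᶠ s in 𝓝 t, (s, chartAt E p ((chartAt E p').symm (f' s))) ∈ W := by
    have : ContinuousAt (fun s ↦ (s, chartAt E p ((chartAt E p').symm (f' s)))) t :=
      continuousAt_id.prodMk (ContinuousAt.comp (f := fun s ↦ (chartAt E p').symm (f' s))
        ((chartAt E p).continuousAt (hcp.self_of_nhds).1) hc')
    exact this.eventually (hW.isOpen.mem_nhds (by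
      change (t, chartAt E p ((chartAt E p').symm (f' t))) ∈ W
      rw [hfx]
      exact h.mem t ht))
  have key := eventually_eq_of_hasDerivAt (h := fun s ↦ (f s, g s))
    (h' := fun s ↦ ptCoord E p (coordPt F A p' (f' s) (g' s)))
    (contDiffAt_flowField (𝒜 := 𝒜) hW (h.mem t ht) (g t))
    (by filter_upwards [hIoo] with s hs using (h.base s hs).prodMk (h.fibre s hs))
    (by
      filter_upwards [hIoo, hcp, hcW] with s hs hx hsW
      have hfs' := hW'.mem _ (h'.mem s hs)
      have hx' := symm_mem_chartDom hfs'
      have hfs : f' s = chartAt E p' ((chartAt E p').symm (f' s)) :=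
        ((chartAt E p').right_inv hfs'.1).symm
      exact (hasDerivAt_chart_change 𝒜 hx hx' hfs (h'.base s hs)).prodMk
        (hasDerivAt_fibre_change 𝒜 hx hx' (hW.eventually_contDiffAt hsW)
          (hW'.eventually_contDiffAt (by rw [← hfs]; exact h'.mem s hs)) hfs (h'.base s hs)
          (h'.fibre s hs)))
    (by rw [← heq, ptCoord_coordPt hft])
  filter_upwards [key, hcp] with s h1 h2
  rw [← coordPt_ptCoord (p := p) (z := coordPt F A p' (f' s) (g' s)) h2, ← h1]

/-- Flow lines in different coordinates that meet at one time agree: the set of times at which they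
agree nearby is open, and closed by the Hausdorff property. -/
theorem IsFlowLine.eqOn (hW : IsSmoothField (F := F) v W p) (hW' : IsSmoothField (F := F) v W' p')
    (h : IsFlowLine 𝒜 v W p a b f g) (h' : IsFlowLine 𝒜 v W' p' a b f' g') {t₀ : ℝ}
    (ht₀ : t₀ ∈ Ioo a b) (heq : coordPt F A p (f t₀) (g t₀) = coordPt F A p' (f' t₀) (g' t₀))
    {t : ℝ} (ht : t ∈ Ioo a b) :
    coordPt F A p (f t) (g t) = coordPt F A p' (f' t) (g' t) := by
  let u : Set ℝ := {t | ∀ᶠ s in 𝓝 t, coordPt F A p (f s) (g s) = coordPt F A p' (f' s) (g' s)}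
  have hu : IsOpen u := isOpen_iff_mem_nhds.2 fun t ht ↦ eventually_eventually_nhds.2 ht
  have hsub : Ioo a b ⊆ u := by
    refine isPreconnected_Ioo.subset_of_closure_inter_subset hu
      ⟨t₀, ht₀, h.eventually_eq hW hW' h' ht₀ heq⟩ ?_
    rintro t ⟨htu, ht⟩
    have hfr : ∃ᶠ s in 𝓝 t, coordPt F A p (f s) (g s) = coordPt F A p' (f' s) (g' s) :=
      (mem_closure_iff_frequently.1 htu).mono fun s hs ↦ Eventually.self_of_nhds
        (p := fun s ↦ coordPt F A p (f s) (g s) = coordPt F A p' (f' s) (g' s)) hs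
    have hft := hW.mem _ (h.mem t ht)
    have hft' := hW'.mem _ (h'.mem t ht)
    have hc : ContinuousAt (fun s ↦ (chartAt E p).symm (f s)) t :=
      ContinuousAt.comp (f := f) ((chartAt E p).continuousAt_symm hft.1)
        (h.base t ht).continuousAt
    have hc' : ContinuousAt (fun s ↦ (chartAt E p').symm (f' s)) t :=
      ContinuousAt.comp (f := f') ((chartAt E p').continuousAt_symm hft'.1)
        (h'.base t ht).continuousAt
    have hxx : (chartAt E p).symm (f t) = (chartAt E p').symm (f' t) :=
      tendsto_nhds_unique_of_frequently_eq hc hc' (hfr.mono fun s hs ↦ congrArg TotalSpace.proj hs)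
    have hx := symm_mem_chartDom hft
    have hx' : (chartAt E p).symm (f t) ∈ chartDom (E := E) F A p' := by
      rw [hxx]; exact symm_mem_chartDom hft'
    -- in the trivialization at `p`, both curves are continuous
    have hcg : ContinuousAt (fun s ↦ coordChange (E := E) F A p' p
        (chartAt E p ((chartAt E p').symm (f' s))) (g' s)) t := by
      refine ContinuousAt.clm_apply ?_ (h'.fibre t ht).continuousAt
      refine ContinuousAt.comp (f := fun s ↦ chartAt E p ((chartAt E p').symm (f' s)))
        (g := coordChange (E := E) F A p' p) ?_ ?_
      · rw [← hxx]
        exact (contDiffAt_coordChange hx hx').continuousAt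
      · exact ContinuousAt.comp (f := fun s ↦ (chartAt E p').symm (f' s))
          ((chartAt E p).continuousAt (by rw [← hxx]; exact hx.1)) hc'
    have hcp : ∀ᶠ s in 𝓝 t, (chartAt E p').symm (f' s) ∈ chartDom (E := E) F A p :=
      hc'.eventually ((isOpen_chartDom p).mem_nhds (by
      change (chartAt E p').symm (f' t) ∈ _
      rw [← hxx]
      exact hx))
    have hIoo : ∀ᶠ s in 𝓝 t, s ∈ Ioo a b := Ioo_mem_nhds ht.1 ht.2
    have hpt : ∀ s, (chartAt E p').symm (f' s) ∈ chartDom (E := E) F A p →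
        (ptCoord E p (coordPt F A p' (f' s) (g' s))).2 = coordChange (E := E) F A p' p
          (chartAt E p ((chartAt E p').symm (f' s))) (g' s) := by
      intro s hs
      simp only [ptCoord, coordPt, coordChange, ContinuousLinearMap.comp_apply]
      rw [(chartAt E p).left_inv hs.1]
      rfl
    have hgg : g t = coordChange (E := E) F A p' p
        (chartAt E p ((chartAt E p').symm (f' t))) (g' t) := by
      refine tendsto_nhds_unique_of_frequently_eq (h.fibre t ht).continuousAt hcg
        ((hfr.and_eventually (hcp.and hIoo)).mono ?_)
      rintro s ⟨h1, h2, h3⟩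
      rw [← hpt s h2, ← h1, ptCoord_coordPt (hW.mem _ (h.mem s h3))]
    refine h.eventually_eq hW hW' h' ht ?_
    have hcpt := hcp.self_of_nhds
    rw [← coordPt_ptCoord (p := p) (z := coordPt F A p' (f' t) (g' t)) hcpt, hpt t hcpt, ← hgg]
    congr 1
    change f t = chartAt E p ((chartAt E p').symm (f' t))
    rw [← hxx, (chartAt E p).right_inv hft.1]
  exact (hsub ht).self_of_nhds

end FlowLines

/-! ### Flow maps near a submanifold -/

section FlowMap

variable {E : Type*} [NormedAddCommGroup E] [NormedSpace ℝ E] [FiniteDimensional ℝ E]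
  {M : Type*} [TopologicalSpace M] [T2Space M] [ChartedSpace E M] [IsManifold 𝓘(ℝ, E) ∞ M]
  {F : Type*} [NormedAddCommGroup F] [NormedSpace ℝ F] [FiniteDimensional ℝ F]
  {A : M → Type*} [TopologicalSpace (TotalSpace F A)] [∀ x, TopologicalSpace (A x)]
  [∀ x, AddCommGroup (A x)] [∀ x, Module ℝ (A x)]
  [FiberBundle F A] [VectorBundle ℝ F A] [ContMDiffVectorBundle ∞ F A 𝓘(ℝ, E)]
  (𝒜 : LieAlgebroid 𝓘(ℝ, E) F A)

/-- The curves `f` and `Φ` are the coordinates at `p` of the flow, between the times `a` and `b`, of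
the time-dependent section `v` on one fibre of `A`. -/
structure IsFlow (v : ℝ → Π x, A x) (W : Set (ℝ × E)) (p : M) (a b : ℝ) (f : ℝ → E)
    (Φ : ℝ → F →L[ℝ] F) : Prop where
  mem : ∀ t ∈ Ioo a b, (t, f t) ∈ W
  base : ∀ t ∈ Ioo a b, HasDerivAt f (coordAnchor 𝒜 p (f t) (coordSec F v p (t, f t))) t
  fibre : ∀ t ∈ Ioo a b, HasDerivAt Φ ((adj (coordAnchor 𝒜 p) (coordBracket 𝒜 p)
    (fun y ↦ coordSec F v p (t, y)) (f t)).comp (Φ t)) t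

variable {𝒜} {v : ℝ → Π x, A x}

theorem IsFlow.isFlowLine {W : Set (ℝ × E)} {p : M} {a b : ℝ} {f : ℝ → E} {Φ : ℝ → F →L[ℝ] F}
    (h : IsFlow 𝒜 v W p a b f Φ) (u : F) : IsFlowLine 𝒜 v W p a b f (fun t ↦ Φ t u) where
  mem := h.mem
  base := h.base
  fibre t ht := by
    have := (h.fibre t ht).clm_apply (hasDerivAt_const t u)
    simpa using this

variable (𝒜) in
/-- If the time-dependent section `v` vanishes to second order at the points of `S`, then its flow
from time `t₀` to time `t₁` is defined on a neighbourhood of `S`, is given in coordinates by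
morphisms, and fixes `A` over `S`. The flow near a point of `S` is constructed in the coordinates at
this point; by uniqueness of flow lines the local flows agree on overlaps. -/
theorem exists_flow_map {W : M → Set (ℝ × E)} {S : Set M} {a b t₀ t₁ : ℝ} (ht₀ : t₀ ∈ Ioo a b)
    (ht₁ : t₁ ∈ Ioo a b) (hW : ∀ p ∈ S, IsSmoothField (F := F) v (W p) p)
    (hmem : ∀ p ∈ S, ∀ s ∈ Icc a b, (s, chartAt E p p) ∈ W p)
    (hv0 : ∀ p ∈ S, ∀ s ∈ Icc a b, coordSec F v p (s, chartAt E p p) = 0)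
    (hv1 : ∀ p ∈ S, ∀ s ∈ Icc a b, sndDeriv (coordSec F v p) (s, chartAt E p p) = 0) :
    ∃ (O : TopologicalSpace.Opens M) (φ : BundleMap A A), S ⊆ O ∧
      (∀ x₀ ∈ O, ∃ (p : M) (f : E → E) (Φ : E → F →L[ℝ] F), HasLocalForm 𝒜 φ p f Φ x₀) ∧
      (∀ x ∈ O, ∃ p ∈ S, x ∈ chartDom (E := E) F A p ∧
        ∃ (f : ℝ → E) (Φ : ℝ → F →L[ℝ] F), IsFlow 𝒜 v (W p) p a b f Φ ∧
          f t₀ = chartAt E p x ∧ Φ t₀ = 1 ∧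
          ∀ u, φ.toTotal F F ⟨x, u⟩ = coordPt F A p (f t₁) (Φ t₁ (toF F p x u))) ∧
      ∀ p ∈ S, ∀ u, φ.toTotal F F ⟨p, u⟩ = ⟨p, u⟩ := by
  classical
  choose! O f Φ hO hpO hf hΦ hfp hΦp hf0 hΦ0 hQ hfW hfd hΦd hmor using fun p (hp : p ∈ S) ↦
    (locAlg 𝒜 p).exists_flow ht₀ (hW p hp).isOpen (hW p hp).mem (hW p hp).smooth
      (hmem p hp) (hv0 p hp) (hv1 p hp)
      (Q := coordDom (E := E) F A p)
      ((isOpen_coordDom p).mem_nhds (map_mem_coordDom (mem_chartDom_self p)))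
  let V : M → Set M := fun p ↦ {x | x ∈ chartDom (E := E) F A p ∧ chartAt E p x ∈ O p}
  have hV : ∀ p ∈ S, IsOpen (V p) := by
    intro p hp
    exact ((chartAt E p).continuousOn.mono inter_subset_left).isOpen_inter_preimage
      (isOpen_chartDom (E := E) (F := F) (A := A) p) (hO p hp)
  -- a point of `S` whose coordinates are used at `x`; `hφ` shows that the choice does not matter
  let pt : M → M := fun x ↦ if h : ∃ p ∈ S, x ∈ V p then h.choose else x
  have hpt : ∀ p ∈ S, ∀ x ∈ V p, pt x ∈ S ∧ x ∈ V (pt x) := by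
    intro p hp x hx
    have h : ∃ p ∈ S, x ∈ V p := ⟨p, hp, hx⟩
    simp only [pt, dif_pos h]
    exact h.choose_spec
  let φ : BundleMap A A :=
    { base := fun x ↦ (chartAt E (pt x)).symm (f (pt x) t₁ (chartAt E (pt x) x))
      fibre := fun x ↦ (ofF F (A := A) (pt x)
          ((chartAt E (pt x)).symm (f (pt x) t₁ (chartAt E (pt x) x)))).toLinearMap ∘ₗ
        (Φ (pt x) t₁ (chartAt E (pt x) x)).toLinearMap ∘ₗ (toF F (pt x) x).toLinearMap }
  have hflow : ∀ p ∈ S, ∀ x ∈ V p, IsFlow 𝒜 v (W p) p a b (fun t ↦ f p t (chartAt E p x))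
      (fun t ↦ Φ p t (chartAt E p x)) := fun p hp x hx ↦
    ⟨fun t ht ↦ hfW p hp _ hx.2 t (Ioo_subset_Icc_self ht), fun t ht ↦ hfd p hp _ hx.2 t ht,
      fun t ht ↦ hΦd p hp _ hx.2 t ht⟩
  have h0 : ∀ p ∈ S, ∀ x ∈ V p, ∀ u : A x, coordPt F A p (f p t₀ (chartAt E p x))
      (Φ p t₀ (chartAt E p x) (toF F p x u)) = ⟨x, u⟩ := by
    intro p hp x hx u
    rw [hf0 p hp _ hx.2, hΦ0 p hp _ hx.2]
    exact coordPt_ptCoord (z := ⟨x, u⟩) hx.1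
  have hφ : ∀ p ∈ S, ∀ x ∈ V p, ∀ u : A x, φ.toTotal F F ⟨x, u⟩ =
      coordPt F A p (f p t₁ (chartAt E p x)) (Φ p t₁ (chartAt E p x) (toF F p x u)) := by
    intro p hp x hx u
    obtain ⟨hp', hx'⟩ := hpt p hp x hx
    exact ((hflow _ hp' x hx').isFlowLine (toF F (pt x) x u)).eqOn (hW _ hp') (hW p hp)
      ((hflow p hp x hx).isFlowLine (toF F p x u)) ht₀
      ((h0 _ hp' x hx' u).trans (h0 p hp x hx u).symm) ht₁
  refine ⟨⟨⋃ p ∈ S, V p, isOpen_biUnion hV⟩, φ, ?_, ?_, ?_, ?_⟩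
  · exact fun p hp ↦ mem_biUnion hp ⟨mem_chartDom_self p, hpO p hp⟩
  · intro x hx
    obtain ⟨p, hp, hx⟩ := mem_iUnion₂.1 hx
    refine ⟨p, f p t₁, Φ p t₁, hx.1, ?_, ?_⟩
    · filter_upwards [(hO p hp).mem_nhds hx.2] with y hy
      exact ⟨(hf p hp t₁).contDiffAt ((hO p hp).mem_nhds hy),
        (hΦ p hp t₁).contDiffAt ((hO p hp).mem_nhds hy), hmor p hp y hy t₁ ht₁⟩
    · filter_upwards [(hV p hp).mem_nhds hx] with z hz
      have hd : f p t₁ (chartAt E p z) ∈ coordDom (E := E) F A p := hQ p hp _ hz.2 t₁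
      have hb : φ.base z = (chartAt E p).symm (f p t₁ (chartAt E p z)) :=
        congrArg TotalSpace.proj (hφ p hp z hz 0)
      refine ⟨?_, ?_, fun u ↦ ?_⟩
      · rw [hb]
        exact symm_mem_chartDom hd
      · rw [hb, (chartAt E p).right_inv hd.1]
      · exact (congrArg (fun w ↦ (ptCoord E p w).2) (hφ p hp z hz u)).trans
          (congrArg Prod.snd (ptCoord_coordPt hd _))
  · intro x hx
    obtain ⟨p, hp, hx⟩ := mem_iUnion₂.1 hx
    exact ⟨p, hp, hx.1, _, _, hflow p hp x hx, hf0 p hp _ hx.2, hΦ0 p hp _ hx.2, hφ p hp x hx⟩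
  · intro p hp u
    rw [hφ p hp p ⟨mem_chartDom_self p, hpO p hp⟩ u, hfp p hp, hΦp p hp]
    exact coordPt_ptCoord (z := ⟨p, u⟩) (mem_chartDom_self p)

/-- The flow of `v` from time `t₁` to `t₀` inverts the one from time `t₀` to `t₁`. -/
theorem flow_map_leftInverse {W : M → Set (ℝ × E)} {S : Set M} {a b t₀ t₁ : ℝ}
    (hW : ∀ p ∈ S, IsSmoothField (F := F) v (W p) p) (ht₀ : t₀ ∈ Ioo a b) (ht₁ : t₁ ∈ Ioo a b)
    {O O' : TopologicalSpace.Opens M} {φ ψ : BundleMap A A}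
    (hφ : ∀ x ∈ O, ∃ p ∈ S, x ∈ chartDom (E := E) F A p ∧
        ∃ (f : ℝ → E) (Φ : ℝ → F →L[ℝ] F), IsFlow 𝒜 v (W p) p a b f Φ ∧
          f t₀ = chartAt E p x ∧ Φ t₀ = 1 ∧
          ∀ u, φ.toTotal F F ⟨x, u⟩ = coordPt F A p (f t₁) (Φ t₁ (toF F p x u)))
    (hψ : ∀ x ∈ O', ∃ p ∈ S, x ∈ chartDom (E := E) F A p ∧
        ∃ (f : ℝ → E) (Φ : ℝ → F →L[ℝ] F), IsFlow 𝒜 v (W p) p a b f Φ ∧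
          f t₁ = chartAt E p x ∧ Φ t₁ = 1 ∧
          ∀ u, ψ.toTotal F F ⟨x, u⟩ = coordPt F A p (f t₀) (Φ t₀ (toF F p x u)))
    {z : TotalSpace F A} (hz : z.1 ∈ O) (hz' : φ.base z.1 ∈ O') :
    ψ.toTotal F F (φ.toTotal F F z) = z := by
  obtain ⟨x, u⟩ := z
  obtain ⟨p, hp, hx, f, Φ, hf, hf0, hΦ0, hφx⟩ := hφ x hz
  obtain ⟨p', hp', hx', f', Φ', hf', hf0', hΦ0', hψx⟩ := hψ _ hz'
  refine (hψx (φ.fibre x u)).trans ?_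
  have h1 : coordPt F A p' (f' t₁) (Φ' t₁ (toF F p' (φ.base x) (φ.fibre x u))) =
      φ.toTotal F F ⟨x, u⟩ := by
    rw [hf0', hΦ0']
    exact coordPt_ptCoord (z := φ.toTotal F F ⟨x, u⟩) hx'
  have h2 : coordPt F A p (f t₀) (Φ t₀ (toF F p x u)) = ⟨x, u⟩ := by
    rw [hf0, hΦ0]
    exact coordPt_ptCoord (z := ⟨x, u⟩) hx
  exact ((hf'.isFlowLine _).eqOn (hW _ hp') (hW _ hp) (hf.isFlowLine _) ht₁
    (h1.trans (hφx u)) ht₀).trans h2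

end FlowMap

/-! ### The primitive and the Moser section -/

section LocalForms

variable {E F G : Type*} [NormedAddCommGroup E] [NormedSpace ℝ E] [NormedAddCommGroup F]
  [NormedSpace ℝ F] [NormedAddCommGroup G] [NormedSpace ℝ G]

theorem fderiv_sub_apply {f g : E → G} {x : E} (hf : DifferentiableAt ℝ f x)
    (hg : DifferentiableAt ℝ g x) (ξ : E) :
    fderiv ℝ (fun y ↦ f y - g y) x ξ = fderiv ℝ f x ξ - fderiv ℝ g x ξ := by
  rw [fderiv_fun_sub hf hg, sub_apply]

theorem LocClosed.sub {ρ : E → F →L[ℝ] E} {c : E → F →L[ℝ] F →L[ℝ] F}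
    {η ζ : E → F →L[ℝ] F →L[ℝ] ℝ} {x : E} (hη : DifferentiableAt ℝ η x)
    (hζ : DifferentiableAt ℝ ζ x) (h : LocClosed ρ c η x) (h' : LocClosed ρ c ζ x) :
    LocClosed ρ c (fun y ↦ η y - ζ y) x := by
  intro a b d
  have h1 := h a b d
  have h2 := h' a b d
  rw [fderiv_sub_apply (G := F →L[ℝ] F →L[ℝ] ℝ) hη hζ,
    fderiv_sub_apply (G := F →L[ℝ] F →L[ℝ] ℝ) hη hζ,
    fderiv_sub_apply (G := F →L[ℝ] F →L[ℝ] ℝ) hη hζ]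
  simp only [sub_apply]
  linarith

theorem LocClosed.add_smul {ρ : E → F →L[ℝ] E} {c : E → F →L[ℝ] F →L[ℝ] F}
    {η ζ : E → F →L[ℝ] F →L[ℝ] ℝ} {x : E} (hη : DifferentiableAt ℝ η x)
    (hζ : DifferentiableAt ℝ ζ x) (h : LocClosed ρ c η x) (h' : LocClosed ρ c ζ x) (t : ℝ) :
    LocClosed ρ c (fun y ↦ η y + t • ζ y) x := by
  intro a b d
  have h1 := h a b d
  have h2 := h' a b d
  have h3 := (fderiv_add_const_smul (G := F →L[ℝ] F →L[ℝ] ℝ) hη hζ t).2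
  have h4 : ∀ ξ u w, fderiv ℝ (fun y ↦ η y + t • ζ y) x ξ u w =
      fderiv ℝ η x ξ u w + t * fderiv ℝ ζ x ξ u w := fun ξ u w ↦ by rw [h3]; rfl
  simp only [h4, add_apply, smul_apply, smul_eq_mul]
  linear_combination h1 + t * h2

end LocalForms

section Moser

variable {E : Type*} [NormedAddCommGroup E] [NormedSpace ℝ E] [FiniteDimensional ℝ E]
  {M : Type*} [TopologicalSpace M] [T2Space M] [ChartedSpace E M] [IsManifold 𝓘(ℝ, E) ∞ M]
  {F : Type*} [NormedAddCommGroup F] [NormedSpace ℝ F] [FiniteDimensional ℝ F]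
  {A : M → Type*} [TopologicalSpace (TotalSpace F A)] [∀ x, TopologicalSpace (A x)]
  [∀ x, AddCommGroup (A x)] [∀ x, Module ℝ (A x)]
  [∀ x, ContinuousAdd (A x)] [∀ x, ContinuousSMul ℝ (A x)]
  [FiberBundle F A] [VectorBundle ℝ F A] [ContMDiffVectorBundle ∞ F A 𝓘(ℝ, E)]
  {𝒜 : LieAlgebroid 𝓘(ℝ, E) F A} (ϱ : BundleMap (ExtProd IccTangent A) A)
  (ω₀ ω₁ : SymplecticForm 𝒜)

/-- The primitive of `ω₁ - ω₀` obtained by integrating its pullback under the homotopy `ϱ` over the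
time interval. The homotopy is reparametrized by the clock. -/
def moserPrimitive (x : M) (b : A x) : ℝ :=
  ∫ s in (0 : ℝ)..1,
    (ω₁.form (ϱ.base (clock s, x)) (ϱ.fibre (clock s, x) (timeIncl (clock s, x) (clockVel s)))
        (ϱ.fibre (clock s, x) (spaceIncl (clock s, x) b))
      - ω₀.form (ϱ.base (clock s, x)) (ϱ.fibre (clock s, x) (timeIncl (clock s, x) (clockVel s)))
        (ϱ.fibre (clock s, x) (spaceIncl (clock s, x) b)))

/-- The equation `(ω₀ + t (ω₁ - ω₀))(u, ·) = -β` at the point `x`, for the primitive `β` of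
`ω₁ - ω₀`. -/
def IsMoserVector (t : ℝ) (x : M) (u : A x) : Prop :=
  ∀ b, ω₀.form x u b + t * (ω₁.form x u b - ω₀.form x u b) = - moserPrimitive ϱ ω₀ ω₁ x b

open Classical in
/-- The time-dependent section of `A` defined by the Moser equation at the points and times where
the equation has a unique solution, and by zero elsewhere. -/
def moserField (t : ℝ) (x : M) : A x :=
  if h : ∃! u, IsMoserVector ϱ ω₀ ω₁ t x u then h.choose else 0

variable {ϱ ω₀ ω₁} in
theorem moserField_eq {t : ℝ} {x : M} {u : A x} (hu : IsMoserVector ϱ ω₀ ω₁ t x u)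
    (huniq : ∀ u', IsMoserVector ϱ ω₀ ω₁ t x u' → u' = u) : moserField ϱ ω₀ ω₁ t x = u := by
  have h : ∃! u, IsMoserVector ϱ ω₀ ω₁ t x u := ⟨u, hu, huniq⟩
  rw [moserField, dif_pos h]
  exact huniq _ h.choose_spec.1

/-- The difference of the forms `ω₁` and `ω₀` in the coordinates at `p`. -/
def formDiff (p : M) (y : E) : F →L[ℝ] F →L[ℝ] ℝ := coordForm ω₁ p y - coordForm ω₀ p y

theorem contDiffOn_formDiff (p : M) : ContDiffOn ℝ ∞ (formDiff ω₀ ω₁ p) (coordDom F A p) :=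
  (contDiffOn_coordForm ω₁ p).sub (contDiffOn_coordForm ω₀ p)

theorem locClosed_formDiff {p : M} {y : E} (hy : y ∈ coordDom F A p) :
    LocClosed (coordAnchor 𝒜 p) (coordBracket 𝒜 p) (formDiff ω₀ ω₁ p) y := by
  have hd (η : SymplecticForm 𝒜) := ((contDiffOn_coordForm η p).contDiffAt
    ((isOpen_coordDom (F := F) (A := A) p).mem_nhds hy)).differentiableAt (by simp)
  exact LocClosed.sub (hd ω₁) (hd ω₀) (locClosed_coordForm ω₁ hy) (locClosed_coordForm ω₀ hy)

theorem formDiff_eq_zero {p x : M} (hx : x ∈ (chartAt E p).source)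
    (h : ω₀.form x = ω₁.form x) : formDiff ω₀ ω₁ p (chartAt E p x) = 0 := by
  ext a b
  have : ∀ x', x' = x → ω₁.form x' (ofF F p x' a) (ofF F p x' b) -
      ω₀.form x' (ofF F p x' a) (ofF F p x' b) = 0 := by
    rintro _ rfl
    rw [h, sub_self]
  exact this _ ((chartAt E p).left_inv hx)

variable {ϱ ω₀ ω₁} {U : TopologicalSpace.Opens M} {N : Type*} {ι : N → M}
  {B : Π y : N, Submodule ℝ (A (ι y))}

theorem IsDeformationRetraction.base_fixed (h : IsDeformationRetraction 𝒜 U ι B ϱ)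
    (t : Icc (0 : ℝ) 1) (y : N) : ϱ.base (t, ι y) = ι y :=
  congrArg TotalSpace.proj (h.fixed t 0 y 0 (zero_mem _))

/-- The homotopy maps the time direction over the submanifold to zero, because `ϱ (t, u, 0) = 0`. -/
theorem IsDeformationRetraction.fibre_fixed (h : IsDeformationRetraction 𝒜 U ι B ϱ)
    (p : M) (t : Icc (0 : ℝ) 1) (u : IccTangent t) (y : N) :
    toF F p (ϱ.base (t, ι y)) (ϱ.fibre (t, ι y) (timeIncl (t, ι y) u)) = 0 :=
  (congrArg (fun w ↦ (ptCoord E p w).2) (h.fixed t u y 0 (zero_mem _))).trans (map_zero _)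

theorem IsDeformationRetraction.homBase_one (h : IsDeformationRetraction 𝒜 U ι B ϱ) {p : M} {y : E}
    (hy : y ∈ coordDom (E := E) F A p) (hU : (chartAt E p).symm y ∈ U) :
    homBase ϱ p (1, y) = y := by
  have h1 : clockPt p (1, y) = ((1 : Icc (0 : ℝ) 1), (chartAt E p).symm y) :=
    Prod.ext clock_one rfl
  rw [homBase, h1]
  have h2 : ϱ.base (1, (chartAt E p).symm y) = (chartAt E p).symm y :=
    congrArg TotalSpace.proj (h.at_one _ hU 0)
  rw [h2, (chartAt E p).right_inv hy.1]

theorem IsDeformationRetraction.homFibre_one (h : IsDeformationRetraction 𝒜 U ι B ϱ) {p : M} {y : E}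
    (hy : y ∈ coordDom (E := E) F A p) (hU : (chartAt E p).symm y ∈ U) (a : F) :
    homFibre ϱ p (1, y) a = a := by
  have h1 : clockPt p (1, y) = ((1 : Icc (0 : ℝ) 1), (chartAt E p).symm y) :=
    Prod.ext clock_one rfl
  let K : Icc (0 : ℝ) 1 × M → F := fun z ↦
    toF F p (ϱ.base z) (ϱ.fibre z (spaceIncl z (ofF F p z.2 a)))
  change K (clockPt p (1, y)) = a
  rw [h1]
  have h2 := congrArg (fun w ↦ (ptCoord E p w).2)
    (h.at_one _ hU (ofF F p ((chartAt E p).symm y) a))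
  exact h2.trans (toF_ofF (symm_mem_chartDom hy) a)

/-- The homotopy starts at a map with values in `B`, so its base map takes values in the
submanifold, where the two forms agree. -/
theorem IsDeformationRetraction.formDiff_homBase_zero (h : IsDeformationRetraction 𝒜 U ι B ϱ)
    (hω : ∀ y : N, ω₀.form (ι y) = ω₁.form (ι y)) {p : M} {y : E}
    (hq : ((0 : ℝ), y) ∈ homDom E F U ϱ p) :
    formDiff ω₀ ω₁ p (homBase ϱ p (0, y)) = 0 := by
  have h1 : clockPt p (0, y) = ((0 : Icc (0 : ℝ) 1), (chartAt E p).symm y) :=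
    Prod.ext clock_zero rfl
  have h2 : ϱ.toTotal (EuclideanSpace ℝ (Fin 1) × F) F
      ⟨(0, (chartAt E p).symm y), ((0 : IccTangent 0), (0 : A ((chartAt E p).symm y)))⟩ ∈
      {w : TotalSpace F A | ∃ y, ∃ b ∈ B y, (⟨ι y, b⟩ : TotalSpace F A) = w} := by
    rw [← h.at_zero]
    exact ⟨_, hq.2.1, 0, rfl⟩
  obtain ⟨y', b, -, hb⟩ := h2
  have h3 : ι y' = ϱ.base (0, (chartAt E p).symm y) := congrArg TotalSpace.proj hb
  have h4 := hq.2.2.1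
  rw [homBase]
  rw [h1, ← h3] at h4 ⊢
  exact formDiff_eq_zero ω₀ ω₁ h4 (hω y')

theorem IsDeformationRetraction.homBase_self (h : IsDeformationRetraction 𝒜 U ι B ϱ) (y : N)
    (s : ℝ) : ϱ.base (clockPt (ι y) (s, chartAt E (ι y) (ι y))) = ι y := by
  have h1 : clockPt (ι y) (s, chartAt E (ι y) (ι y)) = (clock s, ι y) :=
    Prod.ext rfl ((chartAt E (ι y)).left_inv (mem_chart_source E (ι y)))
  rw [h1, h.base_fixed]

theorem IsDeformationRetraction.homTime_self (h : IsDeformationRetraction 𝒜 U ι B ϱ) (y : N)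
    (s : ℝ) : homTime (F := F) ϱ (ι y) (s, chartAt E (ι y) (ι y)) = 0 := by
  have : ∀ x, x = ι y → toF F (ι y) (ϱ.base (clock s, x))
      (ϱ.fibre (clock s, x) (timeIncl (clock s, x) (clockVel s))) = 0 := by
    rintro _ rfl
    exact h.fibre_fixed _ _ _ y
  exact this _ ((chartAt E (ι y)).left_inv (mem_chart_source E (ι y)))

theorem IsDeformationRetraction.self_mem_homDom (h : IsDeformationRetraction 𝒜 U ι B ϱ)
    (hU : range ι ⊆ U) (y : N) (s : ℝ) :
    (s, chartAt E (ι y) (ι y)) ∈ homDom E F U ϱ (ι y) := by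
  refine ⟨map_mem_coordDom (mem_chartDom_self _), ?_, ?_⟩
  · rw [(chartAt E (ι y)).left_inv (mem_chart_source E (ι y))]
    exact hU (mem_range_self y)
  · rw [h.homBase_self]
    exact mem_chartDom_self _

variable (ϱ ω₀ ω₁) in
/-- The primitive of `ω₁ - ω₀` in the coordinates at `p`. -/
def coordPrimitive (p : M) (y : E) : F →L[ℝ] ℝ :=
  ∫ s in (0 : ℝ)..1, contraction (formDiff ω₀ ω₁ p) (homBase ϱ p) (homFibre ϱ p)
    (homTime ϱ p) (s, y)

theorem coordPrimitive_apply (h : IsHomotopy 𝒜 U ϱ) {p : M} {y : E}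
    (hq : ∀ s ∈ Icc (0 : ℝ) 1, (s, y) ∈ homDom E F U ϱ p) (b : F) :
    coordPrimitive ϱ ω₀ ω₁ p y b =
      moserPrimitive ϱ ω₀ ω₁ ((chartAt E p).symm y) (ofF F p ((chartAt E p).symm y) b) := by
  have hsm := (locHomotopy h p).contDiffOn_contraction (contDiffOn_formDiff ω₀ ω₁ p)
  have hpath : ContinuousOn (fun s : ℝ ↦ (s, y)) (Icc 0 1) := by fun_prop
  have hc : ContinuousOn (fun s ↦ contraction (formDiff ω₀ ω₁ p) (homBase ϱ p) (homFibre ϱ p)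
      (homTime ϱ p) (s, y)) (Icc 0 1) := hsm.continuousOn.comp hpath hq
  rw [coordPrimitive, ContinuousLinearMap.intervalIntegral_apply
    (hc.intervalIntegrable_of_Icc zero_le_one), moserPrimitive]
  refine intervalIntegral.integral_congr fun s hs ↦ ?_
  rw [uIcc_of_le zero_le_one] at hs
  have hd := (hq s hs).2.2
  exact congrArg₂ (· - ·) (coordForm_apply ω₁ hd _ _) (coordForm_apply ω₀ hd _ _)

/-- In coordinates the solution of the Moser equation is `moserSection`. -/
theorem coordSec_moserField (h : IsHomotopy 𝒜 U ϱ) {p : M} {O : Set E}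
    (hO : ∀ y ∈ O, ∀ s ∈ Icc (0 : ℝ) 1, (s, y) ∈ homDom E F U ϱ p) {q : ℝ × E}
    (hq : q ∈ nondegSet O (coordForm ω₀ p) (formDiff ω₀ ω₁ p)) :
    coordSec F (moserField ϱ ω₀ ω₁) p q =
      moserSection (coordForm ω₀ p) (formDiff ω₀ ω₁ p) (coordPrimitive ϱ ω₀ ω₁ p) q := by
  obtain ⟨t, y⟩ := q
  have hy : y ∈ coordDom (E := E) F A p := (hO y hq.1 0 (by simp)).1
  have hx := symm_mem_chartDom hy
  have hm := form_moserSection (β := coordPrimitive ϱ ω₀ ω₁ p) hq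
  -- the Moser equation in coordinates
  have hiff : ∀ u : F, IsMoserVector ϱ ω₀ ω₁ t ((chartAt E p).symm y)
      (ofF F p ((chartAt E p).symm y) u) ↔
      (coordForm ω₀ p y + t • formDiff ω₀ ω₁ p y) u = - coordPrimitive ϱ ω₀ ω₁ p y := by
    intro u
    constructor
    · intro hu
      ext b
      have := hu (ofF F p ((chartAt E p).symm y) b)
      rw [← coordPrimitive_apply h (hO y hq.1)] at this
      exact this
    · intro hu b
      have := congrArg (fun L ↦ L (toF F p _ b)) hu
      simp only [neg_apply] at this
      rw [coordPrimitive_apply h (hO y hq.1), ofF_toF hx] at this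
      rw [← this, ← ofF_toF hx b, toF_ofF hx]
      rfl
  have h1 : moserField ϱ ω₀ ω₁ t ((chartAt E p).symm y) = ofF F p ((chartAt E p).symm y)
      (moserSection (coordForm ω₀ p) (formDiff ω₀ ω₁ p) (coordPrimitive ϱ ω₀ ω₁ p) (t, y)) := by
    refine moserField_eq ((hiff _).2 hm) fun u hu ↦ ?_
    rw [← ofF_toF hx u] at hu ⊢
    obtain ⟨e, he⟩ := hq.2
    congr 1
    apply e.injective
    have h2 := ((hiff _).1 hu).trans hm.symm
    rw [← he] at h2
    exact h2
  rw [coordSec, h1, toF_ofF hx]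

end Moser

/-! ### The Moser flow -/

section MoserFlow

variable {E : Type*} [NormedAddCommGroup E] [NormedSpace ℝ E] [FiniteDimensional ℝ E]
  {M : Type*} [TopologicalSpace M] [T2Space M] [ChartedSpace E M] [IsManifold 𝓘(ℝ, E) ∞ M]
  {F : Type*} [NormedAddCommGroup F] [NormedSpace ℝ F] [FiniteDimensional ℝ F]
  {A : M → Type*} [TopologicalSpace (TotalSpace F A)] [∀ x, TopologicalSpace (A x)]
  [∀ x, AddCommGroup (A x)] [∀ x, Module ℝ (A x)]
  [∀ x, ContinuousAdd (A x)] [∀ x, ContinuousSMul ℝ (A x)]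
  [FiberBundle F A] [VectorBundle ℝ F A] [ContMDiffVectorBundle ∞ F A 𝓘(ℝ, E)]
  {𝒜 : LieAlgebroid 𝓘(ℝ, E) F A} {ϱ : BundleMap (ExtProd IccTangent A) A}
  {ω₀ ω₁ : SymplecticForm 𝒜} {U : TopologicalSpace.Opens M} {N : Type*} {ι : N → M}
  {B : Π y : N, Submodule ℝ (A (ι y))}

/-- The homotopy keeps points near a fixed point `ι y` in the coordinate domain at `ι y` for all
times, by compactness of the time interval. -/
theorem exists_nhds_subset_homDom (h : IsDeformationRetraction 𝒜 U ι B ϱ) (hU : range ι ⊆ U)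
    (y : N) : ∃ O : Set E, IsOpen O ∧ chartAt E (ι y) (ι y) ∈ O ∧
      ∀ z ∈ O, ∀ s ∈ Icc (0 : ℝ) 1, (s, z) ∈ homDom E F U ϱ (ι y) := by
  obtain ⟨u, O, -, hO, hIu, hyO, huO⟩ := generalized_tube_lemma (isCompact_Icc (a := (0 : ℝ))
    (b := 1)) (isCompact_singleton (x := chartAt E (ι y) (ι y)))
    (isOpen_homDom h.morphism (ι y)) (by
      rintro ⟨s, z⟩ ⟨-, rfl⟩
      exact h.self_mem_homDom hU y s)
  exact ⟨O, hO, hyO rfl, fun z hz s hs ↦ huO ⟨hIu hs, hz⟩⟩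

/-- The primitive is smooth, and its differential is `ω₁ - ω₀`. -/
theorem coordPrimitive_spec (h : IsDeformationRetraction 𝒜 U ι B ϱ)
    (hω : ∀ y : N, ω₀.form (ι y) = ω₁.form (ι y)) {p : M} {y : E}
    (hq : ∀ s ∈ Icc (0 : ℝ) 1, (s, y) ∈ homDom E F U ϱ p) :
    ContDiffAt ℝ ∞ (coordPrimitive ϱ ω₀ ω₁ p) y ∧
      LocPrimitive (coordAnchor 𝒜 p) (coordBracket 𝒜 p) (formDiff ω₀ ω₁ p)
        (coordPrimitive ϱ ω₀ ω₁ p) y := by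
  have hl := locHomotopy h.morphism p
  have h0 := hq 0 (by simp)
  refine ⟨(contDiffAt_parametric_integral zero_le_one hl.isOpen hq
    (hl.contDiffOn_contraction (contDiffOn_formDiff ω₀ ω₁ p))).1, ?_⟩
  exact hl.locPrimitive (isOpen_coordDom p) (contDiffOn_formDiff ω₀ ω₁ p)
    (fun x _ a b ↦ by
      simp only [formDiff, sub_apply]
      rw [coordForm_skew ω₁ p x a b, coordForm_skew ω₀ p x a b]
      ring)
    (fun x hx ↦ locClosed_formDiff ω₀ ω₁ hx) hq (h.homBase_one h0.1 h0.2.1)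
    (h.homFibre_one h0.1 h0.2.1) (h.formDiff_homBase_zero hω h0)

/-- The primitive vanishes to second order on the submanifold, because both the form `ω₁ - ω₀` and
the image of the time direction vanish there. -/
theorem coordPrimitive_self (h : IsDeformationRetraction 𝒜 U ι B ϱ) (hU : range ι ⊆ U)
    (hω : ∀ y : N, ω₀.form (ι y) = ω₁.form (ι y)) (y : N) :
    coordPrimitive ϱ ω₀ ω₁ (ι y) (chartAt E (ι y) (ι y)) = 0 ∧
      fderiv ℝ (coordPrimitive ϱ ω₀ ω₁ (ι y)) (chartAt E (ι y) (ι y)) = 0 := by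
  have hl := locHomotopy h.morphism (ι y)
  have hmem := h.self_mem_homDom hU y
  have hα : ∀ s, formDiff ω₀ ω₁ (ι y) (homBase ϱ (ι y) (s, chartAt E (ι y) (ι y))) = 0 := by
    intro s
    rw [homBase, h.homBase_self]
    exact formDiff_eq_zero ω₀ ω₁ (mem_chart_source E (ι y)) (hω y)
  have hw := h.homTime_self (F := F) y
  constructor
  · have : ∀ s : ℝ, contraction (formDiff ω₀ ω₁ (ι y)) (homBase ϱ (ι y)) (homFibre ϱ (ι y))
        (homTime ϱ (ι y)) (s, chartAt E (ι y) (ι y)) = 0 := by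
      intro s
      ext b
      simp [contraction, hw]
    simp [coordPrimitive, this]
  · have hd := (contDiffAt_parametric_integral zero_le_one hl.isOpen (fun s _ ↦ hmem s)
      (hl.contDiffOn_contraction (contDiffOn_formDiff ω₀ ω₁ (ι y)))).2.fderiv
    refine Eq.trans hd ?_
    have : ∀ s : ℝ, sndDeriv (contraction (formDiff ω₀ ω₁ (ι y)) (homBase ϱ (ι y))
        (homFibre ϱ (ι y)) (homTime ϱ (ι y))) (s, chartAt E (ι y) (ι y)) = 0 := by
      intro s
      ext ξ b
      rw [hl.fderiv_contraction (isOpen_coordDom _) (contDiffOn_formDiff ω₀ ω₁ (ι y)) (hmem s),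
        hα, hw]
      simp
    simp [this]

/-- Near a point of the submanifold the Moser section is smooth and vanishes to second order, and
the Lie derivative along it of `ω₀ + t (ω₁ - ω₀)` is `ω₀ - ω₁`. -/
theorem exists_moserField_nhds (h : IsDeformationRetraction 𝒜 U ι B ϱ) (hU : range ι ⊆ U)
    (hω : ∀ y : N, ω₀.form (ι y) = ω₁.form (ι y)) {p : M}
    (hp : p ∈ range ι) :
    ∃ W : Set (ℝ × E), IsSmoothField (F := F) (moserField ϱ ω₀ ω₁) W p ∧
      (∀ s, (s, chartAt E p p) ∈ W) ∧
      (∀ s, coordSec F (moserField ϱ ω₀ ω₁) p (s, chartAt E p p) = 0) ∧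
      (∀ s, sndDeriv (coordSec F (moserField ϱ ω₀ ω₁) p) (s, chartAt E p p) = 0) ∧
      ∀ t z, (t, z) ∈ W → ∀ a b : F,
        formDiff ω₀ ω₁ p z a b
        + fderiv ℝ (fun z ↦ coordForm ω₀ p z + t • formDiff ω₀ ω₁ p z) z
          (coordAnchor 𝒜 p z (coordSec F (moserField ϱ ω₀ ω₁) p (t, z))) a b
        + (coordForm ω₀ p z + t • formDiff ω₀ ω₁ p z)
          (adj (coordAnchor 𝒜 p) (coordBracket 𝒜 p)
            (fun z ↦ coordSec F (moserField ϱ ω₀ ω₁) p (t, z)) z a) b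
        + (coordForm ω₀ p z + t • formDiff ω₀ ω₁ p z) a
          (adj (coordAnchor 𝒜 p) (coordBracket 𝒜 p)
            (fun z ↦ coordSec F (moserField ϱ ω₀ ω₁) p (t, z)) z b) = 0 := by
  obtain ⟨y, rfl⟩ := hp
  obtain ⟨O, hO, hyO, hOd⟩ := exists_nhds_subset_homDom h hU y
  set p := ι y
  set c := chartAt E p p
  have hOc : O ⊆ coordDom (E := E) F A p := fun z hz ↦ (hOd z hz 0 (by simp)).1
  have hω₀ := (contDiffOn_coordForm ω₀ p).mono hOc
  have hα := (contDiffOn_formDiff ω₀ ω₁ p).mono hOc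
  have hβ : ContDiffOn ℝ ∞ (coordPrimitive ϱ ω₀ ω₁ p) O := fun z hz ↦
    (coordPrimitive_spec h hω (hOd z hz)).1.contDiffWithinAt
  have hα0 : formDiff ω₀ ω₁ p c = 0 := formDiff_eq_zero ω₀ ω₁ (mem_chart_source E p) (hω y)
  obtain ⟨hβ0, hβ1⟩ := coordPrimitive_self h hU hω y
  have hopen := isOpen_nondegSet hO hω₀ hα
  have hsec := fun q (hq : q ∈ nondegSet O (coordForm ω₀ p) (formDiff ω₀ ω₁ p)) ↦
    coordSec_moserField h.morphism hOd hq
  have hcW : ∀ s : ℝ, (s, c) ∈ nondegSet O (coordForm ω₀ p) (formDiff ω₀ ω₁ p) := by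
    refine fun s ↦ ⟨hyO, ?_⟩
    have : coordForm ω₀ p c + s • formDiff ω₀ ω₁ p c = coordForm ω₀ p c := by
      ext a b
      rw [hα0]
      change coordForm ω₀ p c a b + s * 0 = _
      rw [mul_zero, add_zero]
    change coordForm ω₀ p c + s • formDiff ω₀ ω₁ p c ∈ _
    rw [this]
    exact coordForm_mem_range ω₀ (hOc hyO)
  have hsm := contDiffOn_moserSection hω₀ hα hβ
  have hsm' : ContDiffOn ℝ ∞ (coordSec F (moserField ϱ ω₀ ω₁) p)
      (nondegSet O (coordForm ω₀ p) (formDiff ω₀ ω₁ p)) := hsm.congr hsec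
  refine ⟨nondegSet O (coordForm ω₀ p) (formDiff ω₀ ω₁ p), ⟨hopen, fun q hq ↦ hOc hq.1, hsm'⟩,
    hcW, fun s ↦ ?_, fun s ↦ ?_, fun t z hz a b ↦ ?_⟩
  · rw [hsec _ (hcW s)]
    exact moserSection_eq_zero hβ0
  · have e : coordSec F (moserField ϱ ω₀ ω₁) p =ᶠ[𝓝 (s, c)]
        moserSection (coordForm ω₀ p) (formDiff ω₀ ω₁ p) (coordPrimitive ϱ ω₀ ω₁ p) := by
      filter_upwards [hopen.mem_nhds (hcW s)] with q hq using hsec q hq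
    rw [sndDeriv, e.fderiv_eq]
    exact sndDeriv_moserSection_eq_zero hO hω₀ hα hβ (hcW s) hβ0 hβ1
  · have hzO : z ∈ O := hz.1
    have d0 := (hω₀.contDiffAt (hO.mem_nhds hzO)).differentiableAt (by simp)
    have d1 := (hα.contDiffAt (hO.mem_nhds hzO)).differentiableAt (by simp)
    have d2 := (fderiv_add_const_smul (G := F →L[ℝ] F →L[ℝ] ℝ) d0 d1 t).1
    refine lie_derivative_eq (η := fun z ↦ coordForm ω₀ p z + t • formDiff ω₀ ω₁ p z)
      (v := fun z ↦ coordSec F (moserField ϱ ω₀ ω₁) p (t, z)) d2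
      ((contDiffAt_slice hopen hsm' hz).differentiableAt (by simp)) ?_ ?_ ?_
      (coordPrimitive_spec h hω (hOd z hzO)).2 a b
    · intro a b
      simp only [formDiff, add_apply, smul_apply, sub_apply, smul_eq_mul]
      rw [coordForm_skew ω₁ p z a b, coordForm_skew ω₀ p z a b]
      ring
    · exact (locClosed_coordForm ω₀ (hOc hzO)).add_smul d0 d1
        (locClosed_formDiff ω₀ ω₁ (hOc hzO)) t
    · filter_upwards [(hopen.preimage (show Continuous fun z : E ↦ (t, z) by fun_prop)).mem_nhds hz]
        with z hz
      have hz' : (t, z) ∈ nondegSet O (coordForm ω₀ p) (formDiff ω₀ ω₁ p) := hz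
      have h5 := form_moserSection (β := coordPrimitive ϱ ω₀ ω₁ p) hz'
      rw [← hsec _ hz'] at h5
      exact h5

/-- The time one map of a flow along which the Lie derivative of `ω₀ + t (ω₁ - ω₀)` is `ω₀ - ω₁`
pulls `ω₁` back to `ω₀`. -/
theorem form_eq_of_isFlow {p x : M} (hx : x ∈ chartDom (E := E) F A p) {W : Set (ℝ × E)}
    {v : ℝ → Π x, A x} (hW : IsSmoothField (F := F) v W p) {a b : ℝ} {f : ℝ → E}
    {Φ : ℝ → F →L[ℝ] F} (hflow : IsFlow 𝒜 v W p a b f Φ)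
    (hL : ∀ t z, (t, z) ∈ W → ∀ a b : F,
        formDiff ω₀ ω₁ p z a b
        + fderiv ℝ (fun z ↦ coordForm ω₀ p z + t • formDiff ω₀ ω₁ p z) z
          (coordAnchor 𝒜 p z (coordSec F v p (t, z))) a b
        + (coordForm ω₀ p z + t • formDiff ω₀ ω₁ p z)
          (adj (coordAnchor 𝒜 p) (coordBracket 𝒜 p) (fun z ↦ coordSec F v p (t, z)) z a) b
        + (coordForm ω₀ p z + t • formDiff ω₀ ω₁ p z) a
          (adj (coordAnchor 𝒜 p) (coordBracket 𝒜 p) (fun z ↦ coordSec F v p (t, z)) z b) = 0)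
    (h0 : (0 : ℝ) ∈ Ioo a b) (h1 : (1 : ℝ) ∈ Ioo a b) (hf0 : f 0 = chartAt E p x) (hΦ0 : Φ 0 = 1)
    {φ : BundleMap A A}
    (hφ : ∀ u, φ.toTotal F F ⟨x, u⟩ = coordPt F A p (f 1) (Φ 1 (toF F p x u))) (u w : A x) :
    ω₁.form (φ.base x) (φ.fibre x u) (φ.fibre x w) = ω₀.form x u w := by
  have hd (η : E → F →L[ℝ] F →L[ℝ] ℝ) (hη : ContDiffOn ℝ ∞ η (coordDom F A p)) :
      ∀ t ∈ Ioo a b, DifferentiableAt ℝ η (f t) := fun t ht ↦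
    (hη.contDiffAt ((isOpen_coordDom p).mem_nhds (hW.mem _ (hflow.mem t ht)))).differentiableAt
      (by simp)
  have key := form_const_along_flow (hd _ (contDiffOn_coordForm ω₀ p))
    (hd _ (contDiffOn_formDiff ω₀ ω₁ p)) hflow.base hflow.fibre
    (fun t ht u w ↦ hL t (f t) (hflow.mem t ht) u w) h0 h1 (toF F p x u) (toF F p x w)
  have hf1 := hW.mem _ (hflow.mem 1 h1)
  have hc (u : A x) : ptCoord E p (φ.toTotal F F ⟨x, u⟩) = (f 1, Φ 1 (toF F p x u)) := by
    rw [hφ, ptCoord_coordPt hf1]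
  have hb : φ.base x ∈ chartDom (E := E) F A p := by
    have := congrArg TotalSpace.proj (hφ u)
    change φ.base x = (chartAt E p).symm (f 1) at this
    rw [this]
    exact symm_mem_chartDom hf1
  have e1 : chartAt E p (φ.base x) = f 1 := congrArg Prod.fst (hc u)
  have e2 (u : A x) : toF F p (φ.base x) (φ.fibre x u) = Φ 1 (toF F p x u) :=
    congrArg Prod.snd (hc u)
  rw [← coordForm_apply ω₁ hb, ← coordForm_apply ω₀ hx, e1, e2, e2, ← hf0]
  rw [hΦ0] at key
  change coordForm ω₀ p (f 1) (Φ 1 (toF F p x u)) (Φ 1 (toF F p x w)) + 1 *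
    (coordForm ω₁ p (f 1) (Φ 1 (toF F p x u)) (Φ 1 (toF F p x w)) -
      coordForm ω₀ p (f 1) (Φ 1 (toF F p x u)) (Φ 1 (toF F p x w))) =
    coordForm ω₀ p (f 0) (toF F p x u) (toF F p x w) +
      0 * formDiff ω₀ ω₁ p (f 0) (toF F p x u) (toF F p x w) at key
  linarith

end MoserFlow

end DMW

end

theorem mainTheorem2
    {E : Type*} [NormedAddCommGroup E] [NormedSpace ℝ E] [FiniteDimensional ℝ E]
    {M : Type*} [TopologicalSpace M] [T2Space M] [SecondCountableTopology M]
    [ChartedSpace E M] [IsManifold 𝓘(ℝ, E) ∞ M]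
    {F : Type*} [NormedAddCommGroup F] [NormedSpace ℝ F] [FiniteDimensional ℝ F]
    {A : M → Type*} [TopologicalSpace (TotalSpace F A)] [∀ x, TopologicalSpace (A x)]
    [∀ x, AddCommGroup (A x)] [∀ x, Module ℝ (A x)]
    [∀ x, ContinuousAdd (A x)] [∀ x, ContinuousSMul ℝ (A x)]
    [FiberBundle F A] [VectorBundle ℝ F A] [ContMDiffVectorBundle ∞ F A 𝓘(ℝ, E)]
    (𝒜 : DMW.LieAlgebroid 𝓘(ℝ, E) F A)
    {E' : Type*} [NormedAddCommGroup E'] [NormedSpace ℝ E'] [FiniteDimensional ℝ E']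
    {N : Type*} [TopologicalSpace N] [T2Space N] [SecondCountableTopology N]
    [ChartedSpace E' N] [IsManifold 𝓘(ℝ, E') ∞ N]
    (ι : N → M) (B : Π y : N, Submodule ℝ (A (ι y)))
    (hB : DMW.IsLieSubalgebroid 𝓘(ℝ, E') F 𝒜.toLocal ι B)
    (hretr : ∃ U : TopologicalSpace.Opens M, range ι ⊆ U ∧
      ∃ ϱ, DMW.IsDeformationRetraction 𝒜 U ι B ϱ)
    (ω₀ ω₁ : DMW.SymplecticForm 𝒜) (hω : ∀ y : N, ω₀.form (ι y) = ω₁.form (ι y)) :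
    ∃ (U₀ U₁ : TopologicalSpace.Opens M) (φ : DMW.BundleMap A A),
      range ι ⊆ U₀ ∧ range ι ⊆ U₁ ∧
      DMW.IsLieIso 𝒜 U₀ U₁ φ ∧
      (∀ x ∈ U₀, ∀ a b : A x,
        ω₁.form (φ.base x) (φ.fibre x a) (φ.fibre x b) = ω₀.form x a b) ∧
      (∀ y : N, φ.base (ι y) = ι y) ∧
      (∀ (y : N) (a : A (ι y)), φ.toTotal F F ⟨ι y, a⟩ = ⟨ι y, a⟩) := by
  obtain ⟨U, hU, ϱ, h⟩ := hretr
  choose! W hW hcW hv0 hv1 hL using fun p (hp : p ∈ range ι) ↦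
    DMW.exists_moserField_nhds (ω₀ := ω₀) (ω₁ := ω₁) h hU hω hp
  -- the flow is considered on `(-1, 2)`, an interval with `0` and `1` in its interior
  have m0 : (0 : ℝ) ∈ Ioo (-1 : ℝ) 2 := by norm_num
  have m1 : (1 : ℝ) ∈ Ioo (-1 : ℝ) 2 := by norm_num
  obtain ⟨O, φ, hSO, hloc, hflow, hfix⟩ := DMW.exists_flow_map 𝒜 m0 m1 hW
    (fun p hp s _ ↦ hcW p hp s) (fun p hp s _ ↦ hv0 p hp s) (fun p hp s _ ↦ hv1 p hp s)
  -- `φ` is the flow from time `0` to time `1`, and `ψ` is the flow back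
  obtain ⟨O', ψ, hSO', hloc', hflow', hfix'⟩ := DMW.exists_flow_map 𝒜 m1 m0 hW
    (fun p hp s _ ↦ hcW p hp s) (fun p hp s _ ↦ hv0 p hp s) (fun p hp s _ ↦ hv1 p hp s)
  have hψφ : ∀ z : TotalSpace F A, z.1 ∈ O → φ.base z.1 ∈ O' →
      ψ.toTotal F F (φ.toTotal F F z) = z := fun z hz hz' ↦
    DMW.flow_map_leftInverse hW m0 m1 hflow hflow' hz hz'
  have hφψ : ∀ z : TotalSpace F A, z.1 ∈ O' → ψ.base z.1 ∈ O →
      φ.toTotal F F (ψ.toTotal F F z) = z := fun z hz hz' ↦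
    DMW.flow_map_leftInverse hW m1 m0 hflow' hflow hz hz'
  have hbase : ∀ y : N, φ.base (ι y) = ι y := fun y ↦
    congrArg TotalSpace.proj (hfix (ι y) (mem_range_self y) 0)
  have hbase' : ∀ y : N, ψ.base (ι y) = ι y := fun y ↦
    congrArg TotalSpace.proj (hfix' (ι y) (mem_range_self y) 0)
  have hcont : ∀ {O : TopologicalSpace.Opens M} {φ : DMW.BundleMap A A},
      (∀ x₀ ∈ O, ∃ (p : M) (f : E → E) (Φ : E → F →L[ℝ] F), DMW.HasLocalForm 𝒜 φ p f Φ x₀) →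
      ContinuousOn φ.base O := fun hloc x hx ↦ by
    obtain ⟨p, f, Φ, hf⟩ := hloc x hx
    exact hf.contMDiffAt_base.continuousAt.continuousWithinAt
  -- the flow maps are inverse to each other where both compositions are defined
  let U₀ : TopologicalSpace.Opens M :=
    ⟨O ∩ φ.base ⁻¹' O', (hcont hloc).isOpen_inter_preimage O.isOpen O'.isOpen⟩
  let U₁ : TopologicalSpace.Opens M :=
    ⟨O' ∩ ψ.base ⁻¹' O, (hcont hloc').isOpen_inter_preimage O'.isOpen O.isOpen⟩
  have hmap : MapsTo φ.base U₀ U₁ := fun x hx ↦ ⟨hx.2, by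
    have := congrArg TotalSpace.proj (hψφ ⟨x, 0⟩ hx.1 hx.2)
    change ψ.base (φ.base x) = x at this
    rw [mem_preimage, this]
    exact hx.1⟩
  have hmap' : MapsTo ψ.base U₁ U₀ := fun x hx ↦ ⟨hx.2, by
    have := congrArg TotalSpace.proj (hφψ ⟨x, 0⟩ hx.1 hx.2)
    change φ.base (ψ.base x) = x at this
    rw [mem_preimage, this]
    exact hx.1⟩
  refine ⟨U₀, U₁, φ, ?_, ?_, ⟨?_, ψ, ?_, fun z hz ↦ hψφ z hz.1 hz.2, fun z hz ↦ hφψ z hz.1 hz.2⟩,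
    fun x hx u w ↦ ?_, hbase, fun y u ↦ hfix (ι y) (mem_range_self y) u⟩
  · rintro _ ⟨y, rfl⟩
    refine ⟨hSO (mem_range_self y), ?_⟩
    rw [mem_preimage, hbase]
    exact hSO' (mem_range_self y)
  · rintro _ ⟨y, rfl⟩
    refine ⟨hSO' (mem_range_self y), ?_⟩
    rw [mem_preimage, hbase']
    exact hSO (mem_range_self y)
  · exact DMW.isLieMorphism_of_hasLocalForm hmap fun x hx ↦ hloc x hx.1
  · exact DMW.isLieMorphism_of_hasLocalForm hmap' fun x hx ↦ hloc' x hx.1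
  · obtain ⟨p, hp, hxp, f, Φ, hf, hf0, hΦ0, hφ⟩ := hflow x hx.1
    exact DMW.form_eq_of_isFlow hxp (hW p hp) hf (hL p hp) m0 m1 hf0 hΦ0 hφ u w
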